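/- Let $k$ be an algebraically closed field and let $A=\bigoplus_{i\in\mathbb N}A_i$ be an $\mathbb N$-graded $k$-algebra. Let $\operatorname{GrAut}A$ be the group of graded $k$-algebra automorphisms of $A$ and let $G\le\operatorname{GrAut}A$ be a finite subgroup such that $\operatorname{char}k$ does not divide $|G|$. Conventions. The category $\operatorname{GrMod}A$ consists of the $\mathbb Z$-graded right $A$-modules and the $A$-linear maps of degree $0$, and $M(n)_i=M_{n+i}$. The skew group algebra $A*G$ is $A\otimes_k kG$ with $(a\otimes g)(b\otimes h)=a\,g(b)\otimes gh$, graded by $(A*G)_i=A_i\otimes_k kG$. The module $A_0=A/A_{\ge1}$ is a graded right $A$-module, and also a graded right $A*G$-module by $c\cdot(a*g)=g^{-1}(ca)$. For a graded algebra $B$ put $$B^!=\bigoplus_{i\in\mathbb N}\bigoplus_{n\in\mathbb Z}\operatorname{Ext}^i_{\operatorname{GrMod}B}(B_0,B_0(n))$$ with the Yoneda product (composition of chain maps between projective resolutions), graded by $i$. The group $G$ acts on $A^!$ by graded automorphisms, by conjugation: if $P$ is a graded projective resolution of $A_0$ over $A$ to which $G$ acts compatibly with its action on $A$ and $A_0$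 (so $g(xa)=g(x)g(a)$), then $g$ maps the class of a chain map $f$ to the class of $gfg^{-1}$. The algebra $G*A^!$ is $kG\otimes_k A^!$ with $(g\otimes x)(h\otimes y)=gh\otimes h^{-1}(x)\,y$, graded by $(G*A^!)_i=kG\otimes_k (A^!)_i$. A graded algebra $B$ is called Koszul if $\dim_k B_i<\infty$ for all $i$, $B_0$ is semisimple, and $B_0=B/B_{\ge1}$ has a resolution $\cdots\to P^1\to P^0\to B_0\to0$ in $\operatorname{GrMod}B$ in which each $P^i$ is a graded projective right $B$-module generated in degree $i$. Proposition. Suppose that the graded right $A*G$-module $A_0$ has a graded projective resolution consisting of finitely generated graded projective right $A*G$-modules. Then: 1. $(A*G)^!\cong G*A^!$ as graded $k$-algebras; moreover the isomorphism can be chosen so that it also respects the internal grading by $n$. 2. $A$ is Koszul if and only if $A*G$ is Koszul. -/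

import Mathlib

open DirectSum MulOpposite

universe v u

set_option linter.unusedSectionVars false

namespace SkewKoszul

noncomputable section

/-! ### Criteria for internal gradings -/

section Internal

variable {k : Type*} [Field k] {ι : Type*} [DecidableEq ι]

theorem isInternal_of_proj {M : Type*} [AddCommGroup M] [Module k M] (gr : ι → Submodule k M)
    (p : ι → M →ₗ[k] M) (h1 : ∀ n, ∀ x ∈ gr n, p n x = x)
    (h2 : ∀ m n, m ≠ n → ∀ x ∈ gr m, p n x = 0) (h3 : ⨆ n, gr n = ⊤) :
    DirectSum.IsInternal gr := by
  refine DirectSum.isInternal_submodule_of_iSupIndep_of_iSup_eq_top ?_ h3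
  intro n
  rw [Submodule.disjoint_def]
  intro x hx hx'
  have hle : (⨆ j, ⨆ (_ : j ≠ n), gr j) ≤ LinearMap.ker (p n) :=
    iSup₂_le fun j hj y hy => h2 j n hj y hy
  rw [← h1 n x hx]
  exact hle hx'

theorem exists_proj {M : Type*} [AddCommGroup M] [Module k M] (gr : ι → Submodule k M)
    (h : DirectSum.IsInternal gr) :
    ∃ p : ι → M →ₗ[k] M, (∀ n x, p n x ∈ gr n) ∧ (∀ n, ∀ x ∈ gr n, p n x = x) ∧
      (∀ m n, m ≠ n → ∀ x ∈ gr m, p n x = 0) ∧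
      ∀ x, ∃ s : Finset ι, ∑ n ∈ s, p n x = x := by
  classical
  let _ := h.chooseDecomposition
  refine ⟨fun n => (gr n).subtype ∘ₗ DirectSum.component k ι (fun i => gr i) n ∘ₗ
    (DirectSum.decomposeLinearEquiv gr).toLinearMap, ?_, ?_, ?_, ?_⟩
  · intro n x
    exact (DirectSum.decompose gr x n).2
  · intro n x hx
    exact DirectSum.decompose_of_mem_same gr hx
  · intro m n hmn x hx
    exact DirectSum.decompose_of_mem_ne gr hx hmn
  · intro x
    exact ⟨_, DirectSum.sum_support_decompose gr x⟩

end Internal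

section Modules

variable {k : Type v} [Field k] {A : Type u} [Ring A] [Algebra k A]

/-! ### Graded automorphisms and graded right modules -/

/-- The group of graded `k`-algebra automorphisms of `A = ⨁ 𝒜 i`. -/
def GrAut (𝒜 : ℕ → Submodule k A) : Subgroup (A ≃ₐ[k] A) where
  carrier := {σ | ∀ i, ∀ a, σ a ∈ 𝒜 i ↔ a ∈ 𝒜 i}
  mul_mem' := fun {σ τ} hσ hτ i a => by
    rw [AlgEquiv.mul_apply]; exact (hσ i _).trans (hτ i a)
  one_mem' := fun i a => Iff.rfl
  inv_mem' := fun {σ} hσ i a => by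
    rw [← hσ i (σ⁻¹ a), ← AlgEquiv.mul_apply, mul_inv_cancel, AlgEquiv.one_apply]

theorem GrAut.smul_mem_iff (𝒜 : ℕ → Submodule k A) (σ : GrAut 𝒜) {i : ℕ} {a : A} :
    σ • a ∈ 𝒜 i ↔ a ∈ 𝒜 i := σ.2 i a

/-- A `ℤ`-graded right `A`-module; right modules are modules over `Aᵐᵒᵖ`, so that
`op a • x` is `x · a`. -/
structure GrMod (𝒜 : ℕ → Submodule k A) where
  carrier : Type u
  [addCommGroup : AddCommGroup carrier]
  [moduleBase : Module k carrier]
  [module : Module Aᵐᵒᵖ carrier]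
  [isScalarTower : IsScalarTower k Aᵐᵒᵖ carrier]
  gr : ℤ → Submodule k carrier
  isInternal : DirectSum.IsInternal gr
  smul_mem : ∀ (i : ℕ) (n : ℤ) (a : A) (x : carrier),
    a ∈ 𝒜 i → x ∈ gr n → op a • x ∈ gr (n + i)

attribute [instance] GrMod.addCommGroup GrMod.moduleBase GrMod.module GrMod.isScalarTower

instance (𝒜 : ℕ → Submodule k A) : CoeSort (GrMod 𝒜) (Type u) := ⟨GrMod.carrier⟩

instance {𝒜 : ℕ → Submodule k A} (M : GrMod 𝒜) : SMulCommClass Aᵐᵒᵖ k M :=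
  IsScalarTower.to_smulCommClass'

/-- A graded right module is generated in degree `n` if its degree `n` part generates it. -/
def GrMod.GeneratedInDegree {𝒜 : ℕ → Submodule k A} (M : GrMod 𝒜) (n : ℤ) : Prop :=
  Submodule.span Aᵐᵒᵖ (M.gr n : Set M) = ⊤

/-- A graded projective resolution `⋯ → P 2 → P 1 → P 0 → M → 0` in the category of graded right
`A`-modules (with morphisms the `A`-linear maps of degree zero).  A graded module is projective in
that category if and only if it is projective as a module. -/
structure GrProjRes {𝒜 : ℕ → Submodule k A} (M : GrMod 𝒜) where
  P : ℕ → GrMod 𝒜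
  d : ∀ i, P (i + 1) →ₗ[Aᵐᵒᵖ] P i
  ε : P 0 →ₗ[Aᵐᵒᵖ] M
  projective : ∀ i, Module.Projective Aᵐᵒᵖ (P i)
  d_mem : ∀ i n x, x ∈ (P (i + 1)).gr n → d i x ∈ (P i).gr n
  ε_mem : ∀ n x, x ∈ (P 0).gr n → ε x ∈ M.gr n
  ε_surjective : Function.Surjective ε
  exact_zero : Function.Exact (d 0) ε
  exact_succ : ∀ i, Function.Exact (d (i + 1)) (d i)

/-! ### The Ext algebra of a graded module, computed from a graded projective resolution -/

namespace GrProjRes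

variable {𝒜 : ℕ → Submodule k A} {M : GrMod 𝒜} (R : GrProjRes M)

/-- The total module `⨁ i, P i` of a resolution. -/
abbrev Tot : Type u := ⨁ i, R.P i

instance : IsScalarTower k Aᵐᵒᵖ R.Tot :=
  ⟨fun c a x => by ext i; exact smul_assoc c a (x i)⟩

instance : SMulCommClass Aᵐᵒᵖ k R.Tot := IsScalarTower.to_smulCommClass'

/-- The differential of the total module: it maps `P (i + 1)` to `P i` by `d i` and kills `P 0`. -/
def D : R.Tot →ₗ[Aᵐᵒᵖ] R.Tot :=
  DirectSum.toModule Aᵐᵒᵖ ℕ R.Tot fun i => match i with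
    | 0 => 0
    | i + 1 => DirectSum.lof Aᵐᵒᵖ ℕ (fun i => R.P i) i ∘ₗ R.d i

theorem D_apply (x : R.Tot) (i : ℕ) : R.D x i = R.d i (x (i + 1)) := by
  induction x using DirectSum.induction_on with
  | zero => simp
  | add x y hx hy => simp [hx, hy]
  | of j y =>
    change R.D (DirectSum.lof Aᵐᵒᵖ ℕ (fun i => R.P i) j y) i =
      R.d i (DirectSum.lof Aᵐᵒᵖ ℕ (fun i => R.P i) j y (i + 1))
    rw [D, DirectSum.toModule_lof]
    cases j with
    | zero => simp [DirectSum.lof_eq_of, DirectSum.of_eq_of_ne]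
    | succ j =>
      rcases eq_or_ne j i with rfl | h
      · simp [DirectSum.lof_eq_of]
      · rw [LinearMap.comp_apply, DirectSum.lof_eq_of, DirectSum.lof_eq_of,
          DirectSum.of_eq_of_ne _ _ _ h.symm, DirectSum.of_eq_of_ne _ _ _ (by omega), map_zero]

theorem d_d (i : ℕ) (x : R.P (i + 2)) : R.d i (R.d (i + 1) x) = 0 :=
  (R.exact_succ i).apply_apply_eq_zero x

theorem D_D (x : R.Tot) : R.D (R.D x) = 0 := by
  ext i
  rw [D_apply, D_apply, d_d]
  rfl

/-- The part of the total module of homological degree `j` (zero for `j < 0`) and internal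
degree `m`. -/
def piece (j m : ℤ) : Submodule k R.Tot where
  carrier := {x | ∀ i : ℕ, x i ∈ (R.P i).gr m ∧ ((i : ℤ) ≠ j → x i = 0)}
  zero_mem' := fun i => ⟨zero_mem _, fun _ => rfl⟩
  add_mem' := fun {x y} hx hy i =>
    ⟨add_mem (hx i).1 (hy i).1, fun h => by
      rw [DirectSum.add_apply, (hx i).2 h, (hy i).2 h, add_zero]⟩
  smul_mem' := fun c x hx i =>
    ⟨Submodule.smul_mem _ c (hx i).1, fun h => by
      change c • x i = 0
      rw [(hx i).2 h, smul_zero]⟩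

/-- `A`-linear endomorphisms of the total module which lower the homological degree by `p` and
raise the internal degree by `n`; these are the families of morphisms of graded modules
`P (p + j) → P j (n)`. -/
def homPiece (p n : ℤ) : Submodule k (Module.End Aᵐᵒᵖ R.Tot) where
  carrier := {f | ∀ j m : ℤ, ∀ x ∈ R.piece j m, f x ∈ R.piece (j - p) (m + n)}
  zero_mem' := fun _ _ _ _ => zero_mem _
  add_mem' := fun hf hg j m x hx => add_mem (hf j m x hx) (hg j m x hx)
  smul_mem' := fun c _ hf j m x hx => Submodule.smul_mem _ c (hf j m x hx)

/-- Chain maps `P → P[p](n)`: families `P (p + j) → P j (n)` commuting with the differentials. -/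
def cocycle (p n : ℤ) : Submodule k (Module.End Aᵐᵒᵖ R.Tot) where
  carrier := {f | f ∈ R.homPiece p n ∧ R.D * f = f * R.D}
  zero_mem' := ⟨zero_mem _, by simp⟩
  add_mem' := fun hf hg => ⟨add_mem hf.1 hg.1, by rw [mul_add, add_mul, hf.2, hg.2]⟩
  smul_mem' := fun c f hf => ⟨Submodule.smul_mem _ c hf.1, by
    rw [mul_smul_comm, smul_mul_assoc, hf.2]⟩

/-- Null-homotopic chain maps `P → P[p](n)`. -/
def coboundary (p n : ℤ) : Submodule k (Module.End Aᵐᵒᵖ R.Tot) where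
  carrier := {f | ∃ h ∈ R.homPiece (p - 1) n, f = R.D * h + h * R.D}
  zero_mem' := ⟨0, zero_mem _, by simp⟩
  add_mem' := by
    rintro _ _ ⟨h, hh, rfl⟩ ⟨h', hh', rfl⟩
    exact ⟨h + h', add_mem hh hh', by noncomm_ring⟩
  smul_mem' := by
    rintro c _ ⟨h, hh, rfl⟩
    exact ⟨c • h, Submodule.smul_mem _ c hh, by
      rw [mul_smul_comm, smul_mul_assoc, smul_add]⟩

theorem homPiece_mul {p n q m : ℤ} {f g : Module.End Aᵐᵒᵖ R.Tot} (hf : f ∈ R.homPiece p n)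
    (hg : g ∈ R.homPiece q m) : f * g ∈ R.homPiece (p + q) (n + m) := by
  intro j l x hx
  have := hf _ _ _ (hg j l x hx)
  rwa [show j - q - p = j - (p + q) by ring, show l + m + n = l + (n + m) by ring] at this

theorem one_mem_homPiece : (1 : Module.End Aᵐᵒᵖ R.Tot) ∈ R.homPiece 0 0 := by
  intro j m x hx
  simpa using hx

theorem cocycle_mul {p n q m : ℤ} {f g : Module.End Aᵐᵒᵖ R.Tot} (hf : f ∈ R.cocycle p n)
    (hg : g ∈ R.cocycle q m) : f * g ∈ R.cocycle (p + q) (n + m) :=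
  ⟨R.homPiece_mul hf.1 hg.1, by rw [← mul_assoc, hf.2, mul_assoc, hg.2, mul_assoc]⟩

theorem cocycle_mul_coboundary {p n q m : ℤ} {f g : Module.End Aᵐᵒᵖ R.Tot}
    (hf : f ∈ R.cocycle p n) (hg : g ∈ R.coboundary q m) :
    f * g ∈ R.coboundary (p + q) (n + m) := by
  obtain ⟨h, hh, rfl⟩ := hg
  refine ⟨f * h, ?_, ?_⟩
  · rw [show p + q - 1 = p + (q - 1) by ring]
    exact R.homPiece_mul hf.1 hh
  · rw [mul_add, ← mul_assoc, ← hf.2]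
    simp only [mul_assoc]

theorem coboundary_mul_cocycle {p n q m : ℤ} {f g : Module.End Aᵐᵒᵖ R.Tot}
    (hf : f ∈ R.coboundary p n) (hg : g ∈ R.cocycle q m) :
    f * g ∈ R.coboundary (p + q) (n + m) := by
  obtain ⟨h, hh, rfl⟩ := hf
  refine ⟨h * g, ?_, ?_⟩
  · rw [show p + q - 1 = (p - 1) + q by ring]
    exact R.homPiece_mul hh hg.1
  · rw [add_mul, mul_assoc h, hg.2]
    simp only [mul_assoc]

/-- The algebra of finite sums of bihomogeneous chain maps `P → P[p](n)`, `p ∈ ℕ`, `n ∈ ℤ`, with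
composition as multiplication. -/
def cocycles : Subalgebra k (Module.End Aᵐᵒᵖ R.Tot) :=
  (⨆ x : ℕ × ℤ, R.cocycle x.1 x.2).toSubalgebra
    (Submodule.mem_iSup_of_mem ((0 : ℕ), (0 : ℤ)) ⟨R.one_mem_homPiece, by simp⟩)
    (by
      intro f g hf hg
      induction hf using Submodule.iSup_induction' with
      | zero => rw [zero_mul]; exact zero_mem _
      | add x y _ _ hx hy => rw [add_mul]; exact add_mem hx hy
      | mem a f hf =>
        induction hg using Submodule.iSup_induction' with
        | zero => rw [mul_zero]; exact zero_mem _
        | add x y _ _ hx hy => rw [mul_add]; exact add_mem hx hy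
        | mem b g hg =>
          refine Submodule.mem_iSup_of_mem (a + b) ?_
          simpa using R.cocycle_mul hf hg)

/-- The finite sums of bihomogeneous null-homotopic chain maps. -/
def coboundaries : Submodule k (Module.End Aᵐᵒᵖ R.Tot) := ⨆ x : ℕ × ℤ, R.coboundary x.1 x.2

theorem cocycles_mul_coboundaries {f g : Module.End Aᵐᵒᵖ R.Tot} (hf : f ∈ R.cocycles)
    (hg : g ∈ R.coboundaries) : f * g ∈ R.coboundaries := by
  replace hf : f ∈ ⨆ x : ℕ × ℤ, R.cocycle x.1 x.2 := hf
  rw [coboundaries] at hg ⊢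
  induction hf using Submodule.iSup_induction' with
  | zero => rw [zero_mul]; exact zero_mem _
  | add x y _ _ hx hy => rw [add_mul]; exact add_mem hx hy
  | mem a f hf =>
    induction hg using Submodule.iSup_induction' with
    | zero => rw [mul_zero]; exact zero_mem _
    | add x y _ _ hx hy => rw [mul_add]; exact add_mem hx hy
    | mem b g hg =>
      refine Submodule.mem_iSup_of_mem (a + b) ?_
      simpa using R.cocycle_mul_coboundary hf hg

theorem coboundaries_mul_cocycles {f g : Module.End Aᵐᵒᵖ R.Tot} (hf : f ∈ R.coboundaries)
    (hg : g ∈ R.cocycles) : f * g ∈ R.coboundaries := by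
  replace hg : g ∈ ⨆ x : ℕ × ℤ, R.cocycle x.1 x.2 := hg
  rw [coboundaries] at hf ⊢
  induction hf using Submodule.iSup_induction' with
  | zero => rw [zero_mul]; exact zero_mem _
  | add x y _ _ hx hy => rw [add_mul]; exact add_mem hx hy
  | mem a f hf =>
    induction hg using Submodule.iSup_induction' with
    | zero => rw [mul_zero]; exact zero_mem _
    | add x y _ _ hx hy => rw [mul_add]; exact add_mem hx hy
    | mem b g hg =>
      refine Submodule.mem_iSup_of_mem (a + b) ?_
      simpa using R.coboundary_mul_cocycle hf hg

/-- The algebra `cocycles` as a type. -/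
def CocycleAlg : Type u := R.cocycles

instance : Ring R.CocycleAlg := inferInstanceAs (Ring R.cocycles)

instance : Algebra k R.CocycleAlg := inferInstanceAs (Algebra k R.cocycles)

/-- The inclusion of the algebra of chain maps into the endomorphism algebra. -/
def CocycleAlg.val : R.CocycleAlg →ₐ[k] Module.End Aᵐᵒᵖ R.Tot := R.cocycles.val

theorem CocycleAlg.val_mem (z : R.CocycleAlg) : CocycleAlg.val R z ∈ R.cocycles :=
  Subtype.prop (p := fun f => f ∈ R.cocycles) z

theorem CocycleAlg.val_injective : Function.Injective (CocycleAlg.val R) :=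
  Subtype.val_injective

/-- The two-sided ideal of null-homotopic elements. -/
def boundaryIdeal : Ideal R.CocycleAlg where
  carrier := {z | CocycleAlg.val R z ∈ R.coboundaries}
  zero_mem' := by
    change CocycleAlg.val R 0 ∈ R.coboundaries
    rw [map_zero]
    exact zero_mem _
  add_mem' := fun {x y} hx hy => by
    change CocycleAlg.val R (x + y) ∈ R.coboundaries
    rw [map_add]
    exact add_mem hx hy
  smul_mem' := fun c x hx => by
    change CocycleAlg.val R (c * x) ∈ R.coboundaries
    rw [map_mul]
    exact R.cocycles_mul_coboundaries (CocycleAlg.val_mem R c) hx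

theorem mem_boundaryIdeal {z : R.CocycleAlg} :
    z ∈ R.boundaryIdeal ↔ CocycleAlg.val R z ∈ R.coboundaries := Iff.rfl

instance : R.boundaryIdeal.IsTwoSided :=
  ⟨fun {a} b ha => by
    rw [mem_boundaryIdeal, map_mul]
    exact R.coboundaries_mul_cocycles ha (CocycleAlg.val_mem R b)⟩

/-- The Ext algebra `⨁ p ∈ ℕ, ⨁ n ∈ ℤ, Ext^p(M, M(n))` computed from the resolution `R`:
`Ext^p(M, M(n))` is the space of homotopy classes of chain maps `P → P[p](n)`, and the Yoneda
product is the composition of such classes. -/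
abbrev ExtAlg : Type u := R.CocycleAlg ⧸ R.boundaryIdeal

/-- The component `Ext^p(M, M(n))`. -/
def extBigrade (p : ℕ) (n : ℤ) : Submodule k R.ExtAlg :=
  ((R.cocycle p n).comap (CocycleAlg.val R).toLinearMap).map
    (Ideal.Quotient.mkₐ k R.boundaryIdeal).toLinearMap

/-- The component of cohomological degree `p`, the sum over `n` of the `Ext^p(M, M(n))`. -/
def extGrade (p : ℕ) : Submodule k R.ExtAlg := ⨆ n : ℤ, R.extBigrade p n

end GrProjRes

/-! ### The degree zero part as a graded right module -/

section DegZero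

variable (𝒜 : ℕ → Submodule k A) [GradedAlgebra 𝒜]

theorem isInternal_concentrated (V : Type*) [AddCommGroup V] [Module k V] :
    DirectSum.IsInternal (fun n : ℤ => if n = 0 then (⊤ : Submodule k V) else ⊥) := by
  refine isInternal_of_proj _ (fun n => if n = 0 then LinearMap.id else 0) ?_ ?_ ?_
  · intro n x hx
    by_cases h : n = 0 <;> simp_all
  · intro m n hmn x hx
    by_cases h : n = 0
    · subst h
      simp_all
    · simp [h]
  · refine eq_top_iff.2 ?_
    refine le_trans ?_ (le_iSup _ (0 : ℤ))
    simp

/-- The right `A`-module structure `c · a = c a₀` on `A₀ = A / A_{≥ 1}`. -/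
@[reducible] def degZeroModule : Module Aᵐᵒᵖ (𝒜 0) where
  smul a c := c * GradedRing.projZeroRingHom' 𝒜 (unop a)
  one_smul c := by
    change c * GradedRing.projZeroRingHom' 𝒜 1 = c
    rw [map_one, mul_one]
  mul_smul a b c := by
    change c * GradedRing.projZeroRingHom' 𝒜 (unop b * unop a) =
      (c * GradedRing.projZeroRingHom' 𝒜 (unop b)) * GradedRing.projZeroRingHom' 𝒜 (unop a)
    rw [map_mul, mul_assoc]
  smul_zero a := zero_mul _
  smul_add a b c := add_mul _ _ _
  zero_smul c := by
    change c * GradedRing.projZeroRingHom' 𝒜 0 = 0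
    rw [map_zero, mul_zero]
  add_smul a b c := by
    change c * GradedRing.projZeroRingHom' 𝒜 (unop a + unop b) = _
    rw [map_add, mul_add]
    rfl

/-- `A₀ = A / A_{≥ 1}` as a graded right `A`-module, concentrated in degree `0`. -/
def degZero : GrMod 𝒜 where
  carrier := 𝒜 0
  module := degZeroModule 𝒜
  isScalarTower := letI := degZeroModule 𝒜
    ⟨fun r a c => by
      apply Subtype.ext
      change (c : A) * ((GradedRing.projZeroRingHom' 𝒜 (r • unop a) : 𝒜 0) : A) =
        r • ((c : A) * ((GradedRing.projZeroRingHom' 𝒜 (unop a) : 𝒜 0) : A))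
      rw [← mul_smul_comm]
      congr 1
      simp [DirectSum.decompose_smul]
      rfl⟩
  gr n := if n = 0 then ⊤ else ⊥
  isInternal := isInternal_concentrated (𝒜 0)
  smul_mem i n a x ha hx := by
    by_cases hn : n = 0
    · subst hn
      rcases Nat.eq_zero_or_pos i with rfl | hi
      · simp
      · have : GradedRing.projZeroRingHom' 𝒜 a = 0 := by
          apply Subtype.ext
          rw [GradedRing.coe_projZeroRingHom'_apply, GradedRing.projZeroRingHom_apply]
          exact DirectSum.decompose_of_mem_ne 𝒜 ha hi.ne'
        have h0 : x * GradedRing.projZeroRingHom' 𝒜 a = 0 := by rw [this, mul_zero]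
        change x * GradedRing.projZeroRingHom' 𝒜 a ∈ _
        rw [h0]
        exact zero_mem _
    · rw [if_neg hn, Submodule.mem_bot] at hx
      subst hx
      change (0 : 𝒜 0) * GradedRing.projZeroRingHom' 𝒜 a ∈ _
      rw [zero_mul]
      exact zero_mem _

end DegZero

/-! ### Equivariant graded modules and the standard free resolution -/

/-- A graded right `A`-module with a compatible degree preserving action of the group of graded
automorphisms of `A`, i.e. `σ (x · a) = σ x · σ a`. -/
structure EqGrMod (𝒜 : ℕ → Submodule k A) extends GrMod 𝒜 where
  act : GrAut 𝒜 →* Module.End k carrier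
  act_smul : ∀ (σ : GrAut 𝒜) (a : A) (x : carrier), act σ (op a • x) = op (σ • a) • act σ x
  act_mem : ∀ (σ : GrAut 𝒜) (n : ℤ) (x : carrier), x ∈ gr n → act σ x ∈ gr n

instance (𝒜 : ℕ → Submodule k A) : CoeSort (EqGrMod 𝒜) (Type u) := ⟨fun M => M.carrier⟩

/-- The grading of `A` extended by zero to a `ℤ`-grading. -/
def zGr (𝒜 : ℕ → Submodule k A) (n : ℤ) : Submodule k A := if 0 ≤ n then 𝒜 n.toNat else ⊥

section Std

variable {𝒜 : ℕ → Submodule k A}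

theorem isInternal_zGr [GradedAlgebra 𝒜] : DirectSum.IsInternal (zGr 𝒜) := by
  obtain ⟨p, hp, hp1, hp2, hp3⟩ := exists_proj 𝒜 (DirectSum.Decomposition.isInternal 𝒜)
  refine isInternal_of_proj _ (fun n => if 0 ≤ n then p n.toNat else 0) ?_ ?_ ?_
  · intro n x hx
    by_cases h : 0 ≤ n
    · simp only [zGr, if_pos h] at hx ⊢
      exact hp1 _ _ hx
    · simp only [zGr, if_neg h, Submodule.mem_bot] at hx ⊢
      simp [hx]
  · intro m n hmn x hx
    by_cases h : 0 ≤ n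
    · by_cases h' : 0 ≤ m
      · simp only [zGr, if_pos h, if_pos h'] at hx ⊢
        exact hp2 _ _ (by omega) _ hx
      · simp only [zGr, if_neg h', Submodule.mem_bot] at hx
        simp [hx]
    · simp [if_neg h]
  · rw [eq_top_iff]
    intro x _
    obtain ⟨s, hs⟩ := hp3 x
    rw [← hs]
    refine sum_mem fun n _ => Submodule.mem_iSup_of_mem (n : ℤ) ?_
    simpa [zGr] using hp n x

theorem zGr_mul_mem [GradedAlgebra 𝒜] {n : ℤ} {i : ℕ} {x a : A} (hx : x ∈ zGr 𝒜 n)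
    (ha : a ∈ 𝒜 i) : x * a ∈ zGr 𝒜 (n + i) := by
  by_cases h : 0 ≤ n
  · have h' : 0 ≤ n + i := by omega
    have e : (n + i).toNat = n.toNat + i := by omega
    simp only [zGr, if_pos h, if_pos h'] at hx ⊢
    rw [e]
    exact SetLike.mul_mem_graded hx ha
  · simp only [zGr, if_neg h, Submodule.mem_bot] at hx
    simp [hx]

theorem smul_mem_zGr (σ : GrAut 𝒜) {n : ℤ} {x : A} (hx : x ∈ zGr 𝒜 n) : σ • x ∈ zGr 𝒜 n := by
  by_cases h : 0 ≤ n
  · simp only [zGr, if_pos h] at hx ⊢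
    exact (GrAut.smul_mem_iff 𝒜 σ).2 hx
  · simp only [zGr, if_neg h, Submodule.mem_bot] at hx ⊢
    simp [hx]

variable (M : EqGrMod 𝒜)

/-- The homogeneous elements of a graded module, with their degrees. -/
abbrev HomogElt : Type u := Σ n : ℤ, M.gr n

/-- The action of a graded automorphism on homogeneous elements. -/
def HomogElt.map (σ : GrAut 𝒜) (i : HomogElt M) : HomogElt M :=
  ⟨i.1, M.act σ i.2, M.act_mem σ i.1 i.2 i.2.2⟩

/-- The degree `d` part of the free module on the homogeneous elements of `M`, the basis element
given by an element of degree `n` being placed in degree `n`. -/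
def freeGr (d : ℤ) : Submodule k (HomogElt M →₀ A) where
  carrier := {f | ∀ i, f i ∈ zGr 𝒜 (d - i.1)}
  zero_mem' := fun _ => zero_mem _
  add_mem' := fun hf hg i => add_mem (hf i) (hg i)
  smul_mem' := fun c _ hf i => Submodule.smul_mem _ c (hf i)

theorem single_mem_freeGr {d : ℤ} {i : HomogElt M} {a : A} (ha : a ∈ zGr 𝒜 (d - i.1)) :
    Finsupp.single i a ∈ freeGr M d := by
  classical
  intro j
  rw [Finsupp.single_apply]
  split_ifs with h
  · exact h ▸ ha
  · exact zero_mem _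

theorem isInternal_freeGr [GradedAlgebra 𝒜] : DirectSum.IsInternal (freeGr M) := by
  obtain ⟨p, hp, hp1, hp2, hp3⟩ := exists_proj (zGr 𝒜) isInternal_zGr
  have key : ∀ d f j, (Finsupp.lsum k fun i : HomogElt M =>
      Finsupp.lsingle (R := k) i ∘ₗ p (d - i.1)) f j = p (d - j.1) (f j) := by
    classical
    intro d f j
    induction f using Finsupp.induction_linear with
    | zero => simp
    | add f g hf hg => rw [map_add, Finsupp.add_apply, hf, hg, Finsupp.add_apply, map_add]
    | single i a =>
      rw [Finsupp.lsum_single, LinearMap.comp_apply, Finsupp.lsingle_apply, Finsupp.single_apply,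
        Finsupp.single_apply]
      split_ifs with h
      · rw [h]
      · rw [map_zero]
  refine isInternal_of_proj _ (fun d => Finsupp.lsum k fun i : HomogElt M =>
      Finsupp.lsingle (R := k) i ∘ₗ p (d - i.1)) ?_ ?_ ?_
  · intro d f hf
    ext j
    rw [key, hp1 _ _ (hf j)]
  · intro m n hmn f hf
    ext j
    rw [key, hp2 _ _ (by omega) _ (hf j)]
    rfl
  · rw [eq_top_iff]
    intro f _
    induction f using Finsupp.induction_linear with
    | zero => exact zero_mem _
    | add f g hf hg => exact add_mem (hf trivial) (hg trivial)
    | single i a =>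
      obtain ⟨s, hs⟩ := hp3 a
      rw [← hs, ← Finsupp.lsingle_apply (R := k), map_sum]
      refine sum_mem fun n _ => Submodule.mem_iSup_of_mem (n + i.1) ?_
      exact single_mem_freeGr M (by simpa using hp n a)

/-- The action on the free module: `σ` maps the basis element of `x`, times `a`, to the basis
element of `σ x`, times `σ a`. -/
def freeAct (σ : GrAut 𝒜) : Module.End k (HomogElt M →₀ A) :=
  Finsupp.lsum k fun i => Finsupp.lsingle (R := k) (HomogElt.map M σ i) ∘ₗ
    (σ : A ≃ₐ[k] A).toLinearMap

theorem freeAct_single (σ : GrAut 𝒜) (i : HomogElt M) (a : A) :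
    freeAct M σ (Finsupp.single i a) = Finsupp.single (HomogElt.map M σ i) (σ • a) := by
  rw [freeAct, Finsupp.lsum_single]
  rfl

/-- The graded free right `A`-module on the homogeneous elements of `M`. -/
def freeCover [GradedAlgebra 𝒜] : EqGrMod 𝒜 where
  carrier := HomogElt M →₀ A
  gr := freeGr M
  isInternal := isInternal_freeGr M
  isScalarTower := ⟨fun c a f => by
    ext i
    change f i * (c • unop a) = c • (f i * unop a)
    rw [mul_smul_comm]⟩
  smul_mem i n a f ha hf j := by
    change f j * a ∈ _
    rw [show n + (i : ℤ) - j.1 = n - j.1 + i by ring]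
    exact zGr_mul_mem (hf j) ha
  act :=
    { toFun := freeAct M
      map_one' := by
        refine LinearMap.ext fun f => ?_
        induction f using Finsupp.induction_linear with
        | zero => simp
        | add f g hf hg => rw [map_add, hf, hg, map_add]
        | single i a =>
          rw [freeAct_single, one_smul]
          simp [HomogElt.map]
      map_mul' := fun σ τ => by
        refine LinearMap.ext fun f => ?_
        induction f using Finsupp.induction_linear with
        | zero => simp
        | add f g hf hg => rw [map_add, hf, hg, map_add]
        | single i a =>
          rw [Module.End.mul_apply, freeAct_single, freeAct_single, freeAct_single, mul_smul]
          simp [HomogElt.map] }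
  act_smul σ a f := by
    change freeAct M σ (op a • f) = op (σ • a) • freeAct M σ f
    induction f using Finsupp.induction_linear with
    | zero => simp
    | add f g hf hg => rw [smul_add, map_add, hf, hg, map_add, smul_add]
    | single i b =>
      rw [Finsupp.smul_single, freeAct_single, freeAct_single, Finsupp.smul_single]
      simp
  act_mem σ n f hf := by
    change freeAct M σ f ∈ _
    rw [freeAct, Finsupp.lsum_apply]
    refine sum_mem fun i _ => single_mem_freeGr M (smul_mem_zGr σ ?_)
    exact hf i

/-- The map `a ↦ x · a`. -/
def orbitMap (x : M) : A →ₗ[Aᵐᵒᵖ] M where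
  toFun a := op a • x
  map_add' a b := by rw [op_add, add_smul]
  map_smul' c a := by
    change op (a * unop c) • x = c • op a • x
    rw [op_mul, op_unop, mul_smul]

variable [GradedAlgebra 𝒜]

/-- The canonical surjection from the free cover, mapping a basis element to the homogeneous
element that it stands for. -/
def coverMap : freeCover M →ₗ[Aᵐᵒᵖ] M := Finsupp.lsum ℕ fun i => orbitMap M i.2

theorem coverMap_single (i : HomogElt M) (a : A) :
    coverMap M (Finsupp.single i a : HomogElt M →₀ A) = op a • (i.2 : M) :=
  Finsupp.lsum_single ..

theorem coverMap_mem (n : ℤ) (f : freeCover M) (hf : f ∈ (freeCover M).gr n) :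
    coverMap M f ∈ M.gr n := by
  change HomogElt M →₀ A at f
  change Finsupp.sum f _ ∈ _
  refine sum_mem fun i _ => ?_
  have h : f i ∈ zGr 𝒜 (n - i.1) := hf i
  change op (f i) • (i.2 : M) ∈ _
  by_cases h0 : 0 ≤ n - i.1
  · rw [zGr, if_pos h0] at h
    have := M.smul_mem _ _ _ _ h i.2.2
    rwa [show i.1 + ((n - i.1).toNat : ℤ) = n by omega] at this
  · rw [zGr, if_neg h0, Submodule.mem_bot] at h
    rw [h, op_zero, zero_smul]
    exact zero_mem _

theorem coverMap_act (σ : GrAut 𝒜) (f : freeCover M) :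
    coverMap M ((freeCover M).act σ f) = M.act σ (coverMap M f) := by
  change HomogElt M →₀ A at f
  change coverMap M (freeAct M σ f) = _
  induction f using Finsupp.induction_linear with
  | zero => exact (map_zero (coverMap M)).trans ((map_zero (M.act σ)).symm.trans
      (congrArg (M.act σ) (map_zero (coverMap M)).symm))
  | add f g hf hg =>
    rw [map_add]
    erw [map_add (coverMap M), map_add (coverMap M), map_add, hf, hg]
  | single i b =>
    rw [freeAct_single]
    erw [coverMap_single, coverMap_single]
    rw [M.act_smul]
    rfl

theorem coverMap_surjective : Function.Surjective (coverMap M) := by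
  obtain ⟨p, hp, -, -, hp3⟩ := exists_proj M.gr M.isInternal
  intro x
  obtain ⟨s, hs⟩ := hp3 x
  rw [← hs]
  refine ⟨∑ n ∈ s, (Finsupp.single ⟨n, p n x, hp n x⟩ 1 : HomogElt M →₀ A), ?_⟩
  erw [map_sum (coverMap M)]
  refine Finset.sum_congr rfl fun n _ => ?_
  erw [coverMap_single]
  rw [op_one, one_smul]

theorem freeCover_projective : Module.Projective Aᵐᵒᵖ (freeCover M) := by
  let e : Aᵐᵒᵖ ≃ₗ[Aᵐᵒᵖ] A :=
    { toFun := unop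
      invFun := op
      left_inv := fun _ => rfl
      right_inv := fun _ => rfl
      map_add' := fun _ _ => rfl
      map_smul' := fun _ _ => rfl }
  have : Module.Free Aᵐᵒᵖ A := Module.Free.of_equiv e
  change Module.Projective Aᵐᵒᵖ (HomogElt M →₀ A)
  infer_instance

/-- The kernel of the canonical surjection `freeCover M → M`. -/
def syzygy : EqGrMod 𝒜 where
  carrier := LinearMap.ker (coverMap M)
  gr n := ((freeCover M).gr n).comap ((LinearMap.ker (coverMap M)).subtype.restrictScalars k)
  isInternal := by
    obtain ⟨p, hp, hp1, hp2, hp3⟩ := exists_proj _ (freeCover M).isInternal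
    obtain ⟨q, hq, hq1, hq2, hq3⟩ := exists_proj _ M.isInternal
    have hpq : ∀ n x, coverMap M (p n x) = q n (coverMap M x) := by
      intro n x
      obtain ⟨s, hs⟩ := hp3 x
      rw [← hs]
      simp only [map_sum]
      refine Finset.sum_congr rfl fun m _ => ?_
      rcases eq_or_ne m n with rfl | h
      · rw [hp1 _ _ (hp m x), hq1 _ _ (coverMap_mem M _ _ (hp m x))]
      · rw [hp2 _ _ h _ (hp m x), hq2 _ _ h _ (coverMap_mem M _ _ (hp m x)), map_zero]
    have hker : ∀ n (x : LinearMap.ker (coverMap M)),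
        (p n ∘ₗ (LinearMap.ker (coverMap M)).subtype.restrictScalars k) x ∈
          (LinearMap.ker (coverMap M)).restrictScalars k := by
      intro n x
      change coverMap M (p n x) = 0
      rw [hpq, LinearMap.mem_ker.1 x.2, map_zero]
    refine isInternal_of_proj _ (fun n =>
      ((p n ∘ₗ (LinearMap.ker (coverMap M)).subtype.restrictScalars k).codRestrict
        ((LinearMap.ker (coverMap M)).restrictScalars k) (hker n))) ?_ ?_ ?_
    · intro n x hx
      exact Subtype.ext (hp1 n x hx)
    · intro m n hmn x hx
      exact Subtype.ext (hp2 m n hmn x hx)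
    · rw [eq_top_iff]
      intro x _
      obtain ⟨s, hs⟩ := hp3 (x : freeCover M)
      have hx : x = ∑ n ∈ s, (⟨p n x, hker n x⟩ : LinearMap.ker (coverMap M)) := by
        apply Subtype.ext
        rw [AddSubmonoidClass.coe_finsetSum]
        exact hs.symm
      rw [hx]
      exact sum_mem fun n _ => Submodule.mem_iSup_of_mem n (hp n x)
  smul_mem i n a x ha hx := (freeCover M).smul_mem i n a x ha hx
  act :=
    { toFun := fun σ => ((freeCover M).act σ ∘ₗ
          (LinearMap.ker (coverMap M)).subtype.restrictScalars k).codRestrict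
          ((LinearMap.ker (coverMap M)).restrictScalars k) (fun x => by
            change coverMap M ((freeCover M).act σ x) = 0
            rw [coverMap_act, LinearMap.mem_ker.1 x.2, map_zero])
      map_one' := by
        refine LinearMap.ext fun x => Subtype.ext ?_
        change (freeCover M).act 1 x = x
        rw [map_one]
        rfl
      map_mul' := fun σ τ => by
        refine LinearMap.ext fun x => Subtype.ext ?_
        change (freeCover M).act (σ * τ) x = (freeCover M).act σ ((freeCover M).act τ x)
        rw [map_mul]
        rfl }
  act_smul σ a x := Subtype.ext ((freeCover M).act_smul σ a x)
  act_mem σ n x hx := (freeCover M).act_mem σ n x hx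

/-- The inclusion of the syzygy module. -/
def syzygyIncl : syzygy M →ₗ[Aᵐᵒᵖ] freeCover M := (LinearMap.ker (coverMap M)).subtype

/-- The iterated syzygy modules. -/
def iterSyzygy : ℕ → EqGrMod 𝒜
  | 0 => M
  | i + 1 => syzygy (iterSyzygy i)

/-- The terms of the standard free resolution. -/
def stdP (i : ℕ) : EqGrMod 𝒜 := freeCover (iterSyzygy M i)

/-- The differentials `freeCover (syzygy K) → syzygy K → freeCover K` of the standard
resolution. -/
def stdD (i : ℕ) : stdP M (i + 1) →ₗ[Aᵐᵒᵖ] stdP M i :=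
  syzygyIncl (iterSyzygy M i) ∘ₗ coverMap (syzygy (iterSyzygy M i))

theorem syzygyIncl_injective : Function.Injective (syzygyIncl M) := Subtype.val_injective

theorem stdD_act (σ : GrAut 𝒜) (i : ℕ) (x : stdP M (i + 1)) :
    stdD M i ((stdP M (i + 1)).act σ x) = (stdP M i).act σ (stdD M i x) :=
  congrArg (syzygyIncl (iterSyzygy M i)) (coverMap_act (syzygy (iterSyzygy M i)) σ x)

/-- The standard graded free resolution of `M`. -/
def stdRes : GrProjRes M.toGrMod where
  P i := (stdP M i).toGrMod
  d := stdD M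
  ε := coverMap M
  projective i := freeCover_projective _
  d_mem i n x hx := coverMap_mem (syzygy (iterSyzygy M i)) n x hx
  ε_mem := coverMap_mem M
  ε_surjective := coverMap_surjective M
  exact_zero := by
    intro y
    constructor
    · intro hy
      obtain ⟨x, hx⟩ := coverMap_surjective (syzygy M) ⟨y, hy⟩
      exact ⟨x, congrArg (syzygyIncl M) hx⟩
    · rintro ⟨x, rfl⟩
      exact Subtype.prop (coverMap (syzygy M) x)
  exact_succ i := by
    intro y
    constructor
    · intro hy
      have hy' : coverMap (iterSyzygy M (i + 1)) y = 0 := syzygyIncl_injective _ hy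
      obtain ⟨x, hx⟩ := coverMap_surjective (syzygy (iterSyzygy M (i + 1))) ⟨y, hy'⟩
      exact ⟨x, congrArg (syzygyIncl (iterSyzygy M (i + 1))) hx⟩
    · rintro ⟨x, rfl⟩
      have : coverMap (iterSyzygy M (i + 1)) (stdD M (i + 1) x) = 0 :=
        Subtype.prop (coverMap (syzygy (iterSyzygy M (i + 1))) x)
      change syzygyIncl (iterSyzygy M i) (coverMap (iterSyzygy M (i + 1)) (stdD M (i + 1) x)) = 0
      rw [this]
      exact map_zero (syzygyIncl (iterSyzygy M i))

/-- The action of a graded automorphism on the total module of the standard resolution. -/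
def totAct (σ : GrAut 𝒜) : (stdRes M).Tot →ₗ[k] (stdRes M).Tot :=
  DFinsupp.mapRange.linearMap fun i => (stdP M i).act σ

theorem totAct_apply (σ : GrAut 𝒜) (x : (stdRes M).Tot) (i : ℕ) :
    totAct M σ x i = (stdP M i).act σ (x i) := rfl

theorem totAct_one : totAct M (1 : GrAut 𝒜) = LinearMap.id := by
  refine LinearMap.ext fun x => DFinsupp.ext fun i => ?_
  rw [totAct_apply, map_one]
  rfl

theorem totAct_mul (σ τ : GrAut 𝒜) : totAct M (σ * τ) = totAct M σ ∘ₗ totAct M τ := by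
  refine LinearMap.ext fun x => DFinsupp.ext fun i => ?_
  rw [totAct_apply, map_mul]
  rfl

theorem totAct_totAct (σ τ : GrAut 𝒜) (x : (stdRes M).Tot) :
    totAct M σ (totAct M τ x) = totAct M (σ * τ) x := by
  rw [totAct_mul]
  rfl

theorem totAct_smul (σ : GrAut 𝒜) (a : A) (x : (stdRes M).Tot) :
    totAct M σ (op a • x) = op (σ • a) • totAct M σ x :=
  DFinsupp.ext fun i => (stdP M i).act_smul σ a (x i)

theorem totAct_D (σ : GrAut 𝒜) (x : (stdRes M).Tot) :
    (stdRes M).D (totAct M σ x) = totAct M σ ((stdRes M).D x) := by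
  refine DFinsupp.ext fun i => ?_
  refine ((stdRes M).D_apply _ i).trans ?_
  refine Eq.trans ?_ (congrArg ((stdP M i).act σ) ((stdRes M).D_apply x i)).symm
  exact stdD_act M σ i (x (i + 1))

theorem totAct_mem_piece (σ : GrAut 𝒜) {j m : ℤ} {x : (stdRes M).Tot}
    (hx : x ∈ (stdRes M).piece j m) : totAct M σ x ∈ (stdRes M).piece j m := by
  intro i
  refine ⟨(stdP M i).act_mem σ m _ (hx i).1, fun h => ?_⟩
  rw [totAct_apply, (hx i).2 h]
  exact map_zero ((stdP M i).act σ)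

/-- The conjugation `f ↦ σ f σ⁻¹` of `A`-linear endomorphisms of the standard resolution. -/
def conj (σ : GrAut 𝒜) :
    Module.End Aᵐᵒᵖ (stdRes M).Tot →ₐ[k] Module.End Aᵐᵒᵖ (stdRes M).Tot where
  toFun f :=
    { toFun := fun x => totAct M σ (f (totAct M σ⁻¹ x))
      map_add' := fun x y => by simp only [map_add]
      map_smul' := fun a x => by
        obtain ⟨a, rfl⟩ := op_surjective a
        rw [totAct_smul, map_smul, totAct_smul, smul_inv_smul, RingHom.id_apply] }
  map_one' := by
    refine LinearMap.ext fun x => ?_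
    change totAct M σ (totAct M σ⁻¹ x) = x
    rw [totAct_totAct, mul_inv_cancel, totAct_one]
    rfl
  map_mul' f g := by
    refine LinearMap.ext fun x => ?_
    change totAct M σ (f (g (totAct M σ⁻¹ x))) =
      totAct M σ (f (totAct M σ⁻¹ (totAct M σ (g (totAct M σ⁻¹ x)))))
    rw [totAct_totAct M σ⁻¹ σ, inv_mul_cancel, totAct_one]
    rfl
  map_zero' := LinearMap.ext fun x => map_zero (totAct M σ)
  map_add' f g := LinearMap.ext fun x => map_add (totAct M σ) _ _
  commutes' c := by
    refine LinearMap.ext fun x => ?_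
    change totAct M σ (c • totAct M σ⁻¹ x) = c • x
    rw [map_smul, totAct_totAct, mul_inv_cancel, totAct_one]
    rfl

theorem conj_apply (σ : GrAut 𝒜) (f : Module.End Aᵐᵒᵖ (stdRes M).Tot) (x : (stdRes M).Tot) :
    conj M σ f x = totAct M σ (f (totAct M σ⁻¹ x)) := rfl

theorem conj_one (f : Module.End Aᵐᵒᵖ (stdRes M).Tot) : conj M 1 f = f := by
  refine LinearMap.ext fun x => ?_
  rw [conj_apply, inv_one, totAct_one]
  rfl

theorem conj_mul (σ τ : GrAut 𝒜) (f : Module.End Aᵐᵒᵖ (stdRes M).Tot) :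
    conj M (σ * τ) f = conj M σ (conj M τ f) := by
  refine LinearMap.ext fun x => ?_
  rw [conj_apply, conj_apply, conj_apply, totAct_totAct, totAct_totAct, mul_inv_rev]

theorem conj_D (σ : GrAut 𝒜) : conj M σ (stdRes M).D = (stdRes M).D := by
  refine LinearMap.ext fun x => ?_
  rw [conj_apply, ← totAct_D, totAct_totAct, mul_inv_cancel, totAct_one]
  rfl

theorem conj_mem_homPiece (σ : GrAut 𝒜) {p n : ℤ} {f : Module.End Aᵐᵒᵖ (stdRes M).Tot}
    (hf : f ∈ (stdRes M).homPiece p n) : conj M σ f ∈ (stdRes M).homPiece p n :=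
  fun j m _ hx => totAct_mem_piece M σ (hf j m _ (totAct_mem_piece M σ⁻¹ hx))

theorem conj_mem_cocycle (σ : GrAut 𝒜) {p n : ℤ} {f : Module.End Aᵐᵒᵖ (stdRes M).Tot}
    (hf : f ∈ (stdRes M).cocycle p n) : conj M σ f ∈ (stdRes M).cocycle p n := by
  refine ⟨conj_mem_homPiece M σ hf.1, ?_⟩
  conv_lhs => rw [← conj_D M σ, ← map_mul, hf.2, map_mul, conj_D]

theorem conj_mem_coboundary (σ : GrAut 𝒜) {p n : ℤ} {f : Module.End Aᵐᵒᵖ (stdRes M).Tot}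
    (hf : f ∈ (stdRes M).coboundary p n) : conj M σ f ∈ (stdRes M).coboundary p n := by
  obtain ⟨h, hh, rfl⟩ := hf
  exact ⟨conj M σ h, conj_mem_homPiece M σ hh, by rw [map_add, map_mul, map_mul, conj_D]⟩

theorem conj_mem_cocycles (σ : GrAut 𝒜) {f : Module.End Aᵐᵒᵖ (stdRes M).Tot}
    (hf : f ∈ (stdRes M).cocycles) : conj M σ f ∈ (stdRes M).cocycles := by
  have hle : (⨆ x : ℕ × ℤ, (stdRes M).cocycle x.1 x.2) ≤
      (⨆ x : ℕ × ℤ, (stdRes M).cocycle x.1 x.2).comap (conj M σ).toLinearMap :=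
    iSup_le fun x f hf => Submodule.mem_iSup_of_mem x (conj_mem_cocycle M σ hf)
  exact hle hf

theorem conj_mem_coboundaries (σ : GrAut 𝒜) {f : Module.End Aᵐᵒᵖ (stdRes M).Tot}
    (hf : f ∈ (stdRes M).coboundaries) : conj M σ f ∈ (stdRes M).coboundaries := by
  have hle : (⨆ x : ℕ × ℤ, (stdRes M).coboundary x.1 x.2) ≤
      (⨆ x : ℕ × ℤ, (stdRes M).coboundary x.1 x.2).comap (conj M σ).toLinearMap :=
    iSup_le fun x f hf => Submodule.mem_iSup_of_mem x (conj_mem_coboundary M σ hf)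
  exact hle hf

/-- Conjugation by a graded automorphism on the algebra of chain maps. -/
def conjCocycle (σ : GrAut 𝒜) : (stdRes M).CocycleAlg →ₐ[k] (stdRes M).CocycleAlg :=
  ((conj M σ).comp (GrProjRes.CocycleAlg.val (stdRes M))).codRestrict (stdRes M).cocycles
    fun x => conj_mem_cocycles M σ (GrProjRes.CocycleAlg.val_mem _ x)

theorem val_conjCocycle (σ : GrAut 𝒜) (z : (stdRes M).CocycleAlg) :
    GrProjRes.CocycleAlg.val _ (conjCocycle M σ z) =
      conj M σ (GrProjRes.CocycleAlg.val _ z) := rfl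

/-- The induced map on the Ext algebra. -/
def extAct (σ : GrAut 𝒜) : (stdRes M).ExtAlg →ₐ[k] (stdRes M).ExtAlg :=
  Ideal.quotientMapₐ _ (conjCocycle M σ) fun z hz => by
    change GrProjRes.CocycleAlg.val _ (conjCocycle M σ z) ∈ (stdRes M).coboundaries
    rw [val_conjCocycle]
    exact conj_mem_coboundaries M σ hz

theorem extAct_mk (σ : GrAut 𝒜) (z : (stdRes M).CocycleAlg) :
    extAct M σ (Ideal.Quotient.mk _ z) = Ideal.Quotient.mk _ (conjCocycle M σ z) := rfl

/-- The action of graded automorphisms on the Ext algebra: the class of a chain map `f` is mapped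
to the class of `σ f σ⁻¹`. -/
instance extMulSemiringAction : MulSemiringAction (GrAut 𝒜) (stdRes M).ExtAlg where
  smul σ := extAct M σ
  one_smul x := by
    obtain ⟨z, rfl⟩ := Ideal.Quotient.mk_surjective x
    change extAct M 1 _ = _
    rw [extAct_mk]
    congr 1
    apply GrProjRes.CocycleAlg.val_injective
    rw [val_conjCocycle, conj_one]
  mul_smul σ τ x := by
    obtain ⟨z, rfl⟩ := Ideal.Quotient.mk_surjective x
    change extAct M (σ * τ) _ = extAct M σ (extAct M τ _)
    rw [extAct_mk, extAct_mk, extAct_mk]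
    congr 1
    apply GrProjRes.CocycleAlg.val_injective
    rw [val_conjCocycle, val_conjCocycle, val_conjCocycle, conj_mul]
  smul_zero σ := map_zero (extAct M σ)
  smul_add σ := map_add (extAct M σ)
  smul_one σ := map_one (extAct M σ)
  smul_mul σ := map_mul (extAct M σ)

instance : SMulCommClass (GrAut 𝒜) k (stdRes M).ExtAlg := ⟨fun σ c x => map_smul (extAct M σ) c x⟩

end Std

/-! ### The algebra `A^!` and the Koszul property -/

section Koszul

variable (𝒜 : ℕ → Submodule k A) [GradedAlgebra 𝒜]

/-- The action of a graded automorphism on `A₀`. -/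
def degZeroAct (σ : GrAut 𝒜) : Module.End k (𝒜 0) :=
  (σ : A ≃ₐ[k] A).toLinearMap.restrict fun _ h => (GrAut.smul_mem_iff 𝒜 σ).2 h

/-- Graded automorphisms commute with taking the component of degree zero. -/
theorem smul_projZero (σ : GrAut 𝒜) (a : A) :
    (GradedRing.projZeroRingHom' 𝒜 (σ • a) : A) = σ • (GradedRing.projZeroRingHom' 𝒜 a : A) := by
  rw [GradedRing.coe_projZeroRingHom'_apply, GradedRing.coe_projZeroRingHom'_apply,
    GradedRing.projZeroRingHom_apply, GradedRing.projZeroRingHom_apply]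
  induction a using DirectSum.Decomposition.inductionOn 𝒜 with
  | zero => simp
  | add a b ha hb => simp [smul_add, DirectSum.decompose_add, ha, hb]
  | @homogeneous i a =>
    have h : σ • (a : A) ∈ 𝒜 i := (GrAut.smul_mem_iff 𝒜 σ).2 a.2
    rcases eq_or_ne i 0 with rfl | hi
    · rw [DirectSum.decompose_of_mem_same 𝒜 h, DirectSum.decompose_of_mem_same 𝒜 a.2]
    · rw [DirectSum.decompose_of_mem_ne 𝒜 h hi, DirectSum.decompose_of_mem_ne 𝒜 a.2 hi, smul_zero]

/-- `A₀` as a graded right `A`-module with its action of the graded automorphisms. -/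
def degZeroEq : EqGrMod 𝒜 where
  toGrMod := degZero 𝒜
  act :=
    { toFun := degZeroAct 𝒜
      map_one' := rfl
      map_mul' := fun _ _ => rfl }
  act_smul σ a c := by
    refine Subtype.ext ?_
    change 𝒜 0 at c
    change σ • ((c : A) * (GradedRing.projZeroRingHom' 𝒜 a : A)) =
      (σ • (c : A)) * (GradedRing.projZeroRingHom' 𝒜 (σ • a) : A)
    rw [smul_mul', smul_projZero]
  act_mem σ n c hc := by
    change c ∈ (if n = 0 then ⊤ else ⊥ : Submodule k (𝒜 0)) at hc
    change degZeroAct 𝒜 σ c ∈ (if n = 0 then ⊤ else ⊥ : Submodule k (𝒜 0))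
    split_ifs at hc ⊢ with h
    · trivial
    · have hc0 : c = (0 : 𝒜 0) := hc
      rw [hc0]
      exact map_zero (degZeroAct 𝒜 σ)

/-- The algebra `A^! = ⨁ p, ⨁ n, Ext^p(A₀, A₀(n))`. -/
abbrev KoszulDual : Type u := (stdRes (degZeroEq 𝒜)).ExtAlg

/-- The component `(A^!)_p = ⨁ n, Ext^p(A₀, A₀(n))`. -/
def KoszulDual.grade (p : ℕ) : Submodule k (KoszulDual 𝒜) :=
  (stdRes (degZeroEq 𝒜)).extGrade p

/-- The component `Ext^p(A₀, A₀(n))` of `A^!`. -/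
def KoszulDual.bigrade (p : ℕ) (n : ℤ) : Submodule k (KoszulDual 𝒜) :=
  (stdRes (degZeroEq 𝒜)).extBigrade p n

/-- A graded algebra is Koszul if it is locally finite, its degree zero part is semisimple and
`A₀` has a linear resolution as a graded right module. -/
structure IsKoszul : Prop where
  locallyFinite : ∀ i, Module.Finite k (𝒜 i)
  semisimple : IsSemisimpleRing (𝒜 0)
  linear : ∃ R : GrProjRes (degZero 𝒜), ∀ i : ℕ, (R.P i).GeneratedInDegree i

end Koszul

/-! ### Skew group algebras -/

section Skew

variable (𝒜 : ℕ → Submodule k A) [GradedAlgebra 𝒜] (G : Subgroup (GrAut 𝒜))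

/-- The skew group algebra `A * G`, with multiplication `(a * g)(b * h) = a g(b) * gh`. -/
abbrev SkewGrp : Type u := SkewMonoidAlgebra A G

/-- The grading `(A * G)_i = A_i ⊗ kG` of the skew group algebra. -/
def skewGr (i : ℕ) : Submodule k (SkewGrp 𝒜 G) where
  carrier := {x | ∀ g, x.coeff g ∈ 𝒜 i}
  zero_mem' := fun _ => zero_mem _
  add_mem' := fun {x y} hx hy g => by
    rw [SkewMonoidAlgebra.coeff_add]
    exact add_mem (hx g) (hy g)
  smul_mem' := fun c x hx g => by
    rw [SkewMonoidAlgebra.coeff_smul]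
    exact Submodule.smul_mem _ c (hx g)

theorem single_mem_skewGr {i : ℕ} (g : G) {a : A} (ha : a ∈ 𝒜 i) :
    SkewMonoidAlgebra.single g a ∈ skewGr 𝒜 G i := by
  classical
  intro h
  rw [SkewMonoidAlgebra.coeff_single, Finsupp.single_apply]
  split_ifs
  · exact ha
  · exact zero_mem _

theorem smul_mem_of_mem {i : ℕ} (g : G) {a : A} (ha : a ∈ 𝒜 i) : g • a ∈ 𝒜 i :=
  (GrAut.smul_mem_iff 𝒜 (g : GrAut 𝒜)).2 ha

theorem isInternal_skewGr : DirectSum.IsInternal (skewGr 𝒜 G) := by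
  obtain ⟨p, hp, hp1, hp2, hp3⟩ := exists_proj 𝒜 (DirectSum.Decomposition.isInternal 𝒜)
  let e := SkewMonoidAlgebra.coeffLinearEquiv (S := k) (k := A) (G := G)
  let q : ℕ → SkewGrp 𝒜 G →ₗ[k] SkewGrp 𝒜 G := fun n =>
    e.symm.toLinearMap ∘ₗ Finsupp.mapRange.linearMap (p n) ∘ₗ e.toLinearMap
  have hq : ∀ n x g, (q n x).coeff g = p n (x.coeff g) := fun n x g => rfl
  refine isInternal_of_proj _ q ?_ ?_ ?_
  · intro n x hx
    ext g
    rw [hq, hp1 _ _ (hx g)]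
  · intro m n hmn x hx
    ext g
    rw [hq, hp2 _ _ hmn _ (hx g)]
    rfl
  · rw [eq_top_iff]
    intro x _
    induction x using SkewMonoidAlgebra.induction_on with
    | zero => exact zero_mem _
    | add x y hx hy => exact add_mem (hx trivial) (hy trivial)
    | single g a =>
      obtain ⟨s, hs⟩ := hp3 a
      rw [← hs]
      have : SkewMonoidAlgebra.single g (∑ n ∈ s, p n a) =
          ∑ n ∈ s, SkewMonoidAlgebra.single g (p n a) :=
        _root_.map_sum (AddMonoidHom.mk' (SkewMonoidAlgebra.single g)
          (SkewMonoidAlgebra.single_add g)) _ _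
      rw [this]
      exact sum_mem fun n _ => Submodule.mem_iSup_of_mem n (single_mem_skewGr 𝒜 G g (hp n a))

instance skewGradedAlgebra : GradedAlgebra (skewGr 𝒜 G) where
  one_mem := by
    rw [SkewMonoidAlgebra.one_def]
    exact single_mem_skewGr 𝒜 G 1 SetLike.GradedOne.one_mem
  mul_mem i j x y hx hy := by
    rw [SkewMonoidAlgebra.mul_def]
    refine sum_mem fun g _ => sum_mem fun h _ => single_mem_skewGr 𝒜 G _ ?_
    exact SetLike.mul_mem_graded (hx g) (smul_mem_of_mem 𝒜 G g (hy h))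
  toDecomposition := (isInternal_skewGr 𝒜 G).chooseDecomposition

/-- The action of `g ∈ G` on `A₀`, as an additive map. -/
def degZeroActAdd (g : G) : AddMonoid.End (𝒜 0) := (degZeroAct 𝒜 (g : GrAut 𝒜)).toAddMonoidHom

/-- Right multiplication by `b` on `A₀`, as an additive map. -/
def mulRightEnd (b : 𝒜 0) : AddMonoid.End (𝒜 0) := AddMonoidHom.mulRight b

/-- The right action of `A * G` on `A₀`, given by `c · (a * g) = g⁻¹ (c a₀)`; a right action is a
ring homomorphism to the opposite of the endomorphism ring. -/
def degZeroSkewHom : SkewGrp 𝒜 G →+* (AddMonoid.End (𝒜 0))ᵐᵒᵖ :=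
  SkewMonoidAlgebra.liftNCRingHom
    { toFun := fun a => op (mulRightEnd 𝒜 (GradedRing.projZeroRingHom' 𝒜 a))
      map_one' := by
        rw [map_one]
        exact congrArg op (AddMonoidHom.ext fun c => mul_one c)
      map_mul' := fun a b => by
        rw [map_mul, ← op_mul]
        exact congrArg op (AddMonoidHom.ext fun c => (mul_assoc c _ _).symm)
      map_zero' := by
        rw [map_zero]
        exact congrArg op (AddMonoidHom.ext fun c => mul_zero c)
      map_add' := fun a b => by
        rw [map_add, ← op_add]
        exact congrArg op (AddMonoidHom.ext fun c => mul_add c _ _) }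
    { toFun := fun g => op (degZeroActAdd 𝒜 G g⁻¹)
      map_one' := by
        rw [inv_one]
        rfl
      map_mul' := fun g h => by
        rw [mul_inv_rev, ← op_mul]
        rfl }
    (by
      intro a g
      refine congrArg op (AddMonoidHom.ext fun c => Subtype.ext ?_)
      change g⁻¹ • ((c : A) * (GradedRing.projZeroRingHom' 𝒜 (g • a) : A)) =
        (g⁻¹ • (c : A)) * (GradedRing.projZeroRingHom' 𝒜 a : A)
      have : (GradedRing.projZeroRingHom' 𝒜 (g • a) : A) =
        g • (GradedRing.projZeroRingHom' 𝒜 a : A) := smul_projZero 𝒜 (g : GrAut 𝒜) a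
      rw [this, smul_mul', inv_smul_smul])

theorem degZeroSkewHom_single (g : G) (a : A) (c : 𝒜 0) :
    ((unop (degZeroSkewHom 𝒜 G (SkewMonoidAlgebra.single g a)) c : 𝒜 0) : A) =
      g⁻¹ • ((c : A) * (GradedRing.projZeroRingHom' 𝒜 a : A)) := by
  have : degZeroSkewHom 𝒜 G (SkewMonoidAlgebra.single g a) =
      op (mulRightEnd 𝒜 (GradedRing.projZeroRingHom' 𝒜 a)) *
        op (degZeroActAdd 𝒜 G g⁻¹) :=
    SkewMonoidAlgebra.liftNC_single _ _ _ _
  rw [this]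
  rfl

/-- The right `A * G`-module structure `c · (a * g) = g⁻¹ (c a₀)` on `A₀`. -/
@[reducible] def degZeroSkewModule : Module (SkewGrp 𝒜 G)ᵐᵒᵖ (𝒜 0) where
  smul x c := unop (degZeroSkewHom 𝒜 G (unop x)) c
  one_smul c := by
    change unop (degZeroSkewHom 𝒜 G 1) c = c
    rw [map_one]
    rfl
  mul_smul x y c := by
    change unop (degZeroSkewHom 𝒜 G (unop y * unop x)) c = _
    rw [map_mul]
    rfl
  smul_zero x := map_zero (unop (degZeroSkewHom 𝒜 G (unop x)))
  smul_add x := map_add (unop (degZeroSkewHom 𝒜 G (unop x)))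
  zero_smul c := by
    change unop (degZeroSkewHom 𝒜 G 0) c = 0
    rw [map_zero]
    rfl
  add_smul x y c := by
    change unop (degZeroSkewHom 𝒜 G (unop x + unop y)) c = _
    rw [map_add]
    rfl

theorem degZeroSkewHom_eq_sum (x : SkewGrp 𝒜 G) :
    degZeroSkewHom 𝒜 G x =
      ∑ g ∈ x.support, degZeroSkewHom 𝒜 G (SkewMonoidAlgebra.single g (x.coeff g)) := by
  conv_lhs => rw [← SkewMonoidAlgebra.sum_single x, SkewMonoidAlgebra.sum_def']
  rw [_root_.map_sum]

theorem degZeroSkewHom_smul (r : k) (x : SkewGrp 𝒜 G) (c : 𝒜 0) :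
    unop (degZeroSkewHom 𝒜 G (r • x)) c = r • unop (degZeroSkewHom 𝒜 G x) c := by
  induction x using SkewMonoidAlgebra.induction_on with
  | zero =>
    rw [smul_zero, map_zero]
    exact (smul_zero r).symm
  | add x y hx hy =>
    rw [smul_add, map_add, map_add]
    change unop (degZeroSkewHom 𝒜 G (r • x)) c + unop (degZeroSkewHom 𝒜 G (r • y)) c =
      r • (unop (degZeroSkewHom 𝒜 G x) c + unop (degZeroSkewHom 𝒜 G y) c)
    rw [hx, hy, smul_add]
  | single g a =>
    apply Subtype.ext
    rw [SkewMonoidAlgebra.smul_single]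
    change _ = r • ((unop (degZeroSkewHom 𝒜 G (SkewMonoidAlgebra.single g a)) c : 𝒜 0) : A)
    have h : (GradedRing.projZeroRingHom' 𝒜 (r • a) : A) =
        r • (GradedRing.projZeroRingHom' 𝒜 a : A) := by
      simp [DirectSum.decompose_smul]
      rfl
    have h' : ∀ x : A, g⁻¹ • r • x = r • g⁻¹ • x := fun x => map_smul ((g⁻¹ : G) : A ≃ₐ[k] A) r x
    rw [degZeroSkewHom_single, degZeroSkewHom_single, h, mul_smul_comm, h']

/-- `A₀ = A / A_{≥ 1}` as a graded right `A * G`-module, concentrated in degree `0`. -/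
def degZeroSkew : GrMod (skewGr 𝒜 G) where
  carrier := 𝒜 0
  module := degZeroSkewModule 𝒜 G
  isScalarTower := letI := degZeroSkewModule 𝒜 G
    ⟨fun r x c => degZeroSkewHom_smul 𝒜 G r (unop x) c⟩
  gr n := if n = 0 then ⊤ else ⊥
  isInternal := isInternal_concentrated (𝒜 0)
  smul_mem i n x c hx hc := by
    change unop (degZeroSkewHom 𝒜 G x) c ∈ _
    by_cases hn : n = 0
    · subst hn
      rcases Nat.eq_zero_or_pos i with rfl | hi
      · simp
      · have h0 : degZeroSkewHom 𝒜 G x = 0 := by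
          rw [degZeroSkewHom_eq_sum]
          refine Finset.sum_eq_zero fun g _ => unop_injective (AddMonoidHom.ext fun c => ?_)
          apply Subtype.ext
          have : (GradedRing.projZeroRingHom' 𝒜 (x.coeff g) : A) = 0 := by
            rw [GradedRing.coe_projZeroRingHom'_apply, GradedRing.projZeroRingHom_apply]
            exact DirectSum.decompose_of_mem_ne 𝒜 (hx g) hi.ne'
          refine (degZeroSkewHom_single 𝒜 G g (x.coeff g) c).trans ?_
          rw [this, mul_zero, smul_zero]
          rfl
        rw [h0]
        exact zero_mem _
    · rw [if_neg hn, Submodule.mem_bot] at hc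
      subst hc
      rw [map_zero]
      exact zero_mem _

end Skew

end Modules

/-! ### The algebra `G * R` -/

/-- The underlying space `kG ⊗ R` of `G * R`, for a finite group `G`: the function `x` stands for
`∑ g, g ⊗ x g`. -/
def LeftSkew (G R : Type*) : Type _ := G → R

namespace LeftSkew

variable {G R : Type*}

instance [AddCommGroup R] : AddCommGroup (LeftSkew G R) := inferInstanceAs (AddCommGroup (G → R))

instance {k : Type*} [Field k] [AddCommGroup R] [Module k R] : Module k (LeftSkew G R) :=
  inferInstanceAs (Module k (G → R))

theorem add_apply [AddCommGroup R] (x y : LeftSkew G R) (g : G) : (x + y) g = x g + y g := rfl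

theorem smul_apply {k : Type*} [Field k] [AddCommGroup R] [Module k R] (c : k)
    (x : LeftSkew G R) (g : G) : (c • x) g = c • x g := rfl

@[ext] theorem ext {x y : LeftSkew G R} (h : ∀ g, x g = y g) : x = y := funext h

variable [Group G] [Fintype G] [Ring R] [MulSemiringAction G R]

/-- The multiplication determined by `(g ⊗ a)(h ⊗ b) = gh ⊗ h⁻¹(a) b`. -/
instance : Mul (LeftSkew G R) := ⟨fun x y g => ∑ h : G, (h⁻¹ • x (g * h⁻¹)) * y h⟩

theorem mul_apply (x y : LeftSkew G R) (g : G) :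
    (x * y) g = ∑ h : G, (h⁻¹ • x (g * h⁻¹)) * y h := rfl

open Classical in
/-- The element `g ⊗ a`. -/
def single (g : G) (a : R) : LeftSkew G R := fun h => if h = g then a else 0

open Classical in
theorem single_apply (g h : G) (a : R) : single g a h = if h = g then a else 0 := rfl

theorem single_mul_single (g h : G) (a b : R) :
    single g a * single h b = single (g * h) ((h⁻¹ • a) * b) := by
  classical
  ext l
  rw [mul_apply, Finset.sum_eq_single h]
  · simp only [single_apply, if_true]
    by_cases hl : l = g * h
    · simp [hl]
    · rw [if_neg hl, if_neg (fun e => hl (by rw [← e, inv_mul_cancel_right])), smul_zero, zero_mul]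
  · intro m _ hm
    rw [single_apply h m, if_neg hm, mul_zero]
  · simp

instance : One (LeftSkew G R) := ⟨single 1 1⟩

theorem one_def : (1 : LeftSkew G R) = single 1 1 := rfl

instance : Ring (LeftSkew G R) :=
  { (inferInstance : AddCommGroup (LeftSkew G R)) with
    left_distrib := fun x y z => by
      ext g
      simp only [mul_apply, add_apply, mul_add, Finset.sum_add_distrib]
    right_distrib := fun x y z => by
      ext g
      simp only [mul_apply, add_apply, smul_add, add_mul, Finset.sum_add_distrib]
    zero_mul := fun x => by
      ext g
      change ∑ h : G, (h⁻¹ • (0 : R)) * x h = 0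
      simp
    mul_zero := fun x => by
      ext g
      change ∑ h : G, (h⁻¹ • x (g * h⁻¹)) * (0 : R) = 0
      simp
    mul_assoc := fun x y z => by
      ext g
      simp only [mul_apply, Finset.smul_sum, Finset.sum_mul, Finset.mul_sum, smul_mul']
      rw [Finset.sum_comm' (t' := Finset.univ) (s' := fun _ => Finset.univ) (by simp)]
      rw [Finset.sum_comm]
      conv_rhs => rw [Finset.sum_comm]
      refine Finset.sum_congr rfl fun l _ => ?_
      refine (Fintype.sum_equiv (Equiv.mulRight l) _ _ fun h => ?_)
      simp [mul_assoc, mul_smul]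
    one_mul := fun x => by
      classical
      ext g
      rw [mul_apply, Finset.sum_eq_single g]
      · simp [one_def, single_apply]
      · intro h _ hh
        rw [one_def, single_apply, if_neg (fun e => hh (mul_inv_eq_one.1 e).symm), smul_zero,
          zero_mul]
      · simp
    mul_one := fun x => by
      classical
      ext g
      rw [mul_apply, Finset.sum_eq_single 1]
      · simp [one_def, single_apply]
      · intro h _ hh
        rw [one_def, single_apply, if_neg hh, mul_zero]
      · simp }

variable {k : Type*} [Field k] [Algebra k R] [SMulCommClass G k R]

instance : Algebra k (LeftSkew G R) :=
  Algebra.ofModule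
    (fun c x y => by
      ext g
      simp only [mul_apply, smul_apply, Finset.smul_sum, smul_comm _ c, smul_mul_assoc])
    (fun c x y => by
      ext g
      simp only [mul_apply, smul_apply, Finset.smul_sum, mul_smul_comm])

/-- The subspace `kG ⊗ S` of `G * R`. -/
def extend (G : Type*) {R k : Type*} [Field k] [Ring R] [Algebra k R] (S : Submodule k R) :
    Submodule k (LeftSkew G R) where
  carrier := {x | ∀ g, x g ∈ S}
  zero_mem' := fun _ => zero_mem S
  add_mem' := fun hx hy g => add_mem (hx g) (hy g)
  smul_mem' := fun c _ hx g => S.smul_mem c (hx g)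

end LeftSkew

end

end SkewKoszul

open SkewKoszul

namespace SkewKoszul

noncomputable section

variable {k : Type v} [Field k] {A : Type u} [Ring A] [Algebra k A]

/-! ### Graded linear maps -/

section GradedMaps

variable {𝒜 : ℕ → Submodule k A}

/-! Both parts rest on the induction functor M ↦ M ⊗_A (A * G), here `Ind`, whose elements are
written ∑ m_g ⊗ g. It is exact, preserves graded projectives and generation in a given degree, and
(A * G)₀ ≅ A₀ ⊗_A (A * G) (`degZeroEquivInd`). Hence a graded projective resolution P of A₀ induces
one of (A * G)₀, namely `indRes`.

Part 1. The Ext algebra with its bigrading does not depend on the resolution (`exists_extEquiv`), so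
(A * G)^! may be computed from the resolution induced by the standard resolution P, on which the
graded automorphisms act. An A * G-linear endomorphism F of the induced complex is determined by its
values F(x ⊗ 1) = ∑ g(f_g x) ⊗ g. The twist by g makes each f_g an A-linear endomorphism of P, and
every family (f_g) occurs. Composing two such expansions produces h⁻¹ f h, so composition becomes
the product of G * End(P) (`endComponent_mul`). Since G commutes with the differential and preserves
degrees, chain maps and null-homotopic maps are recognised component by component, and the
isomorphism descends to Ext (`exists_extIndEquiv`).

Part 2. Local finiteness passes both ways by comparing coefficients. Semisimplicity of A₀ passes to
(A * G)₀ by Maschke averaging, where |G| must be invertible (`isSemisimpleRing_of_crossedProduct`),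
and returns by reading off the coefficient at 1 of an idempotent
(`isSemisimpleRing_of_skewGr_zero`). Inducing a linear resolution of A₀ gives one of (A * G)₀.
Conversely, restricting to A a linear resolution of (A * G)₀ gives a linear resolution of a module
having A₀ as a graded retract. For degree reasons, a graded chain map of a linear resolution that
lifts zero is zero; thus a lift of the idempotent cutting out A₀ is itself idempotent, and its image
is a linear resolution of A₀ (`GrProjRes.IsLinear.retract`). -/

theorem exists_linearMap_of_isInternal {ι V W : Type*} [DecidableEq ι] [AddCommGroup V] [Module k V]
    [AddCommGroup W] [Module k W] (gr : ι → Submodule k V) (h : DirectSum.IsInternal gr)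
    (f : ι → V →ₗ[k] W) : ∃ F : V →ₗ[k] W, ∀ n, ∀ x ∈ gr n, F x = f n x := by
  refine ⟨DirectSum.toModule k ι W (fun n => f n ∘ₗ (gr n).subtype) ∘ₗ
    (LinearEquiv.ofBijective (DirectSum.coeLinearMap gr) h).symm.toLinearMap, fun n x hx => ?_⟩
  have : (LinearEquiv.ofBijective (DirectSum.coeLinearMap gr) h).symm x =
      DirectSum.lof k ι (fun n => gr n) n ⟨x, hx⟩ := by
    rw [LinearEquiv.symm_apply_eq]
    exact (DirectSum.coeLinearMap_lof gr n ⟨x, hx⟩).symm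
  rw [LinearMap.comp_apply, LinearEquiv.coe_coe, this, DirectSum.toModule_lof]
  rfl

/-- A linear map of graded modules is graded if it preserves degrees. -/
def IsGraded {M N : GrMod 𝒜} (f : M →ₗ[Aᵐᵒᵖ] N) : Prop :=
  ∀ n x, x ∈ M.gr n → f x ∈ N.gr n

theorem IsGraded.comp {M N K : GrMod 𝒜} {g : N →ₗ[Aᵐᵒᵖ] K} {f : M →ₗ[Aᵐᵒᵖ] N}
    (hg : IsGraded g) (hf : IsGraded f) : IsGraded (g ∘ₗ f) :=
  fun n x hx => hg n _ (hf n x hx)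

theorem IsGraded.sub {M N : GrMod 𝒜} {g : M →ₗ[Aᵐᵒᵖ] N} {f : M →ₗ[Aᵐᵒᵖ] N}
    (hg : IsGraded g) (hf : IsGraded f) : IsGraded (g - f) :=
  fun n x hx => sub_mem (hg n _ hx) (hf n x hx)

theorem IsGraded.id {M : GrMod 𝒜} : IsGraded (LinearMap.id : M →ₗ[Aᵐᵒᵖ] M) :=
  fun _ _ hx => hx

theorem GrMod.induction {M : GrMod 𝒜} {p : M → Prop} (zero : p 0)
    (add : ∀ x y, p x → p y → p (x + y)) (mem : ∀ n x, x ∈ M.gr n → p x) (x : M) : p x := by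
  obtain ⟨q, hq, -, -, hs⟩ := exists_proj M.gr M.isInternal
  obtain ⟨s, hx⟩ := hs x
  rw [← hx]
  exact Finset.sum_induction _ p add zero fun n _ => mem n _ (hq n x)

/-- The projections are arbitrary families with the two listed properties, because `exists_proj`
supplies them only existentially; these properties determine them on homogeneous elements, hence
everywhere. -/
theorem IsGraded.map_proj {M N : GrMod 𝒜} {g : M →ₗ[Aᵐᵒᵖ] N} (hg : IsGraded g)
    {q : ℤ → M →ₗ[k] M} (hq1 : ∀ n, ∀ x ∈ M.gr n, q n x = x)
    (hq2 : ∀ m n, m ≠ n → ∀ x ∈ M.gr m, q n x = 0)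
    {r : ℤ → N →ₗ[k] N} (hr1 : ∀ n, ∀ x ∈ N.gr n, r n x = x)
    (hr2 : ∀ m n, m ≠ n → ∀ x ∈ N.gr m, r n x = 0) (n : ℤ) (x : M) : g (q n x) = r n (g x) := by
  induction x using GrMod.induction with
  | zero => simp
  | add x y hx hy => simp only [map_add, hx, hy]
  | mem m x hx =>
    rcases eq_or_ne m n with rfl | h
    · rw [hq1 _ _ hx, hr1 _ _ (hg _ _ hx)]
    · rw [hq2 _ _ h _ hx, hr2 _ _ h _ (hg _ _ hx), map_zero]

theorem induction_graded [GradedAlgebra 𝒜] {p : A → Prop} (zero : p 0)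
    (add : ∀ x y, p x → p y → p (x + y)) (mem : ∀ n x, x ∈ 𝒜 n → p x) (x : A) : p x := by
  obtain ⟨q, hq, -, -, hs⟩ := exists_proj 𝒜 (DirectSum.Decomposition.isInternal 𝒜)
  obtain ⟨s, hx⟩ := hs x
  rw [← hx]
  exact Finset.sum_induction _ p add zero fun n _ => mem n _ (hq n x)

variable [GradedAlgebra 𝒜]

/-- The degree zero component of a linear map between graded modules. -/
theorem exists_degreeZeroPart {M N : GrMod 𝒜} (F : M →ₗ[Aᵐᵒᵖ] N) (q : ℤ → N →ₗ[k] N)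
    (hq1 : ∀ n, ∀ x ∈ N.gr n, q n x = x)
    (hq2 : ∀ m n, m ≠ n → ∀ x ∈ N.gr m, q n x = 0) :
    ∃ F₀ : M →ₗ[Aᵐᵒᵖ] N, ∀ n, ∀ x ∈ M.gr n, F₀ x = q n (F x) := by
  obtain ⟨L, hL⟩ := exists_linearMap_of_isInternal M.gr M.isInternal
    fun n => q n ∘ₗ F.restrictScalars k
  -- Multiplication by an element of degree i shifts components by i. This is what makes the
  -- assembled map linear over homogeneous scalars, hence over A.
  have hqs : ∀ (n : ℤ) (i : ℕ) (a : A), a ∈ 𝒜 i → ∀ y : N,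
      q (n + i) (op a • y) = op a • q n y := by
    intro n i a ha y
    induction y using GrMod.induction with
    | zero => simp
    | add x y hx hy => rw [smul_add, map_add, hx, hy, map_add, smul_add]
    | mem m y hy =>
      rcases eq_or_ne m n with rfl | h
      · rw [hq1 _ _ (N.smul_mem i m a y ha hy), hq1 _ _ hy]
      · rw [hq2 _ _ (by simpa using h) _ (N.smul_mem i m a y ha hy), hq2 _ _ h _ hy, smul_zero]
  refine ⟨{ toFun := L, map_add' := map_add L, map_smul' := fun a x => ?_ }, fun n x hx => hL n x hx⟩
  obtain ⟨a, rfl⟩ := op_surjective a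
  rw [RingHom.id_apply]
  induction a using induction_graded (𝒜 := 𝒜) with
  | zero => simp
  | add a b ha hb => rw [op_add, add_smul, map_add, ha, hb, add_smul]
  | mem i a ha =>
    induction x using GrMod.induction with
    | zero => simp
    | add x y hx hy => rw [smul_add, map_add, hx, hy, map_add, smul_add]
    | mem n x hx =>
      rw [hL _ _ (M.smul_mem i n a x ha hx), hL _ _ hx]
      change q (n + i) (F (op a • x)) = op a • q n (F x)
      rw [map_smul, hqs n i a ha]

/-- Projectivity is only assumed for ungraded modules. An ungraded lift is replaced by its degree
zero part, which is still a lift because f and g are graded. Requiring only that f lands in the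
image of g is the form needed for lifting along exact sequences. -/
theorem exists_gradedLift {P M N : GrMod 𝒜} (hP : Module.Projective Aᵐᵒᵖ P) {f : P →ₗ[Aᵐᵒᵖ] N}
    (hf : IsGraded f) {g : M →ₗ[Aᵐᵒᵖ] N} (hg : IsGraded g) (hfg : ∀ x, ∃ y, g y = f x) :
    ∃ l : P →ₗ[Aᵐᵒᵖ] M, IsGraded l ∧ ∀ x, g (l x) = f x := by
  obtain ⟨l, hl⟩ := Module.projective_lifting_property g.rangeRestrict
    (f.codRestrict (LinearMap.range g) hfg) g.surjective_rangeRestrict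
  have hl' : ∀ x, g (l x) = f x := fun x => congrArg Subtype.val (LinearMap.congr_fun hl x)
  obtain ⟨q, hq, hq1, hq2, -⟩ := exists_proj M.gr M.isInternal
  obtain ⟨r, -, hr1, hr2, -⟩ := exists_proj N.gr N.isInternal
  obtain ⟨l₀, hl₀⟩ := exists_degreeZeroPart l q hq1 hq2
  refine ⟨l₀, fun n x hx => ?_, fun x => ?_⟩
  · rw [hl₀ n x hx]
    exact hq n _
  · induction x using GrMod.induction with
    | zero => simp
    | add x y hx hy => simp only [map_add, hx, hy]
    | mem m x hx => rw [hl₀ m x hx, hg.map_proj hq1 hq2 hr1 hr2, hl', hr1 _ _ (hf _ _ hx)]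

end GradedMaps

/-! ### Comparison of resolutions -/

/-- Dependent choice with an invariant p on each term and a relation r between consecutive terms; it
builds chain maps and homotopies degree by degree. -/
theorem exists_dependent_seq {α : ℕ → Type*} (p : ∀ i, α i → Prop)
    (r : ∀ i, α i → α (i + 1) → Prop) {a : α 0} (ha : p 0 a)
    (step : ∀ i x, p i x → ∃ y, p (i + 1) y ∧ r i x y) :
    ∃ f : ∀ i, α i, f 0 = a ∧ (∀ i, p i (f i)) ∧ ∀ i, r i (f i) (f (i + 1)) := by
  choose s hs using step
  let F : ∀ i, {x : α i // p i x} := fun i =>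
    Nat.rec ⟨a, ha⟩ (fun i x => ⟨s i x.1 x.2, (hs i x.1 x.2).1⟩) i
  exact ⟨fun i => (F i).1, rfl, fun i => (F i).2, fun i => (hs i (F i).1 (F i).2).2⟩

namespace GrProjRes

variable {𝒜 : ℕ → Submodule k A} {M N : GrMod 𝒜}

theorem ε_d (R : GrProjRes M) (x : R.P 1) : R.ε (R.d 0 x) = 0 :=
  R.exact_zero.apply_apply_eq_zero x

variable [GradedAlgebra 𝒜]

theorem exists_chainMap (R : GrProjRes M) (S : GrProjRes N) {u : M →ₗ[Aᵐᵒᵖ] N} (hu : IsGraded u) :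
    ∃ φ : ∀ i, R.P i →ₗ[Aᵐᵒᵖ] S.P i, (∀ i, IsGraded (φ i)) ∧
      (∀ x, S.ε (φ 0 x) = u (R.ε x)) ∧ ∀ i x, S.d i (φ (i + 1) x) = φ i (R.d i x) := by
  obtain ⟨φ₀, h0, h0'⟩ := exists_gradedLift (R.projective 0) (hu.comp R.ε_mem) (g := S.ε) S.ε_mem
    fun x => S.ε_surjective _
  obtain ⟨φ, hφ, h1, h2⟩ := exists_dependent_seq (α := fun i => R.P i →ₗ[Aᵐᵒᵖ] S.P i)
    -- The invariant says that f ∘ d takes values in the image of the next differential of S, which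
    -- is exactly what allows the next lift.
    (fun i f => IsGraded f ∧ ∀ y, ∃ z, S.d i z = f (R.d i y))
    (fun i f g => ∀ x, S.d i (g x) = f (R.d i x)) (a := φ₀)
    ⟨h0, fun y => (S.exact_zero _).1 (by
      rw [h0', LinearMap.comp_apply, R.ε_d, map_zero])⟩ (by
      rintro i f ⟨hf, hf'⟩
      obtain ⟨g, hg, hg'⟩ := exists_gradedLift (R.projective (i + 1)) (hf.comp (R.d_mem i))
        (g := S.d i) (S.d_mem i) hf'
      refine ⟨g, ⟨hg, fun y => (S.exact_succ i _).1 ?_⟩, hg'⟩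
      rw [hg', LinearMap.comp_apply, R.d_d, map_zero])
  exact ⟨φ, fun i => (h1 i).1, fun x => by rw [hφ, h0']; rfl, h2⟩

theorem exists_homotopy (R : GrProjRes M) (S : GrProjRes N) {φ : ∀ i, R.P i →ₗ[Aᵐᵒᵖ] S.P i}
    (hφ : ∀ i, IsGraded (φ i)) (h0 : ∀ x, S.ε (φ 0 x) = 0)
    (hd : ∀ i x, S.d i (φ (i + 1) x) = φ i (R.d i x)) :
    ∃ h : ∀ i, R.P i →ₗ[Aᵐᵒᵖ] S.P (i + 1), (∀ i, IsGraded (h i)) ∧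
      (∀ x, φ 0 x = S.d 0 (h 0 x)) ∧
      ∀ i x, φ (i + 1) x = S.d (i + 1) (h (i + 1) x) + h i (R.d i x) := by
  obtain ⟨h₀, hh, hh'⟩ := exists_gradedLift (R.projective 0) (hφ 0) (g := S.d 0) (S.d_mem 0)
    fun x => (S.exact_zero _).1 (h0 x)
  obtain ⟨h, e0, h1, h2⟩ := exists_dependent_seq (α := fun i => R.P i →ₗ[Aᵐᵒᵖ] S.P (i + 1))
    (fun i f => IsGraded f ∧ ∀ y, S.d i (φ (i + 1) y - f (R.d i y)) = 0)
    (fun i f g => ∀ x, S.d (i + 1) (g x) = φ (i + 1) x - f (R.d i x)) (a := h₀)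
    ⟨hh, fun y => by rw [map_sub, hd, hh', sub_self]⟩ (by
      rintro i f ⟨hf, hf'⟩
      obtain ⟨g, hg, hg'⟩ := exists_gradedLift (R.projective (i + 1))
        (f := φ (i + 1) - f ∘ₗ R.d i) ((hφ (i + 1)).sub (hf.comp (R.d_mem i)))
        (g := S.d (i + 1)) (S.d_mem (i + 1)) (fun x => (S.exact_succ i _).1 (hf' x))
      refine ⟨g, ⟨hg, fun y => ?_⟩, hg'⟩
      rw [map_sub, hd, hg', LinearMap.sub_apply, LinearMap.comp_apply, R.d_d, map_zero, sub_zero,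
        sub_self])
  refine ⟨h, fun i => (h1 i).1, fun x => by rw [e0, hh'], fun i x => by rw [h2, sub_add_cancel]⟩

end GrProjRes

namespace GrProjRes

variable {𝒜 : ℕ → Submodule k A} {M N : GrMod 𝒜}

/-! ### Maps of total modules -/

theorem Tot.induction (R : GrProjRes M) {p : R.Tot → Prop} (zero : p 0)
    (add : ∀ x y, p x → p y → p (x + y)) (lof : ∀ i x, p (DirectSum.lof Aᵐᵒᵖ ℕ (fun i => R.P i) i x))
    (x : R.Tot) : p x := by
  induction x using DirectSum.induction_on with
  | zero => exact zero
  | add x y hx hy => exact add x y hx hy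
  | of i x => exact lof i x

/-- The map of total modules induced by a family of maps. -/
def totMap {R : GrProjRes M} {S : GrProjRes N} (φ : ∀ i, R.P i →ₗ[Aᵐᵒᵖ] S.P i) :
    R.Tot →ₗ[Aᵐᵒᵖ] S.Tot := DFinsupp.mapRange.linearMap φ

theorem totMap_apply {R : GrProjRes M} {S : GrProjRes N} (φ : ∀ i, R.P i →ₗ[Aᵐᵒᵖ] S.P i)
    (x : R.Tot) (i : ℕ) : totMap φ x i = φ i (x i) := rfl

theorem totMap_mem_piece {R : GrProjRes M} {S : GrProjRes N} {φ : ∀ i, R.P i →ₗ[Aᵐᵒᵖ] S.P i}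
    (hφ : ∀ i, IsGraded (φ i)) {j m : ℤ} {x : R.Tot} (hx : x ∈ R.piece j m) :
    totMap φ x ∈ S.piece j m := fun i =>
  ⟨hφ i m _ (hx i).1, fun h => by rw [totMap_apply, (hx i).2 h, map_zero]⟩

theorem D_totMap {R : GrProjRes M} {S : GrProjRes N} {φ : ∀ i, R.P i →ₗ[Aᵐᵒᵖ] S.P i}
    (hφ : ∀ i x, S.d i (φ (i + 1) x) = φ i (R.d i x)) (x : R.Tot) :
    S.D (totMap φ x) = totMap φ (R.D x) := by
  ext i
  rw [D_apply, totMap_apply, totMap_apply, D_apply, hφ]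

/-- The map of total modules of homological degree one induced by a homotopy. -/
def totShift {R : GrProjRes M} {S : GrProjRes N} (h : ∀ i, R.P i →ₗ[Aᵐᵒᵖ] S.P (i + 1)) :
    R.Tot →ₗ[Aᵐᵒᵖ] S.Tot :=
  DirectSum.toModule Aᵐᵒᵖ ℕ S.Tot fun i =>
    DirectSum.lof Aᵐᵒᵖ ℕ (fun i => S.P i) (i + 1) ∘ₗ h i

theorem totShift_zero {R : GrProjRes M} {S : GrProjRes N} (h : ∀ i, R.P i →ₗ[Aᵐᵒᵖ] S.P (i + 1))
    (x : R.Tot) : totShift h x 0 = 0 := by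
  induction x using Tot.induction with
  | zero => rw [map_zero]; rfl
  | add x y hx hy => rw [map_add, DirectSum.add_apply, hx, hy, add_zero]
  | lof i x =>
    rw [totShift, DirectSum.toModule_lof, LinearMap.comp_apply, DirectSum.lof_eq_of,
      DirectSum.of_eq_of_ne _ _ _ (by omega)]

theorem totShift_succ {R : GrProjRes M} {S : GrProjRes N} (h : ∀ i, R.P i →ₗ[Aᵐᵒᵖ] S.P (i + 1))
    (x : R.Tot) (i : ℕ) : totShift h x (i + 1) = h i (x i) := by
  induction x using Tot.induction with
  | zero => rw [map_zero]; exact (map_zero (h i)).symm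
  | add x y hx hy => rw [map_add, DirectSum.add_apply, hx, hy, DirectSum.add_apply, map_add]
  | lof j x =>
    rw [totShift, DirectSum.toModule_lof, LinearMap.comp_apply, DirectSum.lof_eq_of]
    rcases eq_or_ne i j with rfl | hij
    · rw [DirectSum.lof_eq_of, DirectSum.of_eq_same, DirectSum.of_eq_same]
    · rw [DirectSum.lof_eq_of, DirectSum.of_eq_of_ne _ _ _ (by omega),
        DirectSum.of_eq_of_ne _ _ _ hij, map_zero]

theorem totShift_mem_piece {R : GrProjRes M} {S : GrProjRes N}
    {h : ∀ i, R.P i →ₗ[Aᵐᵒᵖ] S.P (i + 1)} (hh : ∀ i, ∀ n x, x ∈ (R.P i).gr n → h i x ∈ (S.P (i + 1)).gr n)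
    {j m : ℤ} {x : R.Tot} (hx : x ∈ R.piece j m) : totShift h x ∈ S.piece (j + 1) m := by
  rintro (_ | i)
  · rw [totShift_zero]
    exact ⟨zero_mem _, fun _ => rfl⟩
  · rw [totShift_succ]
    refine ⟨hh i m _ (hx i).1, fun hi => ?_⟩
    rw [(hx i).2 (by push_cast at hi; omega), map_zero]

/-- A graded chain map `R → R` lifting zero is a coboundary. -/
theorem totMap_mem_coboundary [GradedAlgebra 𝒜] (R : GrProjRes M) {φ : ∀ i, R.P i →ₗ[Aᵐᵒᵖ] R.P i}
    (hφ : ∀ i, IsGraded (φ i)) (h0 : ∀ x, R.ε (φ 0 x) = 0)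
    (hd : ∀ i x, R.d i (φ (i + 1) x) = φ i (R.d i x)) : totMap φ ∈ R.coboundary 0 0 := by
  obtain ⟨h, hh, h1, h2⟩ := exists_homotopy R R hφ h0 hd
  refine ⟨totShift h, fun j m x hx => ?_, LinearMap.ext fun x => ?_⟩
  -- Raising the homological degree by one means lowering it by 0 - 1, so j - (0 - 1) has to become
  -- j + 1.
  · simpa using totShift_mem_piece hh hx
  · rw [LinearMap.add_apply, Module.End.mul_apply, Module.End.mul_apply]
    ext i
    rw [DirectSum.add_apply, totMap_apply, D_apply, totShift_succ]
    cases i with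
    -- In homological degree 0 the term h ∘ d is absent, which matches the vanishing of `totShift`
    -- there.
    | zero => rw [totShift_zero, add_zero, h1]
    | succ i => rw [totShift_succ, D_apply, h2]

/-! ### Invariance of the Ext algebra -/

variable (R : GrProjRes M) (S : GrProjRes N)

theorem mem_cocycles_of_mem {p : ℕ} {n : ℤ} {f : Module.End Aᵐᵒᵖ R.Tot} (hf : f ∈ R.cocycle p n) :
    f ∈ R.cocycles :=
  Submodule.mem_iSup_of_mem (p := fun x : ℕ × ℤ => R.cocycle x.1 x.2) (p, n) hf

theorem mem_coboundaries_of_mem {p : ℕ} {n : ℤ} {f : Module.End Aᵐᵒᵖ R.Tot}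
    (hf : f ∈ R.coboundary p n) : f ∈ R.coboundaries :=
  Submodule.mem_iSup_of_mem (p := fun x : ℕ × ℤ => R.coboundary x.1 x.2) (p, n) hf

/-- Linear maps of endomorphism algebras of total modules which preserve the bidegrees and commute
with the composition with the differential on either side. -/
structure PreservesCochains {B : Type*} [Ring B] [Algebra k B] {ℬ : ℕ → Submodule k B} {K : GrMod ℬ}
    {R : GrProjRes M} {S : GrProjRes K}
    (L : Module.End Aᵐᵒᵖ R.Tot →ₗ[k] Module.End Bᵐᵒᵖ S.Tot) : Prop where
  homPiece : ∀ {p n : ℤ} {f}, f ∈ R.homPiece p n → L f ∈ S.homPiece p n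
  D_mul : ∀ f, L (R.D * f) = S.D * L f
  mul_D : ∀ f, L (f * R.D) = L f * S.D

namespace PreservesCochains

variable {B : Type*} [Ring B] [Algebra k B] {ℬ : ℕ → Submodule k B} {K : GrMod ℬ}
  {R : GrProjRes M} {S : GrProjRes K} {L : Module.End Aᵐᵒᵖ R.Tot →ₗ[k] Module.End Bᵐᵒᵖ S.Tot}

theorem cocycle (hL : PreservesCochains L) {p n : ℤ} {f : Module.End Aᵐᵒᵖ R.Tot}
    (hf : f ∈ R.cocycle p n) : L f ∈ S.cocycle p n :=
  ⟨hL.homPiece hf.1, by rw [← hL.D_mul, hf.2, hL.mul_D]⟩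

theorem coboundary (hL : PreservesCochains L) {p n : ℤ} {f : Module.End Aᵐᵒᵖ R.Tot}
    (hf : f ∈ R.coboundary p n) : L f ∈ S.coboundary p n := by
  obtain ⟨h, hh, rfl⟩ := hf
  exact ⟨L h, hL.homPiece hh, by rw [map_add, hL.D_mul, hL.mul_D]⟩

theorem cocycles (hL : PreservesCochains L) {f : Module.End Aᵐᵒᵖ R.Tot} (hf : f ∈ R.cocycles) :
    L f ∈ S.cocycles := by
  have hle : (⨆ x : ℕ × ℤ, R.cocycle x.1 x.2) ≤ (⨆ x : ℕ × ℤ, S.cocycle x.1 x.2).comap L :=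
    iSup_le fun x f hf => Submodule.mem_iSup_of_mem x (hL.cocycle hf)
  exact hle hf

theorem coboundaries (hL : PreservesCochains L) {f : Module.End Aᵐᵒᵖ R.Tot}
    (hf : f ∈ R.coboundaries) : L f ∈ S.coboundaries := by
  have hle : (⨆ x : ℕ × ℤ, R.coboundary x.1 x.2) ≤ (⨆ x : ℕ × ℤ, S.coboundary x.1 x.2).comap L :=
    iSup_le fun x f hf => Submodule.mem_iSup_of_mem x (hL.coboundary hf)
  exact hle hf

/-- The induced map of the algebras of chain maps. -/
def mapCocycle (hL : PreservesCochains L) : R.CocycleAlg →ₗ[k] S.CocycleAlg :=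
  (L ∘ₗ (CocycleAlg.val R).toLinearMap).codRestrict (Subalgebra.toSubmodule S.cocycles) fun z =>
    hL.cocycles (CocycleAlg.val_mem R z)

theorem val_mapCocycle (hL : PreservesCochains L) (z : R.CocycleAlg) :
    CocycleAlg.val S (hL.mapCocycle z) = L (CocycleAlg.val R z) := rfl

end PreservesCochains

/-! ### Transport of Ext algebras along homotopy equivalences. -/

variable {R S}

/-- A pair of chain maps between two resolutions. -/
structure ChainPair (R : GrProjRes M) (S : GrProjRes N) where
  hom : R.Tot →ₗ[Aᵐᵒᵖ] S.Tot
  inv : S.Tot →ₗ[Aᵐᵒᵖ] R.Tot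
  hom_mem : ∀ j m, ∀ x ∈ R.piece j m, hom x ∈ S.piece j m
  inv_mem : ∀ j m, ∀ x ∈ S.piece j m, inv x ∈ R.piece j m
  hom_D : ∀ x, S.D (hom x) = hom (R.D x)
  inv_D : ∀ x, R.D (inv x) = inv (S.D x)
  homotopy : inv ∘ₗ hom - 1 ∈ R.coboundary 0 0

namespace ChainPair

variable (c : ChainPair R S)

/-- Transport of endomorphisms along a pair of chain maps. -/
def transport : Module.End Aᵐᵒᵖ R.Tot →ₗ[k] Module.End Aᵐᵒᵖ S.Tot where
  toFun f := c.hom ∘ₗ f ∘ₗ c.inv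
  map_add' f g := LinearMap.ext fun x => map_add c.hom _ _
  map_smul' r f := LinearMap.ext fun x => by
    change c.hom (r • f (c.inv x)) = r • c.hom (f (c.inv x))
    exact LinearMap.map_smul_of_tower c.hom r _

theorem transport_apply (f : Module.End Aᵐᵒᵖ R.Tot) (x : S.Tot) :
    c.transport f x = c.hom (f (c.inv x)) := rfl

theorem preservesCochains_transport : PreservesCochains c.transport where
  homPiece hf j m _ hx := c.hom_mem _ _ _ (hf _ _ _ (c.inv_mem j m _ hx))
  D_mul f := LinearMap.ext fun x => by
    rw [Module.End.mul_apply, transport_apply, transport_apply, c.hom_D, Module.End.mul_apply]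
  mul_D f := LinearMap.ext fun x => by
    rw [Module.End.mul_apply, transport_apply, transport_apply, ← c.inv_D, Module.End.mul_apply]

/-- Transport is multiplicative only up to homotopy: the defect is the transport of f (inv ∘ hom -
1) g, whose middle factor is null-homotopic. -/
theorem transport_mul_sub_mem {f g : Module.End Aᵐᵒᵖ R.Tot} (hf : f ∈ R.cocycles)
    (hg : g ∈ R.cocycles) :
    c.transport f * c.transport g - c.transport (f * g) ∈ S.coboundaries := by
  have h : c.transport f * c.transport g - c.transport (f * g) =
      c.transport (f * ((c.inv ∘ₗ c.hom - 1) * g)) := LinearMap.ext fun x => by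
    simp [transport_apply]
  rw [h]
  exact c.preservesCochains_transport.coboundaries (R.cocycles_mul_coboundaries hf
    (R.coboundaries_mul_cocycles (R.mem_coboundaries_of_mem (p := 0) c.homotopy) hg))

/-- The map of Ext algebras induced by a pair of chain maps, where the pair is homotopic to the
identity on both sides. -/
def extMap (h1 : c.hom ∘ₗ c.inv - 1 ∈ S.coboundary 0 0) : R.ExtAlg →ₐ[k] S.ExtAlg :=
  Ideal.Quotient.liftₐ R.boundaryIdeal
    (AlgHom.ofLinearMap ((Ideal.Quotient.mkₐ k S.boundaryIdeal).toLinearMap ∘ₗ c.preservesCochains_transport.mapCocycle)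
      (by
        refine Ideal.Quotient.eq.2 ?_
        rw [mem_boundaryIdeal, map_sub, PreservesCochains.val_mapCocycle, map_one (CocycleAlg.val R),
          map_one (CocycleAlg.val S)]
        exact S.mem_coboundaries_of_mem (p := 0) h1)
      (fun x y => by
        refine Eq.symm ((map_mul (Ideal.Quotient.mk S.boundaryIdeal) _ _).symm.trans
          (Ideal.Quotient.eq.2 ?_))
        rw [mem_boundaryIdeal, map_sub, map_mul]
        simp only [PreservesCochains.val_mapCocycle, map_mul]
        exact c.transport_mul_sub_mem (CocycleAlg.val_mem R x) (CocycleAlg.val_mem R y)))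
    fun z hz => Ideal.Quotient.eq_zero_iff_mem.2
      (c.preservesCochains_transport.coboundaries (R.mem_boundaryIdeal.1 hz))

theorem extMap_mk (h1 : c.hom ∘ₗ c.inv - 1 ∈ S.coboundary 0 0) (z : R.CocycleAlg) :
    c.extMap h1 (Ideal.Quotient.mk _ z) = Ideal.Quotient.mk _ (c.preservesCochains_transport.mapCocycle z) := rfl

/-- The pair of chain maps in the opposite direction. -/
def symm (h1 : c.hom ∘ₗ c.inv - 1 ∈ S.coboundary 0 0) : ChainPair S R where
  hom := c.inv
  inv := c.hom
  hom_mem := c.inv_mem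
  inv_mem := c.hom_mem
  hom_D := c.inv_D
  inv_D := c.hom_D
  homotopy := h1

theorem symm_homotopy (h1 : c.hom ∘ₗ c.inv - 1 ∈ S.coboundary 0 0) :
    (c.symm h1).hom ∘ₗ (c.symm h1).inv - 1 ∈ R.coboundary 0 0 := c.homotopy

theorem extMap_symm_extMap (h1 : c.hom ∘ₗ c.inv - 1 ∈ S.coboundary 0 0) (x : R.ExtAlg) :
    (c.symm h1).extMap (c.symm_homotopy h1) (c.extMap h1 x) = x := by
  obtain ⟨z, rfl⟩ := Ideal.Quotient.mk_surjective x
  rw [extMap_mk, extMap_mk]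
  refine Ideal.Quotient.eq.2 ?_
  rw [mem_boundaryIdeal, map_sub, PreservesCochains.val_mapCocycle, PreservesCochains.val_mapCocycle]
  set f := CocycleAlg.val R z with hf
  have hfm : f ∈ R.cocycles := CocycleAlg.val_mem R z
  -- With e = inv ∘ hom the round trip sends f to e f e, and e f e - f expands into terms each
  -- containing the null-homotopic factor e - 1.
  have h : (c.symm h1).transport (c.transport f) - f =
      (c.inv ∘ₗ c.hom - 1) * (f * (c.inv ∘ₗ c.hom - 1)) + (c.inv ∘ₗ c.hom - 1) * f +
        f * (c.inv ∘ₗ c.hom - 1) := by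
    have key : ∀ e f : Module.End Aᵐᵒᵖ R.Tot,
        e * f * e - f = (e - 1) * (f * (e - 1)) + (e - 1) * f + f * (e - 1) := fun e f => by
      simp only [mul_sub, sub_mul, mul_one, one_mul, mul_assoc]
      abel
    exact key (c.inv ∘ₗ c.hom) f
  rw [h]
  have hb : c.inv ∘ₗ c.hom - 1 ∈ R.coboundaries :=
    R.mem_coboundaries_of_mem (p := 0) c.homotopy
  -- Null-homotopic elements absorb multiplication only by chain maps, so the second factor e - 1 in
  -- the first term must also be known to be a chain map.
  have hc : c.inv ∘ₗ c.hom - 1 ∈ R.cocycles := by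
    refine R.mem_cocycles_of_mem (p := 0) (n := 0) ⟨?_, ?_⟩
    · refine sub_mem (fun j m x hx => ?_) R.one_mem_homPiece
      simpa using c.inv_mem _ _ _ (c.hom_mem _ _ _ hx)
    · refine LinearMap.ext fun x => ?_
      simp [c.hom_D, c.inv_D]
  exact add_mem (add_mem (R.coboundaries_mul_cocycles hb (mul_mem hfm hc))
    (R.coboundaries_mul_cocycles hb hfm)) (R.cocycles_mul_coboundaries hfm hb)

/-- The isomorphism of Ext algebras induced by a homotopy equivalence. -/
def extEquiv (h1 : c.hom ∘ₗ c.inv - 1 ∈ S.coboundary 0 0) : R.ExtAlg ≃ₐ[k] S.ExtAlg :=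
  AlgEquiv.ofAlgHom (c.extMap h1) ((c.symm h1).extMap (c.symm_homotopy h1))
    (AlgHom.ext fun x => (c.symm h1).extMap_symm_extMap (c.symm_homotopy h1) x)
    (AlgHom.ext fun x => c.extMap_symm_extMap h1 x)

theorem extMap_mem (h1 : c.hom ∘ₗ c.inv - 1 ∈ S.coboundary 0 0) {p : ℕ} {n : ℤ} {x : R.ExtAlg}
    (hx : x ∈ R.extBigrade p n) : c.extMap h1 x ∈ S.extBigrade p n := by
  obtain ⟨z, hz, rfl⟩ := hx
  exact ⟨c.preservesCochains_transport.mapCocycle z, c.preservesCochains_transport.cocycle hz, rfl⟩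

theorem map_extEquiv (h1 : c.hom ∘ₗ c.inv - 1 ∈ S.coboundary 0 0) (p : ℕ) (n : ℤ) :
    (R.extBigrade p n).map (c.extEquiv h1).toLinearMap = S.extBigrade p n := by
  refine le_antisymm ?_ fun x hx => ?_
  · rintro _ ⟨x, hx, rfl⟩
    exact c.extMap_mem h1 hx
  · exact ⟨(c.symm h1).extMap (c.symm_homotopy h1) x, (c.symm h1).extMap_mem (c.symm_homotopy h1) hx,
      (c.extEquiv h1).apply_symm_apply x⟩

end ChainPair

/-- The Ext algebra is independent of the resolution, up to isomorphism. -/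
theorem exists_extEquiv [GradedAlgebra 𝒜] (R : GrProjRes M) (S : GrProjRes N)
    (u : M ≃ₗ[Aᵐᵒᵖ] N) (hu : IsGraded u.toLinearMap) (hu' : IsGraded u.symm.toLinearMap) :
    ∃ e : R.ExtAlg ≃ₐ[k] S.ExtAlg,
      ∀ p n, (R.extBigrade p n).map e.toLinearMap = S.extBigrade p n := by
  obtain ⟨φ, hφ, hφ0, hφd⟩ := exists_chainMap R S hu
  obtain ⟨ψ, hψ, hψ0, hψd⟩ := exists_chainMap S R hu'
  -- The composite ψ φ lifts u⁻¹ u = 1, so ψ φ - 1 is a chain map lifting zero and is therefore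
  -- null-homotopic; likewise for φ ψ.
  have h1 : totMap ψ ∘ₗ totMap φ - 1 ∈ R.coboundary 0 0 := by
    refine Eq.mp (congrArg (· ∈ R.coboundary 0 0) ?_) (R.totMap_mem_coboundary (φ := fun i => ψ i ∘ₗ φ i - LinearMap.id)
      (fun i => ((hψ i).comp (hφ i)).sub IsGraded.id)
      (fun x => by simp [hψ0, hφ0]) (fun i x => by simp [hψd, hφd]))
    exact LinearMap.ext fun x => DFinsupp.ext fun i => rfl
  have h2 : totMap φ ∘ₗ totMap ψ - 1 ∈ S.coboundary 0 0 := by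
    refine Eq.mp (congrArg (· ∈ S.coboundary 0 0) ?_) (S.totMap_mem_coboundary (φ := fun i => φ i ∘ₗ ψ i - LinearMap.id)
      (fun i => ((hφ i).comp (hψ i)).sub IsGraded.id)
      (fun x => by simp [hψ0, hφ0]) (fun i x => by simp [hψd, hφd]))
    exact LinearMap.ext fun x => DFinsupp.ext fun i => rfl
  let c : ChainPair R S :=
    { hom := totMap φ
      inv := totMap ψ
      hom_mem := fun _ _ _ => totMap_mem_piece hφ
      inv_mem := fun _ _ _ => totMap_mem_piece hψ
      hom_D := D_totMap hφd
      inv_D := D_totMap hψd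
      homotopy := h1 }
  exact ⟨c.extEquiv h2, c.map_extEquiv h2⟩

end GrProjRes

/-! ### Induced modules over the skew group algebra -/

section Induction

variable {𝒜 : ℕ → Submodule k A} {G : Subgroup (GrAut 𝒜)}

/-- The right action of `A * G` on `G → M`, given by `(m ⊗ g) (a * h) = m g(a) ⊗ g h`, where the
function `x` stands for `∑ g, x g ⊗ g`. -/
def indHom (M : Type u) [AddCommGroup M] [Module Aᵐᵒᵖ M] (G : Subgroup (GrAut 𝒜)) :
    SkewGrp 𝒜 G →+* (AddMonoid.End (G → M))ᵐᵒᵖ :=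
  SkewMonoidAlgebra.liftNCRingHom
    { toFun := fun a => op
        { toFun := fun x g => op (g • a) • x g
          map_zero' := funext fun g => smul_zero _
          map_add' := fun x y => funext fun g => smul_add _ _ _ }
      map_one' := congrArg op (AddMonoidHom.ext fun x => funext fun g => by
        change op (g • (1 : A)) • x g = x g
        rw [smul_one, op_one, one_smul])
      map_mul' := fun a b => congrArg op (AddMonoidHom.ext fun x => funext fun g => by
        change op (g • (a * b)) • x g = op (g • b) • op (g • a) • x g
        rw [smul_mul', op_mul, mul_smul])
      map_zero' := congrArg op (AddMonoidHom.ext fun x => funext fun g => by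
        change op (g • (0 : A)) • x g = 0
        rw [smul_zero, op_zero, zero_smul])
      map_add' := fun a b => congrArg op (AddMonoidHom.ext fun x => funext fun g => by
        change op (g • (a + b)) • x g = op (g • a) • x g + op (g • b) • x g
        rw [smul_add, op_add, add_smul]) }
    { toFun := fun h => op
        { toFun := fun x g => x (g * h⁻¹)
          map_zero' := rfl
          map_add' := fun _ _ => rfl }
      map_one' := congrArg op (AddMonoidHom.ext fun x => funext fun g => by
        change x (g * 1⁻¹) = x g
        rw [inv_one, mul_one])
      map_mul' := fun h h' => congrArg op (AddMonoidHom.ext fun x => funext fun g => by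
        change x (g * (h * h')⁻¹) = x (g * h'⁻¹ * h⁻¹)
        rw [mul_inv_rev, mul_assoc]) }
    (fun {a h} => congrArg op (AddMonoidHom.ext fun x => funext fun g => by
      change op ((g * h⁻¹) • h • a) • x (g * h⁻¹) = op (g • a) • x (g * h⁻¹)
      rw [smul_smul, inv_mul_cancel_right]))

theorem indHom_single (M : Type u) [AddCommGroup M] [Module Aᵐᵒᵖ M] (h : G) (a : A) (x : G → M)
    (g : G) : unop (indHom M G (SkewMonoidAlgebra.single h a)) x g =
      op ((g * h⁻¹) • a) • x (g * h⁻¹) := by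
  have : indHom M G (SkewMonoidAlgebra.single h a) = _ := SkewMonoidAlgebra.liftNC_single _ _ _ _
  rw [this]
  rfl

/-- The right `A * G`-module structure on `G → M`. -/
@[reducible] def indModule (M : Type u) [AddCommGroup M] [Module Aᵐᵒᵖ M]
    (G : Subgroup (GrAut 𝒜)) : Module (SkewGrp 𝒜 G)ᵐᵒᵖ (G → M) where
  smul x c := unop (indHom M G (unop x)) c
  one_smul c := by
    change unop (indHom M G 1) c = c
    rw [map_one]
    rfl
  mul_smul x y c := by
    change unop (indHom M G (unop y * unop x)) c = _
    rw [map_mul]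
    rfl
  smul_zero x := map_zero (unop (indHom M G (unop x)))
  smul_add x := map_add (unop (indHom M G (unop x)))
  zero_smul c := by
    change unop (indHom M G 0) c = 0
    rw [map_zero]
    rfl
  add_smul x y c := by
    change unop (indHom M G (unop x + unop y)) c = _
    rw [map_add]
    rfl

theorem skew_eq_sum (b : SkewGrp 𝒜 G) :
    b = ∑ g ∈ b.support, SkewMonoidAlgebra.single g (b.coeff g) := by
  conv_lhs => rw [← SkewMonoidAlgebra.sum_single b, SkewMonoidAlgebra.sum_def']

theorem indHom_smul (M : Type u) [AddCommGroup M] [Module k M] [Module Aᵐᵒᵖ M]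
    [IsScalarTower k Aᵐᵒᵖ M] (r : k) (b : SkewGrp 𝒜 G) (x : G → M) :
    unop (indHom M G (r • b)) x = r • unop (indHom M G b) x := by
  induction b using SkewMonoidAlgebra.induction_on with
  | zero =>
    rw [smul_zero, map_zero]
    exact (smul_zero r).symm
  | add b c hb hc =>
    rw [smul_add, map_add, map_add]
    change unop (indHom M G (r • b)) x + unop (indHom M G (r • c)) x =
      r • (unop (indHom M G b) x + unop (indHom M G c) x)
    rw [hb, hc, smul_add]
  | single h a =>
    funext g
    rw [SkewMonoidAlgebra.smul_single, Pi.smul_apply, indHom_single, indHom_single]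
    have h' : (g * h⁻¹) • r • a = r • (g * h⁻¹) • a :=
      map_smul ((g * h⁻¹ : G) : A ≃ₐ[k] A) r a
    rw [h', op_smul, smul_assoc]

theorem isInternal_pi {ι α V : Type*} [DecidableEq ι] [Finite α] [AddCommGroup V] [Module k V]
    (gr : ι → Submodule k V) (h : DirectSum.IsInternal gr) :
    DirectSum.IsInternal fun n => Submodule.pi Set.univ fun _ : α => gr n := by
  classical
  cases nonempty_fintype α
  obtain ⟨p, hp, hp1, hp2, hp3⟩ := exists_proj gr h
  refine isInternal_of_proj _ (fun n => LinearMap.pi fun g => p n ∘ₗ LinearMap.proj g) ?_ ?_ ?_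
  · exact fun n x hx => funext fun g => hp1 n _ (hx g trivial)
  · exact fun m n hmn x hx => funext fun g => hp2 m n hmn _ (hx g trivial)
  · rw [eq_top_iff]
    intro x _
    rw [← Finset.univ_sum_single x]
    refine sum_mem fun g _ => ?_
    obtain ⟨s, hs⟩ := hp3 (x g)
    rw [← hs, show Pi.single (M := fun _ : α => V) g (∑ n ∈ s, p n (x g)) =
        ∑ n ∈ s, Pi.single (M := fun _ : α => V) g (p n (x g)) from
      map_sum (AddMonoidHom.single (fun _ : α => V) g) (fun n => p n (x g)) s]
    refine sum_mem fun n _ => Submodule.mem_iSup_of_mem n fun g' _ => ?_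
    change Pi.single (M := fun _ : α => V) g (p n (x g)) g' ∈ gr n
    rcases eq_or_ne g' g with rfl | hg
    · rw [Pi.single_eq_same]; exact hp n _
    · rw [Pi.single_eq_of_ne hg]; exact zero_mem _

/-- An additive map compatible with the homogeneous elements `a * h` is `A * G`-linear. -/
def skewLinear {N₁ N₂ : Type*} [AddCommGroup N₁] [AddCommGroup N₂] [Module (SkewGrp 𝒜 G)ᵐᵒᵖ N₁]
    [Module (SkewGrp 𝒜 G)ᵐᵒᵖ N₂] (f : N₁ →+ N₂)
    (hf : ∀ (h : G) (a : A) (x : N₁), f (op (SkewMonoidAlgebra.single h a : SkewGrp 𝒜 G) • x) =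
      op (SkewMonoidAlgebra.single h a : SkewGrp 𝒜 G) • f x) :
    N₁ →ₗ[(SkewGrp 𝒜 G)ᵐᵒᵖ] N₂ :=
  { f with
    map_smul' := fun b x => by
      obtain ⟨b, rfl⟩ := op_surjective b
      change f (op b • x) = op b • f x
      induction b using SkewMonoidAlgebra.induction_on with
      | zero => rw [op_zero, zero_smul, zero_smul, map_zero]
      | add b c hb hc => rw [op_add, add_smul, add_smul, map_add, hb, hc]
      | single h a => exact hf h a x }

theorem skewLinear_apply {N₁ N₂ : Type*} [AddCommGroup N₁] [AddCommGroup N₂]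
    [Module (SkewGrp 𝒜 G)ᵐᵒᵖ N₁] [Module (SkewGrp 𝒜 G)ᵐᵒᵖ N₂] (f : N₁ →+ N₂)
    (hf : ∀ (h : G) (a : A) (x : N₁), f (op (SkewMonoidAlgebra.single h a : SkewGrp 𝒜 G) • x) =
      op (SkewMonoidAlgebra.single h a : SkewGrp 𝒜 G) • f x) (x : N₁) : skewLinear f hf x = f x := rfl

variable [GradedAlgebra 𝒜] [Finite G]

/-- The graded right `A * G`-module `M ⊗_A (A * G)`. -/
def Ind (G : Subgroup (GrAut 𝒜)) [Finite G] (M : GrMod 𝒜) : GrMod (skewGr 𝒜 G) where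
  carrier := G → M
  module := indModule M G
  isScalarTower := letI := indModule M G
    ⟨fun r b x => indHom_smul M r (unop b) x⟩
  gr n := Submodule.pi Set.univ fun _ => M.gr n
  isInternal := isInternal_pi M.gr M.isInternal
  smul_mem i n b x hb hx := by
    let _ := indModule M G
    change op b • x ∈ _
    rw [skew_eq_sum b, Finset.op_sum, Finset.sum_smul]
    refine sum_mem fun h _ g _ => ?_
    change unop (indHom M G (SkewMonoidAlgebra.single h (b.coeff h))) x g ∈ _
    rw [indHom_single]
    exact M.smul_mem i n _ _ (smul_mem_of_mem 𝒜 G _ (hb h)) (hx _ trivial)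

namespace Ind

variable {M N K : GrMod 𝒜}

/-- The coefficient `m_g` of `∑ g, m_g ⊗ g`. -/
def coeff (g : G) : Ind G M →ₗ[k] M := LinearMap.proj (φ := fun _ : G => (M : Type u)) g

/-- The element `∑ g, m_g ⊗ g`. -/
def mk (x : G → M) : Ind G M := x

@[ext] theorem ext {x y : Ind G M} (h : ∀ g, coeff g x = coeff g y) : x = y := funext h

theorem mem_gr {n : ℤ} {x : Ind G M} : x ∈ (Ind G M).gr n ↔ ∀ g, coeff g x ∈ M.gr n :=
  ⟨fun h g => h g trivial, fun h g _ => h g⟩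

theorem coeff_single_smul (g h : G) (a : A) (x : Ind G M) :
    coeff g (op (SkewMonoidAlgebra.single h a : SkewGrp 𝒜 G) • x) =
      op ((g * h⁻¹) • a) • coeff (g * h⁻¹) x :=
  indHom_single M h a x g

open Classical in
/-- The element `m ⊗ g`. -/
def single (g : G) : M →ₗ[k] Ind G M := LinearMap.single k (fun _ : G => (M : Type u)) g

theorem coeff_single_same (g : G) (m : M) : coeff g (single g m) = m := by
  classical exact Pi.single_eq_same (M := fun _ : G => (M : Type u)) g m

theorem coeff_single_of_ne {g h : G} (hgh : h ≠ g) (m : M) : coeff h (single g m) = 0 := by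
  classical exact Pi.single_eq_of_ne (M := fun _ : G => (M : Type u)) hgh m

theorem sum_single [Fintype G] (x : Ind G M) : ∑ g, single g (coeff g x) = x := by
  ext h
  rw [map_sum, Finset.sum_eq_single h, coeff_single_same]
  · intro g _ hg
    rw [coeff_single_of_ne hg.symm]
  · simp

theorem single_mem {n : ℤ} {m : M} (hm : m ∈ M.gr n) (g : G) : single g m ∈ (Ind G M).gr n := by
  rw [mem_gr]
  intro h
  rcases eq_or_ne h g with rfl | hg
  · rwa [coeff_single_same]
  · rw [coeff_single_of_ne hg]; exact zero_mem _

theorem single_smul_single (g h : G) (a : A) (m : M) :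
    op (SkewMonoidAlgebra.single h a : SkewGrp 𝒜 G) • single g m = single (g * h) (op (g • a) • m) := by
  ext l
  rw [coeff_single_smul]
  rcases eq_or_ne (l * h⁻¹) g with hl | hl
  · obtain rfl : l = g * h := by rw [← hl, inv_mul_cancel_right]
    rw [hl, coeff_single_same, coeff_single_same]
  · rw [coeff_single_of_ne hl, coeff_single_of_ne, smul_zero]
    rintro rfl
    exact hl (mul_inv_cancel_right _ _)

end Ind

/-! ### Functoriality and exactness of induction. -/

namespace Ind

variable {M N K : GrMod 𝒜}

/-- The map of induced modules induced by a linear map. -/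
def indMap (f : M →ₗ[Aᵐᵒᵖ] N) : Ind G M →ₗ[(SkewGrp 𝒜 G)ᵐᵒᵖ] Ind G N :=
  skewLinear
    { toFun := fun x => mk fun g => f (coeff g x)
      map_zero' := ext fun g => map_zero f
      map_add' := fun x y => ext fun g => map_add f (coeff g x) (coeff g y) }
    fun h a _ => ext fun g => by
      change f (coeff g _) = _
      rw [coeff_single_smul, map_smul, coeff_single_smul]
      rfl

theorem coeff_indMap (f : M →ₗ[Aᵐᵒᵖ] N) (x : Ind G M) (g : G) :
    coeff g (indMap f x) = f (coeff g x) :=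
  rfl

theorem indMap_isGraded {f : M →ₗ[Aᵐᵒᵖ] N} (hf : IsGraded f) : IsGraded (indMap (G := G) f) :=
  fun n _ hx => mem_gr.2 fun g => hf n _ (mem_gr.1 hx g)

theorem indMap_surjective {f : M →ₗ[Aᵐᵒᵖ] N} (hf : Function.Surjective f) :
    Function.Surjective (indMap (G := G) f) := fun y =>
  ⟨mk fun g => (hf (coeff g y)).choose, ext fun g => (hf (coeff g y)).choose_spec⟩

theorem indMap_exact {f : M →ₗ[Aᵐᵒᵖ] N} {f' : N →ₗ[Aᵐᵒᵖ] K} (h : Function.Exact f f') :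
    Function.Exact (indMap (G := G) f) (indMap (G := G) f') := by
  intro y
  constructor
  · intro hy
    have hy' : ∀ g, ∃ x, f x = coeff g y := fun g => (h _).1 (by
      rw [← coeff_indMap, hy, map_zero])
    choose x hx using hy'
    exact ⟨mk x, ext hx⟩
  · rintro ⟨x, rfl⟩
    exact ext fun g => by rw [coeff_indMap, coeff_indMap, h.apply_apply_eq_zero, map_zero]

end Ind

end Induction

/-! ### Induction preserves projectives and generating degrees. -/

section Restriction

variable {𝒜 : ℕ → Submodule k A} {G : Subgroup (GrAut 𝒜)}

/-- A module over the skew group algebra as a module over `A`. -/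
@[reducible] def resModule (G : Subgroup (GrAut 𝒜)) (N : Type*) [AddCommGroup N]
    [Module (SkewGrp 𝒜 G)ᵐᵒᵖ N] : Module Aᵐᵒᵖ N :=
  Module.compHom N (RingHom.op (SkewMonoidAlgebra.singleOneRingHom : A →+* SkewGrp 𝒜 G))

variable [GradedAlgebra 𝒜] [Finite G]

namespace Ind

variable {M N K : GrMod 𝒜}

/-- Frobenius reciprocity: an A * G-linear map out of M ⊗_A (A * G) is the same as an A-linear map
out of M. The A-linear inclusion m ↦ m ⊗ 1 is lifted through f by projectivity of M, and the lift s
is extended to the induced module. -/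
theorem exists_section (hM : Module.Projective Aᵐᵒᵖ M) {N : Type*} [AddCommGroup N]
    [Module (SkewGrp 𝒜 G)ᵐᵒᵖ N] (f : N →ₗ[(SkewGrp 𝒜 G)ᵐᵒᵖ] Ind G M)
    (hf : Function.Surjective f) :
    ∃ s : Ind G M →ₗ[(SkewGrp 𝒜 G)ᵐᵒᵖ] N, f ∘ₗ s = LinearMap.id := by
  cases nonempty_fintype G
  let _ := resModule G N
  let _ := resModule G (Ind G M)
  let f' : N →ₗ[Aᵐᵒᵖ] Ind G M :=
    { f.toAddMonoidHom with
      map_smul' := fun a x => f.map_smul (op (SkewMonoidAlgebra.single 1 (unop a))) x }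
  let i : M →ₗ[Aᵐᵒᵖ] Ind G M :=
    { toFun := single 1
      map_add' := map_add (single 1)
      map_smul' := fun a m => by
        have := single_smul_single (1 : G) 1 (unop a) m
        rw [one_smul, mul_one] at this
        exact this.symm }
  obtain ⟨s, hs⟩ := Module.projective_lifting_property f' i hf
  have hs' : ∀ m, f (s m) = single 1 m := fun m => LinearMap.congr_fun hs m
  have hsm : ∀ (a : A) (m : M), s (op a • m) =
      op (SkewMonoidAlgebra.single 1 a : SkewGrp 𝒜 G) • s m := fun a m => s.map_smul (op a) m
  -- Since m ⊗ g = (m ⊗ 1) · g, the only possible extension of s sends m ⊗ g to s(m) · g.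
  let t : Ind G M →+ N :=
    { toFun := fun x => ∑ g : G,
        op (SkewMonoidAlgebra.single g 1 : SkewGrp 𝒜 G) • s (coeff g x)
      map_zero' := Finset.sum_eq_zero fun g _ => by
        rw [map_zero (coeff g), map_zero s, smul_zero]
      map_add' := fun x y => by
        simp only [map_add (coeff _), map_add s, smul_add, Finset.sum_add_distrib] }
  have ht : ∀ x, t x = ∑ g : G,
    op (SkewMonoidAlgebra.single g 1 : SkewGrp 𝒜 G) • s (coeff g x) := fun _ => rfl
  refine ⟨skewLinear t fun h a x => ?_, LinearMap.ext fun x => ?_⟩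
  · rw [ht, ht, Finset.smul_sum, ← Equiv.sum_comp (Equiv.mulRight h)]
    refine Finset.sum_congr rfl fun g _ => ?_
    rw [Equiv.coe_mulRight, coeff_single_smul, mul_inv_cancel_right, hsm, smul_smul, smul_smul,
      ← op_mul, ← op_mul, SkewMonoidAlgebra.single_mul_single, SkewMonoidAlgebra.single_mul_single,
      one_mul, one_mul, one_smul, mul_one]
  · change f (t x) = x
    rw [ht, map_sum]
    refine Eq.trans (Finset.sum_congr rfl fun g _ => ?_) (sum_single x)
    rw [map_smul, hs', single_smul_single, one_mul, smul_one, op_one, one_smul]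

theorem projective (hM : Module.Projective Aᵐᵒᵖ M) :
    Module.Projective (SkewGrp 𝒜 G)ᵐᵒᵖ (Ind G M) :=
  Module.Projective.of_lifting_property'' fun f hf => exists_section hM f hf

theorem generatedInDegree {n : ℤ} (hM : M.GeneratedInDegree n) :
    (Ind G M).GeneratedInDegree n := by
  cases nonempty_fintype G
  refine eq_top_iff.2 fun x _ => ?_
  rw [← sum_single x]
  refine sum_mem fun g _ => ?_
  have hm : coeff g x ∈ Submodule.span Aᵐᵒᵖ (M.gr n : Set M) := by
    rw [hM]
    trivial
  generalize coeff g x = m at hm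
  induction hm using Submodule.span_induction with
  | mem m hm => exact Submodule.subset_span (single_mem hm g)
  | zero => rw [map_zero]; exact zero_mem _
  | add m m' _ _ h h' => rw [map_add]; exact add_mem h h'
  | smul a m _ h =>
    -- A scalar a moves past g as g(a), so acting on m ⊗ g by g⁻¹(a) gives (m · a) ⊗ g.
    have := single_smul_single g 1 (g⁻¹ • unop a) m
    rw [smul_inv_smul, mul_one, op_unop] at this
    rw [← this]
    exact Submodule.smul_mem _ _ h

end Ind

/-- The resolution induced by a resolution. -/
def indRes (G : Subgroup (GrAut 𝒜)) [Finite G] {M : GrMod 𝒜} (R : GrProjRes M) :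
    GrProjRes (Ind G M) where
  P i := Ind G (R.P i)
  d i := Ind.indMap (R.d i)
  ε := Ind.indMap R.ε
  projective i := Ind.projective (R.projective i)
  d_mem i := Ind.indMap_isGraded (R.d_mem i)
  ε_mem := Ind.indMap_isGraded R.ε_mem
  ε_surjective := Ind.indMap_surjective R.ε_surjective
  exact_zero := Ind.indMap_exact R.exact_zero
  exact_succ i := Ind.indMap_exact (R.exact_succ i)

/-! ### The degree zero part of A * G as an induced module. -/

theorem projZero_single (h : G) (a : A) :
    (GradedRing.projZeroRingHom' (skewGr 𝒜 G) (SkewMonoidAlgebra.single h a) : SkewGrp 𝒜 G) =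
      SkewMonoidAlgebra.single h (GradedRing.projZeroRingHom' 𝒜 a : A) := by
  induction a using induction_graded (𝒜 := 𝒜) with
  | zero => simp only [SkewMonoidAlgebra.single_zero, map_zero, ZeroMemClass.coe_zero]
  | add a b ha hb =>
    rw [SkewMonoidAlgebra.single_add, map_add, map_add, AddMemClass.coe_add, AddMemClass.coe_add,
      SkewMonoidAlgebra.single_add, ha, hb]
  | mem n a ha =>
    have h' := single_mem_skewGr 𝒜 G h ha
    simp only [GradedRing.coe_projZeroRingHom'_apply, GradedRing.projZeroRingHom_apply]
    rcases eq_or_ne n 0 with rfl | hn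
    · rw [DirectSum.decompose_of_mem_same _ h', DirectSum.decompose_of_mem_same _ ha]
    · rw [DirectSum.decompose_of_mem_ne _ h' hn, DirectSum.decompose_of_mem_ne _ ha hn,
        SkewMonoidAlgebra.single_zero]

/-- The map `(A * G)₀ → A₀ ⊗_A (A * G)`. -/
def degZeroToInd (G : Subgroup (GrAut 𝒜)) [Finite G] :
    degZero (skewGr 𝒜 G) →ₗ[(SkewGrp 𝒜 G)ᵐᵒᵖ] Ind G (degZero 𝒜) :=
  skewLinear
    { toFun := fun c : skewGr 𝒜 G 0 =>
        Ind.mk (M := degZero 𝒜) fun g => (⟨c.1.coeff g, c.2 g⟩ : 𝒜 0)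
      map_zero' := rfl
      map_add' := fun c c' => Ind.ext fun g => Subtype.ext (by
        exact congrArg (fun f => f g) (SkewMonoidAlgebra.coeff_add c.1 c'.1)) }
    fun h a (c : skewGr 𝒜 G 0) => Ind.ext fun g => by
      rw [Ind.coeff_single_smul]
      refine Subtype.ext ?_
      change ((c : SkewGrp 𝒜 G) * (GradedRing.projZeroRingHom' (skewGr 𝒜 G)
        (SkewMonoidAlgebra.single h a) : SkewGrp 𝒜 G)).coeff g = (c : SkewGrp 𝒜 G).coeff (g * h⁻¹) *
          (GradedRing.projZeroRingHom' 𝒜 ((g * h⁻¹) • a) : A)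
      have := smul_projZero 𝒜 ((g * h⁻¹ : G) : GrAut 𝒜) a
      rw [projZero_single, SkewMonoidAlgebra.coeff_mul_single]
      exact congrArg _ this.symm

theorem degZeroToInd_bijective : Function.Bijective (degZeroToInd (𝒜 := 𝒜) G) := by
  constructor
  · intro (c : skewGr 𝒜 G 0) (c' : skewGr 𝒜 G 0) h
    refine Subtype.ext (SkewMonoidAlgebra.ext fun g => ?_)
    exact congrArg Subtype.val (congrArg (Ind.coeff (M := degZero 𝒜) g) h)
  · intro y
    cases nonempty_fintype G
    let z : G → 𝒜 0 := fun g => Ind.coeff (M := degZero 𝒜) g y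
    exact ⟨(⟨⟨Finsupp.equivFunOnFinite.symm fun g => (z g : A)⟩, fun g => (z g).2⟩ :
      skewGr 𝒜 G 0), Ind.ext fun g => rfl⟩

/-- The isomorphism `(A * G)₀ ≅ A₀ ⊗_A (A * G)` of graded right `A * G`-modules. -/
def degZeroEquivInd (G : Subgroup (GrAut 𝒜)) [Finite G] :
    degZero (skewGr 𝒜 G) ≃ₗ[(SkewGrp 𝒜 G)ᵐᵒᵖ] Ind G (degZero 𝒜) :=
  LinearEquiv.ofBijective (degZeroToInd G) degZeroToInd_bijective

/-- Only elements of degree 0 can be nonzero, and in that degree the target imposes no condition.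
Every linear map between the degree zero modules in question is therefore graded. -/
theorem isGraded_of_concentrated {M N : GrMod 𝒜} (f : M →ₗ[Aᵐᵒᵖ] N) (hM : ∀ n ≠ 0, M.gr n = ⊥)
    (hN : N.gr 0 = ⊤) : IsGraded f := fun n x hx => by
  rcases eq_or_ne n 0 with rfl | hn
  · rw [hN]; trivial
  · rw [hM n hn, Submodule.mem_bot] at hx
    rw [hx, map_zero]
    exact zero_mem _

theorem degZero_gr_zero : (degZero 𝒜).gr 0 = ⊤ := by
  change (if (0 : ℤ) = 0 then ⊤ else ⊥ : Submodule k (𝒜 0)) = ⊤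
  exact if_pos rfl

theorem degZero_gr_of_ne {n : ℤ} (hn : n ≠ 0) : (degZero 𝒜).gr n = ⊥ := by
  change (if n = 0 then ⊤ else ⊥ : Submodule k (𝒜 0)) = ⊥
  exact if_neg hn

theorem ind_degZero_gr_zero : (Ind G (degZero 𝒜)).gr 0 = ⊤ :=
  eq_top_iff.2 fun x _ => Ind.mem_gr.2 fun g => by rw [degZero_gr_zero]; trivial

theorem ind_degZero_gr_of_ne {n : ℤ} (hn : n ≠ 0) : (Ind G (degZero 𝒜)).gr n = ⊥ :=
  eq_bot_iff.2 fun x hx => Ind.ext fun g => by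
    have := Ind.mem_gr.1 hx g
    rw [degZero_gr_of_ne hn, Submodule.mem_bot] at this
    rw [this, map_zero]

theorem degZeroEquivInd_isGraded : IsGraded (degZeroEquivInd (𝒜 := 𝒜) G).toLinearMap :=
  isGraded_of_concentrated _ (fun _ => degZero_gr_of_ne) ind_degZero_gr_zero

theorem degZeroEquivInd_symm_isGraded :
    IsGraded (degZeroEquivInd (𝒜 := 𝒜) G).symm.toLinearMap :=
  isGraded_of_concentrated _ (fun _ => ind_degZero_gr_of_ne) degZero_gr_zero

end Restriction

/-! ### The Ext algebra of an induced equivariant module -/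

section ExtInd

open GrProjRes

variable {𝒜 : ℕ → Submodule k A} [GradedAlgebra 𝒜] {G : Subgroup (GrAut 𝒜)} [Finite G]

/-! ### Coefficients in the total module of an induced resolution. -/

namespace Ind

variable {M : GrMod 𝒜} {R : GrProjRes M}

/-- The coefficients of elements of the induced total module. -/
def totCoeff (g : G) : (indRes G R).Tot →ₗ[k] R.Tot :=
  DFinsupp.mapRange.linearMap fun i => coeff (M := R.P i) g

/-- The element `x ⊗ g` of the induced total module. -/
def totSingle (g : G) : R.Tot →ₗ[k] (indRes G R).Tot :=
  DFinsupp.mapRange.linearMap fun i => single (M := R.P i) g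

theorem tot_ext {x y : (indRes G R).Tot} (h : ∀ g, totCoeff g x = totCoeff g y) : x = y :=
  DFinsupp.ext fun i => Ind.ext (M := R.P i) fun g => congrArg (fun z : R.Tot => z i) (h g)

theorem totCoeff_totSingle_same (g : G) (x : R.Tot) : totCoeff g (totSingle g x) = x :=
  DFinsupp.ext fun i => coeff_single_same (M := R.P i) g (x i)

theorem totCoeff_totSingle_of_ne {g h : G} (hgh : h ≠ g) (x : R.Tot) :
    totCoeff h (totSingle g x) = 0 :=
  DFinsupp.ext fun i => coeff_single_of_ne (M := R.P i) hgh (x i)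

theorem totCoeff_smul (g h : G) (a : A) (x : (indRes G R).Tot) :
    totCoeff g (op (SkewMonoidAlgebra.single h a : SkewGrp 𝒜 G) • x) =
      op ((g * h⁻¹) • a) • totCoeff (g * h⁻¹) x :=
  DFinsupp.ext fun i => coeff_single_smul (M := R.P i) g h a (x i)

theorem smul_totSingle (g h : G) (a : A) (x : R.Tot) :
    op (SkewMonoidAlgebra.single h a : SkewGrp 𝒜 G) • totSingle g x =
      totSingle (g * h) (op (g • a) • x) :=
  DFinsupp.ext fun i => single_smul_single (M := R.P i) g h a (x i)

theorem sum_totSingle [Fintype G] (x : (indRes G R).Tot) :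
    ∑ g, totSingle g (totCoeff g x) = x := tot_ext fun h => by
  rw [map_sum, Finset.sum_eq_single h, totCoeff_totSingle_same]
  · intro g _ hg
    rw [totCoeff_totSingle_of_ne hg.symm]
  · simp

theorem totCoeff_D (g : G) (x : (indRes G R).Tot) :
    totCoeff g ((indRes G R).D x) = R.D (totCoeff g x) := by
  refine DFinsupp.ext fun i => ?_
  refine Eq.trans ?_ (R.D_apply (totCoeff g x) i).symm
  exact congrArg (coeff (M := R.P i) g) ((indRes G R).D_apply x i)

theorem D_totSingle (g : G) (x : R.Tot) :
    (indRes G R).D (totSingle g x) = totSingle g (R.D x) := tot_ext fun h => by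
  rw [totCoeff_D]
  rcases eq_or_ne h g with rfl | hg
  · rw [totCoeff_totSingle_same, totCoeff_totSingle_same]
  · rw [totCoeff_totSingle_of_ne hg, totCoeff_totSingle_of_ne hg, map_zero]

theorem totCoeff_mem (g : G) {j m : ℤ} {x : (indRes G R).Tot} (hx : x ∈ (indRes G R).piece j m) :
    totCoeff g x ∈ R.piece j m := fun i =>
  ⟨mem_gr.1 (hx i).1 g, fun hi =>
    (congrArg (coeff (M := R.P i) g) ((hx i).2 hi)).trans (map_zero (coeff (M := R.P i) g))⟩

theorem totSingle_mem (g : G) {j m : ℤ} {x : R.Tot} (hx : x ∈ R.piece j m) :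
    totSingle g x ∈ (indRes G R).piece j m := fun i =>
  ⟨single_mem (hx i).1 g, fun hi =>
    (congrArg (single (M := R.P i) g) ((hx i).2 hi)).trans (map_zero (single (M := R.P i) g))⟩

end Ind

open Ind

/-! ### Endomorphisms of the induced complex as families indexed by the group. -/

variable (E : EqGrMod 𝒜)

/-- The component `g` of an endomorphism of the induced total module, where `∑ g, g ⊗ f_g`
corresponds to the map `x ⊗ h ↦ ∑ g, g (f_g x) ⊗ g h`. -/
def endComponent (g : G) : Module.End (SkewGrp 𝒜 G)ᵐᵒᵖ (indRes G (stdRes E)).Tot →ₗ[k]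
    Module.End Aᵐᵒᵖ (stdRes E).Tot where
  toFun F :=
    { toFun := fun x => totAct E (g : GrAut 𝒜)⁻¹ (totCoeff g (F (totSingle 1 x)))
      map_add' := fun x y => by simp only [map_add]
      map_smul' := fun a x => by
        obtain ⟨a, rfl⟩ := op_surjective a
        have h := smul_totSingle (R := stdRes E) (1 : G) 1 a x
        rw [one_smul, mul_one] at h
        -- Taking the coefficient at g turns the scalar a into g(a), and the twist by g⁻¹ turns it
        -- back into a; without the twist the component would be only semilinear.
        rw [← h, map_smul, totCoeff_smul, inv_one, mul_one, totAct_smul]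
        change op ((g : GrAut 𝒜)⁻¹ • (g : GrAut 𝒜) • a) • _ = _
        rw [inv_smul_smul]
        rfl }
  map_add' F F' := LinearMap.ext fun x => by
    change totAct E _ (totCoeff g (F _ + F' _)) = totAct E _ (totCoeff g (F _)) +
      totAct E _ (totCoeff g (F' _))
    rw [map_add (totCoeff g), map_add (totAct E _)]
  map_smul' c F := LinearMap.ext fun x => by
    change totAct E _ (totCoeff g (c • F _)) = c • totAct E _ (totCoeff g (F _))
    rw [map_smul (totCoeff g), map_smul (totAct E _)]

theorem endComponent_apply (g : G)
    (F : Module.End (SkewGrp 𝒜 G)ᵐᵒᵖ (indRes G (stdRes E)).Tot) (x : (stdRes E).Tot) :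
    endComponent E g F x = totAct E (g : GrAut 𝒜)⁻¹ (totCoeff g (F (totSingle 1 x))) := rfl

theorem totAct_endComponent (g : G)
    (F : Module.End (SkewGrp 𝒜 G)ᵐᵒᵖ (indRes G (stdRes E)).Tot) (x : (stdRes E).Tot) :
    totAct E (g : GrAut 𝒜) (endComponent E g F x) = totCoeff g (F (totSingle 1 x)) := by
  rw [endComponent_apply, totAct_totAct, mul_inv_cancel, totAct_one]
  rfl

/-- Since x ⊗ h = (x ⊗ 1) · h, linearity moves h out of F and shifts the index of the coefficient to
g h⁻¹. All values of F are thus expressed through its components. -/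
theorem totCoeff_apply_totSingle (g h : G)
    (F : Module.End (SkewGrp 𝒜 G)ᵐᵒᵖ (indRes G (stdRes E)).Tot) (x : (stdRes E).Tot) :
    totCoeff g (F (totSingle h x)) =
      totAct E ((g * h⁻¹ : G) : GrAut 𝒜) (endComponent E (g * h⁻¹) F x) := by
  have h' := smul_totSingle (R := stdRes E) (1 : G) h 1 x
  rw [one_mul, smul_one, op_one, one_smul] at h'
  rw [← h', map_smul, totCoeff_smul, smul_one, op_one, one_smul, totAct_endComponent]

theorem endComponent_injective {F F' : Module.End (SkewGrp 𝒜 G)ᵐᵒᵖ (indRes G (stdRes E)).Tot}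
    (h : ∀ g, endComponent E g F = endComponent E g F') : F = F' := by
  cases nonempty_fintype G
  refine LinearMap.ext fun x => ?_
  rw [← sum_totSingle x, map_sum, map_sum]
  refine Finset.sum_congr rfl fun l _ => tot_ext fun g => ?_
  rw [totCoeff_apply_totSingle, totCoeff_apply_totSingle, h]

theorem endComponent_one_same : endComponent E (1 : G) 1 = 1 := LinearMap.ext fun x => by
  rw [endComponent_apply, Module.End.one_apply, totCoeff_totSingle_same]
  change totAct E (1 : GrAut 𝒜)⁻¹ x = x
  rw [inv_one, totAct_one]
  rfl

theorem endComponent_one_of_ne {g : G} (hg : g ≠ 1) : endComponent E g 1 = 0 :=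
  LinearMap.ext fun x => by
    rw [endComponent_apply, Module.End.one_apply, totCoeff_totSingle_of_ne hg, map_zero]
    rfl

theorem endComponent_mul_apply [Fintype G] (g : G)
    (F F' : Module.End (SkewGrp 𝒜 G)ᵐᵒᵖ (indRes G (stdRes E)).Tot) (x : (stdRes E).Tot) :
    totCoeff g (F (F' (totSingle 1 x))) = ∑ h : G,
      totAct E ((g * h⁻¹ : G) : GrAut 𝒜) (endComponent E (g * h⁻¹) F
        (totAct E (h : GrAut 𝒜) (endComponent E h F' x))) := by
  conv_lhs => rw [← sum_totSingle (F' (totSingle 1 x)), map_sum F, map_sum (totCoeff g)]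
  refine Finset.sum_congr rfl fun h _ => ?_
  rw [← totAct_endComponent E h F' x, totCoeff_apply_totSingle]

set_option maxHeartbeats 1000000 in
theorem endComponent_mul [Fintype G] (g : G)
    (F F' : Module.End (SkewGrp 𝒜 G)ᵐᵒᵖ (indRes G (stdRes E)).Tot) :
    endComponent E g (F * F') = ∑ h : G,
      conj E ((h⁻¹ : G) : GrAut 𝒜) (endComponent E (g * h⁻¹) F) * endComponent E h F' := by
  refine LinearMap.ext fun x => ?_
  rw [endComponent_apply, Module.End.mul_apply, endComponent_mul_apply, map_sum (totAct E _),
    LinearMap.sum_apply]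
  refine Finset.sum_congr rfl fun h _ => ?_
  rw [totAct_totAct, Module.End.mul_apply, conj_apply]
  -- The outer twist g⁻¹ cancels against g h⁻¹ and leaves h⁻¹, while h remains on the right of the
  -- component of F: together they form conjugation by h⁻¹, as in the product of G * R.
  have h1 : (g : GrAut 𝒜)⁻¹ * ((g * h⁻¹ : G) : GrAut 𝒜) = ((h⁻¹ : G) : GrAut 𝒜) := by
    rw [Subgroup.coe_mul, inv_mul_cancel_left]
  have h2 : ((h⁻¹ : G) : GrAut 𝒜)⁻¹ = (h : GrAut 𝒜) := by
    rw [Subgroup.coe_inv, inv_inv]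
  rw [h1, h2]

/-- The coefficient maps, the inclusion x ↦ x ⊗ 1 and the group action all preserve bidegrees and
commute with the differentials. Together with the analogous statement for `endSingle`, this lets
chain maps and homotopies be tested on components. -/
theorem preservesCochains_endComponent (g : G) :
    PreservesCochains (endComponent E g) where
  homPiece hf j m _ hx :=
    totAct_mem_piece E _ (totCoeff_mem g (hf j m _ (totSingle_mem 1 hx)))
  D_mul F := LinearMap.ext fun x => by
    rw [endComponent_apply, Module.End.mul_apply, totCoeff_D, ← totAct_D]
    rfl
  mul_D F := LinearMap.ext fun x => by
    rw [endComponent_apply, Module.End.mul_apply, D_totSingle]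
    rfl

/-- The endomorphism `x ⊗ h ↦ g (f x) ⊗ g h` of the induced total module. -/
def endSingle [Fintype G] (g : G) : Module.End Aᵐᵒᵖ (stdRes E).Tot →ₗ[k]
    Module.End (SkewGrp 𝒜 G)ᵐᵒᵖ (indRes G (stdRes E)).Tot where
  toFun f := skewLinear (∑ h : G, (totSingle (g * h) ∘ₗ totAct E (g : GrAut 𝒜) ∘ₗ
      f.restrictScalars k ∘ₗ totCoeff h)).toAddMonoidHom fun h a x => by
    simp only [LinearMap.toAddMonoidHom_coe, LinearMap.sum_apply, LinearMap.comp_apply,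
      LinearMap.restrictScalars_apply, Finset.smul_sum]
    -- Acting by h translates the second tensor factor on the right, which commutes with the left
    -- translation by g after reindexing.
    rw [← Equiv.sum_comp (Equiv.mulRight h)]
    refine Finset.sum_congr rfl fun l _ => ?_
    rw [Equiv.coe_mulRight, totCoeff_smul, mul_inv_cancel_right, map_smul, totAct_smul,
      smul_totSingle, mul_assoc, mul_smul]
    rfl
  map_add' f f' := LinearMap.ext fun x => by
    simp [skewLinear_apply, Finset.sum_add_distrib]
  map_smul' c f := LinearMap.ext fun x => by
    simp [skewLinear_apply, Finset.smul_sum]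

theorem endSingle_apply [Fintype G] (g : G) (f : Module.End Aᵐᵒᵖ (stdRes E).Tot)
    (x : (indRes G (stdRes E)).Tot) : endSingle E g f x =
      ∑ h : G, totSingle (g * h) (totAct E (g : GrAut 𝒜) (f (totCoeff h x))) := by
  change (∑ h : G, (totSingle (g * h) ∘ₗ totAct E (g : GrAut 𝒜) ∘ₗ
      f.restrictScalars k ∘ₗ totCoeff h)) x = _
  rw [LinearMap.sum_apply]
  rfl

theorem totCoeff_endSingle [Fintype G] (g l : G) (f : Module.End Aᵐᵒᵖ (stdRes E).Tot)
    (x : (indRes G (stdRes E)).Tot) : totCoeff l (endSingle E g f x) =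
      totAct E (g : GrAut 𝒜) (f (totCoeff (g⁻¹ * l) x)) := by
  rw [endSingle_apply, map_sum, Finset.sum_eq_single (g⁻¹ * l)]
  · rw [mul_inv_cancel_left, totCoeff_totSingle_same]
  · intro h _ hh
    rw [totCoeff_totSingle_of_ne]
    rintro rfl
    exact hh (inv_mul_cancel_left _ _).symm
  · simp

theorem endComponent_endSingle_same [Fintype G] (g : G) (f : Module.End Aᵐᵒᵖ (stdRes E).Tot) :
    endComponent E g (endSingle E g f) = f := LinearMap.ext fun x => by
  rw [endComponent_apply, totCoeff_endSingle, inv_mul_cancel, totCoeff_totSingle_same,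
    totAct_totAct, inv_mul_cancel, totAct_one]
  rfl

theorem endComponent_endSingle_of_ne [Fintype G] {g l : G} (h : l ≠ g)
    (f : Module.End Aᵐᵒᵖ (stdRes E).Tot) : endComponent E l (endSingle E g f) = 0 :=
  LinearMap.ext fun x => by
    rw [endComponent_apply, totCoeff_endSingle, totCoeff_totSingle_of_ne, map_zero, map_zero,
      map_zero]
    · rfl
    · exact fun e => h (inv_mul_eq_one.1 e).symm

/-- With `endComponent_injective` this shows that an endomorphism of the induced complex is the same
as an arbitrary family indexed by G. -/
theorem endComponent_sum_endSingle [Fintype G] (f : G → Module.End Aᵐᵒᵖ (stdRes E).Tot) (g : G) :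
    endComponent E g (∑ h, endSingle E h (f h)) = f g := by
  rw [map_sum, Finset.sum_eq_single g, endComponent_endSingle_same]
  · intro h _ hh
    rw [endComponent_endSingle_of_ne E hh.symm]
  · simp

theorem preservesCochains_endSingle [Fintype G] (g : G) :
    PreservesCochains (endSingle E g) where
  homPiece hf j m x hx := by
    rw [endSingle_apply]
    exact sum_mem fun h _ =>
      totSingle_mem _ (totAct_mem_piece E _ (hf j m _ (totCoeff_mem h hx)))
  D_mul f := LinearMap.ext fun x => tot_ext fun l => by
    rw [Module.End.mul_apply, totCoeff_D, totCoeff_endSingle, totCoeff_endSingle, totAct_D]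
    rfl
  mul_D f := LinearMap.ext fun x => tot_ext fun l => by
    rw [Module.End.mul_apply, totCoeff_endSingle, totCoeff_endSingle, totCoeff_D]
    rfl

/-! ### Passage from chain maps to the Ext algebra. -/

variable [Fintype G]

theorem mapCocycle_endComponent_one (g : G) :
    (preservesCochains_endComponent E g).mapCocycle 1 = open Classical in if g = 1 then 1 else 0 := by
  apply CocycleAlg.val_injective
  rw [PreservesCochains.val_mapCocycle, map_one (CocycleAlg.val _)]
  split_ifs with hg
  · rw [hg, endComponent_one_same, map_one (CocycleAlg.val _)]
  · rw [endComponent_one_of_ne E hg, map_zero (CocycleAlg.val _)]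

theorem mapCocycle_endComponent_mul (g : G) (z z' : (indRes G (stdRes E)).CocycleAlg) :
    (preservesCochains_endComponent E g).mapCocycle (z * z') = ∑ h : G,
      conjCocycle E ((h⁻¹ : G) : GrAut 𝒜)
        ((preservesCochains_endComponent E (g * h⁻¹)).mapCocycle z) *
      (preservesCochains_endComponent E h).mapCocycle z' := by
  apply CocycleAlg.val_injective
  rw [PreservesCochains.val_mapCocycle, map_mul (CocycleAlg.val _), endComponent_mul,
    map_sum (CocycleAlg.val _)]
  refine Finset.sum_congr rfl fun h _ => ?_
  rw [map_mul (CocycleAlg.val _)]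
  rfl

/-- The map which sends a chain map to the classes of its components. -/
def cocycleToExtLinear : (indRes G (stdRes E)).CocycleAlg →ₗ[k] LeftSkew G (stdRes E).ExtAlg :=
  LinearMap.pi (φ := fun _ : G => (stdRes E).ExtAlg) fun g =>
    (Ideal.Quotient.mkₐ k (stdRes E).boundaryIdeal).toLinearMap ∘ₗ
      (preservesCochains_endComponent E g).mapCocycle

theorem cocycleToExtLinear_apply (z : (indRes G (stdRes E)).CocycleAlg) (g : G) :
    cocycleToExtLinear E z g =
      Ideal.Quotient.mk _ ((preservesCochains_endComponent E g).mapCocycle z) := rfl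

theorem cocycleToExtLinear_one : cocycleToExtLinear (G := G) E 1 = 1 := LeftSkew.ext fun g => by
  rw [LeftSkew.one_def, LeftSkew.single_apply, cocycleToExtLinear_apply,
    mapCocycle_endComponent_one]
  split_ifs
  · exact map_one _
  · exact map_zero _

theorem cocycleToExtLinear_mul (z z' : (indRes G (stdRes E)).CocycleAlg) :
    cocycleToExtLinear E (z * z') = cocycleToExtLinear E z * cocycleToExtLinear E z' :=
  LeftSkew.ext fun g => by
    rw [LeftSkew.mul_apply, cocycleToExtLinear_apply, mapCocycle_endComponent_mul, map_sum]
    exact Finset.sum_congr rfl fun h _ => map_mul (Ideal.Quotient.mk _) _ _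

/-- The algebra map which sends a chain map to the classes of its components. -/
def cocycleToExt : (indRes G (stdRes E)).CocycleAlg →ₐ[k] LeftSkew G (stdRes E).ExtAlg :=
  AlgHom.ofLinearMap (cocycleToExtLinear E) (cocycleToExtLinear_one E) (cocycleToExtLinear_mul E)

theorem cocycleToExt_apply (z : (indRes G (stdRes E)).CocycleAlg) (g : G) :
    cocycleToExt E z g =
      Ideal.Quotient.mk _ ((preservesCochains_endComponent E g).mapCocycle z) := rfl

/-- A chain map is the sum of the maps `endSingle` of its components, and both decomposing and
reassembling preserve null-homotopic maps. So it is null-homotopic exactly when all of its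
components are. -/
theorem cocycleToExt_eq_zero (z : (indRes G (stdRes E)).CocycleAlg) :
    cocycleToExt E z = 0 ↔ z ∈ (indRes G (stdRes E)).boundaryIdeal := by
  rw [mem_boundaryIdeal]
  constructor
  · intro h
    have h' : ∀ g : G, endComponent E g (CocycleAlg.val _ z) ∈ (stdRes E).coboundaries := fun g =>
      (mem_boundaryIdeal _).1 (Ideal.Quotient.eq_zero_iff_mem.1
        ((cocycleToExt_apply E z g).symm.trans (congrFun h g)))
    have hz : CocycleAlg.val _ z = ∑ g : G, endSingle E g (endComponent E g (CocycleAlg.val _ z)) :=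
      endComponent_injective E fun g => by
        rw [endComponent_sum_endSingle E fun h => endComponent E h (CocycleAlg.val _ z)]
    rw [hz]
    exact sum_mem fun g _ => (preservesCochains_endSingle E g).coboundaries (h' g)
  · exact fun h => LeftSkew.ext fun g => Ideal.Quotient.eq_zero_iff_mem.2
      ((mem_boundaryIdeal _).2 ((preservesCochains_endComponent E g).coboundaries h))

/-- The explicit formula for w is recorded because it preserves bidegrees: it serves both for
surjectivity and for identifying the image of each bigraded piece. -/
theorem exists_cocycleToExt_eq (z : G → (stdRes E).CocycleAlg) :
    ∃ w : (indRes G (stdRes E)).CocycleAlg,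
      CocycleAlg.val _ w = ∑ g, endSingle E g (CocycleAlg.val _ (z g)) ∧
      ∀ g, cocycleToExt E w g = Ideal.Quotient.mk _ (z g) := by
  refine ⟨∑ g, (preservesCochains_endSingle E g).mapCocycle (z g), ?_, fun g => ?_⟩
  · rw [map_sum]
    rfl
  · rw [cocycleToExt_apply]
    congr 1
    apply CocycleAlg.val_injective
    rw [PreservesCochains.val_mapCocycle, map_sum]
    exact endComponent_sum_endSingle E (fun h => CocycleAlg.val _ (z h)) g

/-- The isomorphism between the Ext algebra of an induced module and `G * Ext`. -/
theorem exists_extIndEquiv :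
    ∃ e : (indRes G (stdRes E)).ExtAlg ≃ₐ[k] LeftSkew G (stdRes E).ExtAlg, ∀ p n,
      ((indRes G (stdRes E)).extBigrade p n).map e.toLinearMap =
        LeftSkew.extend G ((stdRes E).extBigrade p n) := by
  let φ : (indRes G (stdRes E)).ExtAlg →ₐ[k] LeftSkew G (stdRes E).ExtAlg :=
    Ideal.Quotient.liftₐ _ (cocycleToExt E) fun z hz => (cocycleToExt_eq_zero E z).2 hz
  have hφ : ∀ z, φ (Ideal.Quotient.mk _ z) = cocycleToExt E z := fun z => rfl
  have hinj : Function.Injective φ := (injective_iff_map_eq_zero φ).2 fun x hx => by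
    obtain ⟨z, rfl⟩ := Ideal.Quotient.mk_surjective x
    exact Ideal.Quotient.eq_zero_iff_mem.2 ((cocycleToExt_eq_zero E z).1 hx)
  have hsurj : Function.Surjective φ := fun x => by
    choose z hz using fun g => Ideal.Quotient.mk_surjective (x g)
    obtain ⟨w, -, hw⟩ := exists_cocycleToExt_eq E z
    exact ⟨Ideal.Quotient.mk _ w, LeftSkew.ext fun g => (hw g).trans (hz g)⟩
  refine ⟨AlgEquiv.ofBijective φ ⟨hinj, hsurj⟩, fun p n => le_antisymm ?_ fun x hx => ?_⟩
  · rintro _ ⟨_, ⟨z, hz, rfl⟩, rfl⟩ g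
    exact ⟨(preservesCochains_endComponent E g).mapCocycle z,
      (preservesCochains_endComponent E g).cocycle hz, rfl⟩
  · choose z hz hzx using hx
    obtain ⟨w, hwz, hw⟩ := exists_cocycleToExt_eq E z
    refine ⟨Ideal.Quotient.mk _ w, ⟨w, ?_, rfl⟩, LeftSkew.ext fun g => (hw g).trans (hzx g)⟩
    change CocycleAlg.val _ w ∈ (indRes G (stdRes E)).cocycle p n
    rw [hwz]
    exact sum_mem fun g _ => (preservesCochains_endSingle E g).cocycle (hz g)

/-- Finiteness of G is what matters: x is the finite sum of its parts supported at single group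
elements, and each part can be treated separately. It passes from the bigrading to the grading by
cohomological degree. -/
theorem extend_iSup {ι V : Type*} [Ring V] [Algebra k V] (S : ι → Submodule k V) :
    LeftSkew.extend G (⨆ n, S n) = ⨆ n, LeftSkew.extend G (S n) := by
  classical
  refine le_antisymm (fun x hx => ?_) (iSup_le fun n x hx g => Submodule.mem_iSup_of_mem n (hx g))
  let s : G → V →ₗ[k] LeftSkew G V := fun g => LinearMap.single k (fun _ : G => V) g
  have hs : ∀ g v, v ∈ ⨆ n, S n → s g v ∈ ⨆ n, LeftSkew.extend G (S n) := by
    intro g v hv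
    have hle : ⨆ n, S n ≤ (⨆ n, LeftSkew.extend G (S n)).comap (s g) :=
      iSup_le fun n v hv => Submodule.mem_iSup_of_mem n fun h => by
        change Pi.single (M := fun _ : G => V) g v h ∈ S n
        rcases eq_or_ne h g with rfl | hg
        · rwa [Pi.single_eq_same]
        · rw [Pi.single_eq_of_ne hg]; exact zero_mem _
    exact hle hv
  have hx' : x = ∑ g, s g (x g) := (Finset.univ_sum_single (M := fun _ : G => V) x).symm
  rw [hx']
  exact sum_mem fun g _ => hs g _ (hx g)

/-- The first isomorphism changes from the standard resolution over A * G to the one induced from A;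
the second decomposes chain maps into components. -/
theorem exists_koszulDual_equiv :
    ∃ e : KoszulDual (skewGr 𝒜 G) ≃ₐ[k] LeftSkew G (KoszulDual 𝒜),
      (∀ p, (KoszulDual.grade (skewGr 𝒜 G) p).map e.toLinearMap =
        LeftSkew.extend G (KoszulDual.grade 𝒜 p)) ∧
      (∀ p n, (KoszulDual.bigrade (skewGr 𝒜 G) p n).map e.toLinearMap =
        LeftSkew.extend G (KoszulDual.bigrade 𝒜 p n)) := by
  obtain ⟨e₁, he₁⟩ := exists_extEquiv (stdRes (degZeroEq (skewGr 𝒜 G)))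
    (indRes G (stdRes (degZeroEq 𝒜))) (degZeroEquivInd G) degZeroEquivInd_isGraded
    degZeroEquivInd_symm_isGraded
  obtain ⟨e₂, he₂⟩ := exists_extIndEquiv (G := G) (degZeroEq 𝒜)
  have h : ∀ p n, (KoszulDual.bigrade (skewGr 𝒜 G) p n).map (e₁.trans e₂).toLinearMap =
      LeftSkew.extend G (KoszulDual.bigrade 𝒜 p n) := fun p n => by
    refine Eq.trans ?_ (he₂ p n)
    rw [← he₁ p n, ← Submodule.map_comp]
    rfl
  refine ⟨e₁.trans e₂, fun p => ?_, h⟩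
  change Submodule.map _ (⨆ n, KoszulDual.bigrade (skewGr 𝒜 G) p n) =
    LeftSkew.extend G (⨆ n, KoszulDual.bigrade 𝒜 p n)
  rw [Submodule.map_iSup, extend_iSup]
  exact iSup_congr fun n => h p n

end ExtInd

/-! ### Semisimplicity of skew group rings -/

section Semisimple

/-- Complements of left ideals correspond to right multiplications projecting onto them. In this
form semisimplicity can be moved between rings by exhibiting a single element. -/
theorem isSemisimpleRing_iff_exists_idempotent (R : Type*) [Ring R] : IsSemisimpleRing R ↔
    ∀ I : Submodule R R, ∃ e ∈ I, ∀ x ∈ I, x * e = x := by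
  constructor
  · intro h I
    obtain ⟨J, hJ⟩ := exists_isCompl I
    obtain ⟨e, he, f, hf, hef⟩ := Submodule.mem_sup.1
      (hJ.sup_eq_top ▸ Submodule.mem_top : (1 : R) ∈ I ⊔ J)
    refine ⟨e, he, fun x hx => ?_⟩
    have h1 : x - x * e = x * f := by
      rw [sub_eq_iff_eq_add', ← mul_add, hef, mul_one]
    have h2 : x - x * e ∈ I ⊓ J :=
      ⟨sub_mem hx (I.smul_mem x he), h1 ▸ J.smul_mem x hf⟩
    rw [hJ.inf_eq_bot, Submodule.mem_bot, sub_eq_zero] at h2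
    exact h2.symm
  · intro h
    refine { exists_isCompl := fun I => ?_ }
    obtain ⟨e, he, hxe⟩ := h I
    -- Right multiplication by e is a linear projection onto I, so its kernel is a complement.
    exact ⟨_, LinearMap.isCompl_of_proj (f := (LinearMap.toSpanSingleton R R e).codRestrict I
      fun x => I.smul_mem x he) fun x => Subtype.ext (hxe x x.2)⟩

/-- Maschke's theorem for crossed products: `S` is generated by the image of `R` and units `u g`
which normalize the image of `R`. -/
theorem isSemisimpleRing_of_crossedProduct {R S G : Type*} [Ring R] [Ring S] [Algebra k S] [Group G]
    [Fintype G] [IsSemisimpleRing R] (i : R →+* S) (u : G →* S) (act : G → R → R)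
    (hu : ∀ g a, i a * u g = u g * i (act g a))
    (hspan : ∀ s, ∃ c : G → R, s = ∑ g, i (c g) * u g) (hG : (Fintype.card G : k) ≠ 0) :
    IsSemisimpleRing S := by
  rw [isSemisimpleRing_iff_exists_idempotent]
  intro J
  let _ : Module R S := Module.compHom S i
  let J' : Submodule R S :=
    { J.toAddSubmonoid with smul_mem' := fun a x hx => J.smul_mem (i a) hx }
  -- S is a semisimple R-module, so the left ideal J has an R-stable complement; the resulting
  -- projection π is R-linear but need not be S-linear.
  obtain ⟨K, hK⟩ := exists_isCompl J'
  let π : S → S := fun s => J'.projectionOnto K hK s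
  have hπ : ∀ s, π s ∈ J := fun s => (J'.projectionOnto K hK s).2
  have hπ1 : ∀ s ∈ J, π s = s := fun s hs =>
    congrArg Subtype.val (Submodule.projectionOnto_apply_left hK ⟨s, hs⟩)
  have hπi : ∀ a s, π (i a * s) = i a * π s := fun a s =>
    congrArg Subtype.val ((J'.projectionOnto K hK).map_smul a s)
  have hπadd : ∀ s t, π (s + t) = π s + π t := fun s t =>
    congrArg Subtype.val ((J'.projectionOnto K hK).map_add s t)
  -- The Maschke average of π over its conjugates by the units u g, not yet divided by |G|.
  let ρ : S →+ S :=
    { toFun := fun s => ∑ g, u g * π (u g⁻¹ * s)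
      map_zero' := Finset.sum_eq_zero fun g _ => by
        rw [mul_zero, hπ1 0 J.zero_mem, mul_zero]
      map_add' := fun s t => by simp only [mul_add, hπadd, Finset.sum_add_distrib] }
  have hρ : ∀ s, ρ s = ∑ g, u g * π (u g⁻¹ * s) := fun _ => rfl
  have hρJ : ∀ s, ρ s ∈ J := fun s => J.sum_mem fun g _ => J.smul_mem _ (hπ _)
  have hρu : ∀ h s, ρ (u h * s) = u h * ρ s := fun h s => by
    rw [hρ, hρ, Finset.mul_sum, ← Equiv.sum_comp (Equiv.mulLeft h)]
    refine Finset.sum_congr rfl fun g _ => ?_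
    rw [Equiv.coe_mulLeft, ← mul_assoc (u _) (u h), ← map_mul, mul_inv_rev, inv_mul_cancel_right,
      map_mul, mul_assoc]
  have hinv : ∀ g : G, u g * u g⁻¹ = 1 := fun g => by rw [← map_mul, mul_inv_cancel, map_one]
  have hinv' : ∀ g : G, u g⁻¹ * u g = 1 := fun g => by rw [← map_mul, inv_mul_cancel, map_one]
  -- Averaging does not spoil R-linearity: moving i a past u g⁻¹ changes a to act g a, and moving it
  -- back past u g restores a.
  have hρi : ∀ a s, ρ (i a * s) = i a * ρ s := fun a s => by
    rw [hρ, hρ, Finset.mul_sum]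
    refine Finset.sum_congr rfl fun g _ => ?_
    have h1 : u g⁻¹ * (i a * s) = i (act g a) * (u g⁻¹ * s) := by
      rw [← mul_assoc, ← mul_assoc]
      congr 1
      calc u g⁻¹ * i a = u g⁻¹ * (i a * u g) * u g⁻¹ := by
            rw [mul_assoc, mul_assoc, hinv, mul_one]
        _ = i (act g a) * u g⁻¹ := by rw [hu, ← mul_assoc, hinv', one_mul]
    rw [h1, hπi, ← mul_assoc, ← hu, mul_assoc]
  -- The elements i a and u g generate S, so ρ is left S-linear and therefore equals right
  -- multiplication by ρ 1.
  have hρ1 : ∀ s, ρ s = s * ρ 1 := fun s => by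
    obtain ⟨c, hc⟩ := hspan s
    conv_lhs => rw [← mul_one s, hc, Finset.sum_mul, map_sum]
    conv_rhs => rw [hc, Finset.sum_mul]
    refine Finset.sum_congr rfl fun g _ => ?_
    rw [mul_assoc, hρi, hρu, mul_assoc]
  have hρc : ∀ s ∈ J, ρ s = (Fintype.card G : k) • s := fun s hs => by
    have : ∀ g, u g * π (u g⁻¹ * s) = s := fun g => by
      rw [hπ1 (u g⁻¹ * s) (J.smul_mem (u g⁻¹) hs), ← mul_assoc, hinv, one_mul]
    rw [hρ, Finset.sum_congr rfl fun g _ => this g, Finset.sum_const, Finset.card_univ,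
      Nat.cast_smul_eq_nsmul]
  -- On J the map ρ is multiplication by |G|, so dividing ρ 1 by |G| gives a right identity for J
  -- lying in J.
  refine ⟨(Fintype.card G : k)⁻¹ • ρ 1, ?_, fun s hs => ?_⟩
  · rw [Algebra.smul_def]
    exact J.smul_mem _ (hρJ 1)
  · rw [mul_smul_comm, ← hρ1, hρc s hs, inv_smul_smul₀ hG]

/-! ### Semisimplicity and finiteness for A and A * G. -/

variable {𝒜 : ℕ → Submodule k A} [GradedAlgebra 𝒜] {G : Subgroup (GrAut 𝒜)} [Fintype G]

/-- The inclusion `A₀ → (A * G)₀`. -/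
def degZeroIncl (G : Subgroup (GrAut 𝒜)) : 𝒜 0 →+* skewGr 𝒜 G 0 where
  toFun a := ⟨SkewMonoidAlgebra.single 1 (a : A), single_mem_skewGr 𝒜 G 1 a.2⟩
  map_one' := rfl
  map_mul' a b := Subtype.ext (map_mul SkewMonoidAlgebra.singleOneRingHom (a : A) (b : A))
  map_zero' := Subtype.ext (SkewMonoidAlgebra.single_zero 1)
  map_add' a b := Subtype.ext (SkewMonoidAlgebra.single_add 1 (a : A) (b : A))

/-- The inclusion `G → (A * G)₀`. -/
def groupIncl (G : Subgroup (GrAut 𝒜)) : G →* skewGr 𝒜 G 0 where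
  toFun g := ⟨SkewMonoidAlgebra.single g 1, single_mem_skewGr 𝒜 G g SetLike.GradedOne.one_mem⟩
  map_one' := rfl
  map_mul' g h := Subtype.ext (map_mul (SkewMonoidAlgebra.of A G) g h)

theorem isSemisimpleRing_skewGr_zero (hG : (Fintype.card G : k) ≠ 0)
    (h : IsSemisimpleRing (𝒜 0)) : IsSemisimpleRing (skewGr 𝒜 G 0) := by
  refine isSemisimpleRing_of_crossedProduct (k := k) (degZeroIncl G) (groupIncl G)
    (fun g a => ⟨g⁻¹ • (a : A), smul_mem_of_mem 𝒜 G g⁻¹ a.2⟩) (fun g a => Subtype.ext ?_)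
    (fun s => ⟨fun g => ⟨(s : SkewGrp 𝒜 G).coeff g, s.2 g⟩, Subtype.ext ?_⟩) hG
  · change (SkewMonoidAlgebra.single 1 (a : A) * SkewMonoidAlgebra.single g 1 : SkewGrp 𝒜 G) =
      SkewMonoidAlgebra.single g 1 * SkewMonoidAlgebra.single 1 (g⁻¹ • (a : A))
    rw [SkewMonoidAlgebra.single_mul_single, SkewMonoidAlgebra.single_mul_single, one_mul, mul_one,
      one_smul, mul_one, one_mul, smul_inv_smul]
  · rw [AddSubmonoidClass.coe_finsetSum]
    refine SkewMonoidAlgebra.ext fun g => ?_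
    have : ∀ h : G, (((degZeroIncl G ⟨(s : SkewGrp 𝒜 G).coeff h, s.2 h⟩ * groupIncl G h :
        skewGr 𝒜 G 0)) : SkewGrp 𝒜 G) = SkewMonoidAlgebra.single h ((s : SkewGrp 𝒜 G).coeff h) := by
      intro h
      change (SkewMonoidAlgebra.single 1 _ * SkewMonoidAlgebra.single h 1 : SkewGrp 𝒜 G) = _
      rw [SkewMonoidAlgebra.single_mul_single, one_mul, one_smul, mul_one]
    rw [Finset.sum_congr rfl fun h _ => this h]
    conv_lhs => rw [skew_eq_sum (s : SkewGrp 𝒜 G)]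
    congr 1
    refine congrArg _ (Finset.sum_subset (Finset.subset_univ _) fun h _ hh => ?_)
    rw [SkewMonoidAlgebra.notMem_support_iff.1 hh, SkewMonoidAlgebra.single_zero]

/-- A left ideal I of A₀ extends to the left ideal J of sums ∑ g x_g with x_g in I. If e in J
satisfies x e = x for all x in J, then comparing coefficients at 1 for x in I shows that the
coefficient of e at 1, an element of I, does the same for I. -/
theorem isSemisimpleRing_of_skewGr_zero (h : IsSemisimpleRing (skewGr 𝒜 G 0)) :
    IsSemisimpleRing (𝒜 0) := by
  rw [isSemisimpleRing_iff_exists_idempotent] at h ⊢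
  intro I
  have hI : ∀ (g : G) (a : A), ∀ ha : a ∈ 𝒜 0, g⁻¹ • a ∈ 𝒜 0 := fun g a ha =>
    smul_mem_of_mem 𝒜 G g⁻¹ ha
  let I' : Set A := {a | ∃ h : a ∈ 𝒜 0, (⟨a, h⟩ : 𝒜 0) ∈ I}
  have hI'add : ∀ {a b}, a ∈ I' → b ∈ I' → a + b ∈ I' := fun ⟨ha, ha'⟩ ⟨hb, hb'⟩ =>
    ⟨add_mem ha hb, I.add_mem ha' hb'⟩
  have hI'zero : (0 : A) ∈ I' := ⟨zero_mem _, I.zero_mem⟩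
  have hI'mul : ∀ {a b}, a ∈ 𝒜 0 → b ∈ I' → a * b ∈ I' := fun {a b} ha ⟨hb, hb'⟩ =>
    ⟨by simpa using SetLike.mul_mem_graded ha hb, I.smul_mem (⟨a, ha⟩ : 𝒜 0) hb'⟩
  let J : Submodule (skewGr 𝒜 G 0) (skewGr 𝒜 G 0) :=
    -- Since a * g = (1 * g)(g⁻¹(a) * 1), the elements g⁻¹(s_g) are the coefficients of s when these
    -- are written to the right of the group elements.
    { carrier := {s | ∀ g : G, g⁻¹ • (s : SkewGrp 𝒜 G).coeff g ∈ I'}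
      zero_mem' := fun g => by
        change g⁻¹ • (0 : A) ∈ I'
        rw [smul_zero]
        exact hI'zero
      add_mem' := fun {s t} hs ht g => by
        change g⁻¹ • ((s : SkewGrp 𝒜 G) + (t : SkewGrp 𝒜 G)).coeff g ∈ I'
        rw [SkewMonoidAlgebra.coeff_add, Finsupp.add_apply, smul_add]
        exact hI'add (hs g) (ht g)
      smul_mem' := fun b s hs g => by
        change g⁻¹ • ((b : SkewGrp 𝒜 G) * (s : SkewGrp 𝒜 G)).coeff g ∈ I'
        rw [skew_eq_sum (b : SkewGrp 𝒜 G), Finset.sum_mul]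
        have : ∀ t : Finset G, g⁻¹ • (∑ h ∈ t, SkewMonoidAlgebra.single h
            ((b : SkewGrp 𝒜 G).coeff h) * (s : SkewGrp 𝒜 G)).coeff g ∈ I' := by
          classical
          intro t
          induction t using Finset.induction_on with
          | empty =>
            rw [Finset.sum_empty, SkewMonoidAlgebra.coeff_zero, Finsupp.zero_apply, smul_zero]
            exact hI'zero
          | insert h t hh ih =>
            rw [Finset.sum_insert hh, SkewMonoidAlgebra.coeff_add, Finsupp.add_apply, smul_add]
            refine hI'add ?_ ih
            rw [SkewMonoidAlgebra.coeff_single_mul, smul_mul', smul_smul]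
            -- The right-hand coefficient of the product at g is g⁻¹(b_h) times the right-hand
            -- coefficient of s at h⁻¹ g, and the latter lies in I.
            have h1 : g⁻¹ * h = (h⁻¹ * g)⁻¹ := by rw [mul_inv_rev, inv_inv]
            rw [h1]
            exact hI'mul (hI g _ (b.2 h)) (hs _)
        exact this _ }
  obtain ⟨e, he, hxe⟩ := h J
  have he1 := he 1
  rw [inv_one, one_smul] at he1
  obtain ⟨he0, heI⟩ := he1
  refine ⟨⟨_, he0⟩, heI, fun x hx => Subtype.ext ?_⟩
  have hxJ : degZeroIncl G x ∈ J := fun g => by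
    classical
    change g⁻¹ • (SkewMonoidAlgebra.single 1 (x : A)).coeff g ∈ I'
    rw [SkewMonoidAlgebra.coeff_single, Finsupp.single_apply]
    split_ifs with hg
    · subst hg
      rw [inv_one, one_smul]
      exact ⟨x.2, hx⟩
    · rw [smul_zero]; exact hI'zero
  have h1 : (SkewMonoidAlgebra.single 1 (x : A) * (e : SkewGrp 𝒜 G)).coeff 1 =
      (SkewMonoidAlgebra.single (1 : G) (x : A)).coeff 1 :=
    congrArg (fun s : skewGr 𝒜 G 0 => (s : SkewGrp 𝒜 G).coeff 1) (hxe _ hxJ)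
  rw [SkewMonoidAlgebra.coeff_single_one_mul, SkewMonoidAlgebra.coeff_single,
    Finsupp.single_eq_same] at h1
  exact h1

theorem finite_skewGr {i : ℕ} (h : Module.Finite k (𝒜 i)) : Module.Finite k (skewGr 𝒜 G i) := by
  let f : skewGr 𝒜 G i →ₗ[k] (G → 𝒜 i) :=
    { toFun := fun x g => ⟨(x : SkewGrp 𝒜 G).coeff g, x.2 g⟩
      map_add' := fun x y => funext fun g => Subtype.ext
        (congrArg (fun f => f g) (SkewMonoidAlgebra.coeff_add (x : SkewGrp 𝒜 G) y))
      map_smul' := fun c x => funext fun g => Subtype.ext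
        (congrArg (fun f => f g) (SkewMonoidAlgebra.coeff_smul c (x : SkewGrp 𝒜 G))) }
  exact Module.Finite.of_injective f fun x y hxy => Subtype.ext (SkewMonoidAlgebra.ext fun g =>
    congrArg Subtype.val (congrFun hxy g))

theorem finite_of_skewGr {i : ℕ} (h : Module.Finite k (skewGr 𝒜 G i)) : Module.Finite k (𝒜 i) := by
  let f : 𝒜 i →ₗ[k] skewGr 𝒜 G i :=
    ((SkewMonoidAlgebra.lsingle (R := k) (1 : G)) ∘ₗ (𝒜 i).subtype).codRestrict _ fun a =>
      single_mem_skewGr 𝒜 G 1 a.2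
  exact Module.Finite.of_injective f fun x y hxy => Subtype.ext
    (SkewMonoidAlgebra.single_injective (1 : G) (congrArg Subtype.val hxy))

end Semisimple

/-! ### Linear resolutions -/

section Linear

variable {𝒜 : ℕ → Submodule k A} [GradedAlgebra 𝒜]

/-- The algebra has no negative degrees, so generators of degree n reach only degrees at least n. -/
theorem GrMod.GeneratedInDegree.eq_zero_of_mem {M : GrMod 𝒜} {n m : ℤ}
    (hM : M.GeneratedInDegree n) (hm : m < n) {x : M} (hx : x ∈ M.gr m) : x = 0 := by
  obtain ⟨q, hq, h1, h2, -⟩ := exists_proj M.gr M.isInternal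
  -- Quantifying over a as well strengthens the claim enough for the induction on the span to pass
  -- through scalar multiples.
  have key : ∀ y : M, ∀ a : A, q m (op a • y) = 0 := by
    intro y
    have hy : y ∈ Submodule.span Aᵐᵒᵖ (M.gr n : Set M) := hM ▸ Submodule.mem_top
    induction hy using Submodule.span_induction with
    | mem y hy =>
      intro a
      induction a using induction_graded (𝒜 := 𝒜) with
      | zero => rw [op_zero, zero_smul, map_zero]
      | add a b ha hb => rw [op_add, add_smul, map_add, ha, hb, add_zero]
      | mem i a ha => exact h2 _ _ (by omega) _ (M.smul_mem i n a y ha hy)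
    | zero => intro a; rw [smul_zero, map_zero]
    | add y z _ _ hy hz => intro a; rw [smul_add, map_add, hy, hz, add_zero]
    | smul b y _ hy =>
      intro a
      rw [smul_smul]
      exact hy (unop b * a)
  have := key x 1
  rwa [op_one, one_smul, h1 m x hx] at this

/-- It suffices to look at generators x of degree n. Then f x = d y, and y may be replaced by its
component of degree n, which vanishes because K starts in degree m > n. -/
theorem eq_zero_of_linear {P Q K : GrMod 𝒜} {n m : ℤ} (hP : P.GeneratedInDegree n)
    (hK : K.GeneratedInDegree m) (hnm : n < m) {f : P →ₗ[Aᵐᵒᵖ] Q} (hf : IsGraded f)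
    {d : K →ₗ[Aᵐᵒᵖ] Q} (hd : IsGraded d) (h : ∀ x, ∃ y, d y = f x) : f = 0 := by
  refine LinearMap.ext_on hP fun x hx => ?_
  obtain ⟨y, hy⟩ := h x
  obtain ⟨q, hq, hq1, hq2, -⟩ := exists_proj K.gr K.isInternal
  obtain ⟨r, -, hr1, hr2, -⟩ := exists_proj Q.gr Q.isInternal
  rw [LinearMap.zero_apply, ← hr1 n _ (hf n x hx), ← hy, ← hd.map_proj hq1 hq2 hr1 hr2,
    hK.eq_zero_of_mem hnm (hq n y), map_zero]

/-- A resolution is linear if its `i`th term is generated in degree `i`. -/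
def GrProjRes.IsLinear {M : GrMod 𝒜} (R : GrProjRes M) : Prop :=
  ∀ i : ℕ, (R.P i).GeneratedInDegree i

/-- A graded chain map of a linear resolution which lifts zero is zero. -/
theorem GrProjRes.IsLinear.chainMap_eq_zero {M : GrMod 𝒜} {R : GrProjRes M} (hR : R.IsLinear)
    {φ : ∀ i, R.P i →ₗ[Aᵐᵒᵖ] R.P i} (hφ : ∀ i, IsGraded (φ i)) (h0 : ∀ x, R.ε (φ 0 x) = 0)
    (hd : ∀ i x, R.d i (φ (i + 1) x) = φ i (R.d i x)) (i : ℕ) : φ i = 0 := by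
  induction i with
  | zero =>
    exact eq_zero_of_linear (hR 0) (hR 1) (by norm_num) (hφ 0) (R.d_mem 0) fun x =>
      (R.exact_zero _).1 (h0 x)
  -- Once φ i = 0, the map φ (i + 1) takes values in cycles, hence in the image of a term generated
  -- in degree i + 2, one above the generators of its source.
  | succ i ih =>
    exact eq_zero_of_linear (hR (i + 1)) (hR (i + 2)) (by push_cast; omega) (hφ (i + 1))
      (R.d_mem (i + 1)) fun x => (R.exact_succ i _).1 (by rw [hd, ih, LinearMap.zero_apply])

/-- The image of a graded idempotent endomorphism. -/
def GrMod.image (M : GrMod 𝒜) (e : M →ₗ[Aᵐᵒᵖ] M) (he : IsGraded e)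
    (_hee : ∀ x, e (e x) = e x) : GrMod 𝒜 where
  carrier := LinearMap.range e
  gr n := (M.gr n).comap ((LinearMap.range e).subtype.restrictScalars k)
  isInternal := by
    obtain ⟨p, hp, hp1, hp2, hp3⟩ := exists_proj M.gr M.isInternal
    have hmem : ∀ n (x : LinearMap.range e),
        (p n ∘ₗ (LinearMap.range e).subtype.restrictScalars k) x ∈
          (LinearMap.range e).restrictScalars k := by
      rintro n ⟨_, x, rfl⟩
      exact ⟨p n x, he.map_proj hp1 hp2 hp1 hp2 n x⟩
    refine isInternal_of_proj _ (fun n =>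
      (p n ∘ₗ (LinearMap.range e).subtype.restrictScalars k).codRestrict
        ((LinearMap.range e).restrictScalars k) (hmem n)) ?_ ?_ ?_
    · exact fun n x hx => Subtype.ext (hp1 n x hx)
    · exact fun m n hmn x hx => Subtype.ext (hp2 m n hmn x hx)
    · rw [eq_top_iff]
      intro x _
      obtain ⟨s, hs⟩ := hp3 (x : M)
      have hx : x = ∑ n ∈ s, (⟨p n x, hmem n x⟩ : LinearMap.range e) := by
        apply Subtype.ext
        rw [AddSubmonoidClass.coe_finsetSum]
        exact hs.symm
      rw [hx]
      exact sum_mem fun n _ => Submodule.mem_iSup_of_mem n (hp n x)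
  smul_mem i n a x ha hx := M.smul_mem i n a x ha hx

/-! ### Splitting graded idempotents. -/

section Image

variable {M N : GrMod 𝒜} {e : M →ₗ[Aᵐᵒᵖ] M} (he : IsGraded e) (hee : ∀ x, e (e x) = e x)

/-- The inclusion of the image of an idempotent. -/
def imageIncl : M.image e he hee →ₗ[Aᵐᵒᵖ] M := (LinearMap.range e).subtype

/-- The projection to the image of an idempotent. -/
def imageProj : M →ₗ[Aᵐᵒᵖ] M.image e he hee := e.rangeRestrict

theorem imageIncl_injective : Function.Injective (imageIncl he hee) := Subtype.val_injective

theorem imageIncl_imageProj (x : M) : imageIncl he hee (imageProj he hee x) = e x := rfl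

theorem imageProj_surjective : Function.Surjective (imageProj he hee) :=
  e.surjective_rangeRestrict

theorem apply_imageIncl (x : M.image e he hee) : e (imageIncl he hee x) = imageIncl he hee x := by
  obtain ⟨y, rfl⟩ := imageProj_surjective he hee x
  rw [imageIncl_imageProj, hee]

theorem imageProj_imageIncl (x : M.image e he hee) : imageProj he hee (imageIncl he hee x) = x :=
  imageIncl_injective he hee (apply_imageIncl he hee x)

theorem imageIncl_isGraded : IsGraded (imageIncl he hee) := fun _ _ hx => hx

theorem imageProj_isGraded : IsGraded (imageProj he hee) := fun n x hx => he n x hx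

theorem image_projective (hM : Module.Projective Aᵐᵒᵖ M) :
    Module.Projective Aᵐᵒᵖ (M.image e he hee) :=
  Module.Projective.of_split (imageIncl he hee) (imageProj he hee)
    (LinearMap.ext (imageProj_imageIncl he hee))

theorem GrMod.GeneratedInDegree.of_surjective {n : ℤ} (hM : M.GeneratedInDegree n)
    {f : M →ₗ[Aᵐᵒᵖ] N} (hf : IsGraded f) (hs : Function.Surjective f) :
    N.GeneratedInDegree n := by
  refine eq_top_iff.2 fun y _ => ?_
  obtain ⟨x, rfl⟩ := hs y
  have hx : x ∈ Submodule.span Aᵐᵒᵖ (M.gr n : Set M) := hM ▸ Submodule.mem_top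
  have hle : Submodule.span Aᵐᵒᵖ (M.gr n : Set M) ≤
      (Submodule.span Aᵐᵒᵖ (N.gr n : Set N)).comap f :=
    Submodule.span_le.2 fun x hx => Submodule.subset_span (hf n x hx)
  exact hle hx

end Image

/-- A retract of a graded module with a linear resolution has a linear resolution. -/
theorem GrProjRes.IsLinear.retract {M N : GrMod 𝒜} {R : GrProjRes M} (hR : R.IsLinear)
    {i : N →ₗ[Aᵐᵒᵖ] M} (hi : IsGraded i) {r : M →ₗ[Aᵐᵒᵖ] N} (hr : IsGraded r)
    (hri : ∀ x, r (i x) = x) : ∃ S : GrProjRes N, S.IsLinear := by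
  obtain ⟨φ, hφ, hφ0, hφd⟩ := exists_chainMap R R (hi.comp hr)
  -- The chain map φ² - φ lifts (i r)² - i r = 0, so by linearity it vanishes identically and not
  -- merely up to homotopy.
  have hφφ : ∀ j x, φ j (φ j x) = φ j x := fun j x => by
    have h := hR.chainMap_eq_zero (φ := fun j => φ j ∘ₗ φ j - φ j)
      (fun j => ((hφ j).comp (hφ j)).sub (hφ j)) (fun x => by simp [hφ0, hri])
      (fun j x => by simp [hφd]) j
    exact sub_eq_zero.1 (LinearMap.congr_fun h x)
  let incl := fun j => imageIncl (hφ j) (hφφ j)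
  let proj := fun j => imageProj (hφ j) (hφφ j)
  have hinj : ∀ j, Function.Injective (incl j) := fun j => imageIncl_injective _ _
  have hproj : ∀ j x, incl j (proj j x) = φ j x := fun j x => rfl
  have hincl : ∀ j x, φ j (incl j x) = incl j x := fun j => apply_imageIncl _ _
  have hsurj : ∀ j, Function.Surjective (proj j) := fun j => imageProj_surjective _ _
  -- The differential carries the image of φ into itself because φ is a chain map; the projection in
  -- the new differential therefore changes nothing.
  have hd : ∀ j x, incl j (proj j (R.d j (incl (j + 1) x))) = R.d j (incl (j + 1) x) :=
    fun j x => by rw [hproj, ← hφd, hincl]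
  have hε : ∀ x, i (r (R.ε (incl 0 x))) = R.ε (incl 0 x) := fun x => by
    have := hφ0 (incl 0 x)
    rw [hincl] at this
    exact this.symm
  have hii : Function.Injective i := Function.LeftInverse.injective hri
  refine ⟨{ P := fun j => (R.P j).image (φ j) (hφ j) (hφφ j)
            d := fun j => proj j ∘ₗ R.d j ∘ₗ incl (j + 1)
            ε := r ∘ₗ R.ε ∘ₗ incl 0
            projective := fun j => image_projective _ _ (R.projective j)
            d_mem := fun j => (imageProj_isGraded (hφ j) (hφφ j)).comp
              ((show IsGraded (R.d j) from R.d_mem j).comp (imageIncl_isGraded _ _))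
            ε_mem := hr.comp ((show IsGraded R.ε from R.ε_mem).comp (imageIncl_isGraded _ _))
            ε_surjective := fun y => ?_
            exact_zero := fun x => ⟨fun hx => ?_, ?_⟩
            exact_succ := fun j x => ⟨fun hx => ?_, ?_⟩ },
    fun j => (hR j).of_surjective (imageProj_isGraded (hφ j) (hφφ j)) (hsurj j)⟩
  · obtain ⟨x, hx⟩ := R.ε_surjective (i y)
    refine ⟨proj 0 x, ?_⟩
    change r (R.ε (incl 0 (proj 0 x))) = y
    rw [hproj, hφ0, hx, LinearMap.comp_apply, hri, hri]
  · have hx' : R.ε (incl 0 x) = 0 := by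
      rw [← hε]
      exact (congrArg i hx).trans (map_zero i)
    obtain ⟨z, hz⟩ := (R.exact_zero _).1 hx'
    -- A preimage z found in R need not lie in the image of φ, but φ z does and is again a preimage:
    -- d φ z = φ d z = φ x = x.
    refine ⟨proj 1 z, hinj 0 ?_⟩
    change incl 0 (proj 0 (R.d 0 (incl 1 (proj 1 z)))) = incl 0 x
    rw [hd, hproj, hφd, hz, hincl]
  · rintro ⟨z, rfl⟩
    change r (R.ε (incl 0 (proj 0 (R.d 0 (incl 1 z))))) = 0
    rw [hd, R.ε_d, map_zero]
  · have hx' : R.d j (incl (j + 1) x) = 0 := by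
      rw [← hd]
      exact (congrArg (incl j) hx).trans (map_zero (incl j))
    obtain ⟨z, hz⟩ := (R.exact_succ j _).1 hx'
    refine ⟨proj (j + 2) z, hinj (j + 1) ?_⟩
    change incl (j + 1) (proj (j + 1) (R.d (j + 1) (incl (j + 2) (proj (j + 2) z)))) =
      incl (j + 1) x
    rw [hd, hproj, hφd, hz, hincl]
  · rintro ⟨z, rfl⟩
    change proj j (R.d j (incl (j + 1) (proj (j + 1) (R.d (j + 1) (incl (j + 2) z))))) = 0
    rw [hd, R.d_d, map_zero]

/-- Transport of a resolution along an isomorphism. -/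
def GrProjRes.ofEquiv {M N : GrMod 𝒜} (R : GrProjRes M) (u : M ≃ₗ[Aᵐᵒᵖ] N)
    (hu : IsGraded u.toLinearMap) : GrProjRes N where
  P := R.P
  d := R.d
  ε := u.toLinearMap ∘ₗ R.ε
  projective := R.projective
  d_mem := R.d_mem
  ε_mem := hu.comp R.ε_mem
  ε_surjective := u.surjective.comp R.ε_surjective
  exact_zero := fun x => by
    rw [← R.exact_zero x]
    exact u.map_eq_zero_iff
  exact_succ := R.exact_succ

end Linear

/-! ### Restriction of modules over the skew group algebra -/

section Restriction

/-- A projective S-module is a retract of a free one, which over R is a direct sum of copies of the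
projective module S. -/
theorem projective_compHom {R S P : Type*} [Ring R] [Ring S] [AddCommGroup P] [Module S P]
    (i : R →+* S) (hS : let _ := Module.compHom S i; Module.Projective R S)
    (hP : Module.Projective S P) : let _ := Module.compHom P i; Module.Projective R P := by
  intro _
  let _ := Module.compHom S i
  have : Module.Projective R S := hS
  classical
  have : Module.Projective R (P →₀ S) :=
    Module.Projective.of_equiv (finsuppLequivDFinsupp (ι := P) (M := S) R).symm
  obtain ⟨s, hs⟩ := hP.out
  let s' : P →ₗ[R] P →₀ S :=
    { s.toAddMonoidHom with map_smul' := fun a x => s.map_smul (i a) x }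
  let l' : (P →₀ S) →ₗ[R] P :=
    { (Finsupp.linearCombination S id).toAddMonoidHom with
      map_smul' := fun a x => (Finsupp.linearCombination S id).map_smul (i a) x }
  exact Module.Projective.of_split s' l' (LinearMap.ext hs)

variable {𝒜 : ℕ → Submodule k A} {G : Subgroup (GrAut 𝒜)}

/-- The skew group algebra is free as a right `A`-module. -/
theorem projective_skewGrp [Finite G] :
    let _ := resModule G (SkewGrp 𝒜 G)ᵐᵒᵖ; Module.Projective Aᵐᵒᵖ (SkewGrp 𝒜 G)ᵐᵒᵖ := by
  intro _
  -- The group elements form a basis of A * G as a right A-module: (1 * g)(a * 1) = g(a) * g, whence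
  -- the twist g • c g.
  let f : (G → Aᵐᵒᵖ) →ₗ[Aᵐᵒᵖ] (SkewGrp 𝒜 G)ᵐᵒᵖ :=
    { toFun := fun c => op ⟨Finsupp.equivFunOnFinite.symm fun g => g • unop (c g)⟩
      map_add' := fun c c' => unop_injective (SkewMonoidAlgebra.ext fun g => by
        rw [unop_add, SkewMonoidAlgebra.coeff_add, Finsupp.add_apply]
        exact smul_add g _ _)
      map_smul' := fun a c => unop_injective (SkewMonoidAlgebra.ext fun g => by
        change g • (unop (c g) * unop a) = ((⟨Finsupp.equivFunOnFinite.symm fun g =>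
          g • unop (c g)⟩ : SkewGrp 𝒜 G) * SkewMonoidAlgebra.single 1 (unop a)).coeff g
        rw [SkewMonoidAlgebra.coeff_mul_single_one, smul_mul']
        rfl) }
  refine Module.Projective.of_equiv (LinearEquiv.ofBijective f ⟨fun c c' h => funext fun g => ?_,
    fun b => ⟨fun g => op (g⁻¹ • (unop b).coeff g), unop_injective
      (SkewMonoidAlgebra.ext fun g => smul_inv_smul g _)⟩⟩)
  have : g • unop (c g) = g • unop (c' g) :=
    congrArg (fun b : (SkewGrp 𝒜 G)ᵐᵒᵖ => (unop b).coeff g) h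
  exact unop_injective (smul_left_cancel g this)

variable [GradedAlgebra 𝒜]

/-- The restriction of a graded module over the skew group algebra to `A`. -/
def Res (N : GrMod (skewGr 𝒜 G)) : GrMod 𝒜 where
  carrier := N
  module := resModule G N
  isScalarTower := let _ := resModule G N
    ⟨fun r a x => by
      change op (SkewMonoidAlgebra.single (1 : G) (r • unop a)) • x =
        r • op (SkewMonoidAlgebra.single (1 : G) (unop a)) • x
      rw [← SkewMonoidAlgebra.smul_single, op_smul, smul_assoc]⟩
  gr := N.gr
  isInternal := N.isInternal
  smul_mem i n a x ha hx := N.smul_mem i n _ x (single_mem_skewGr 𝒜 G 1 ha) hx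

namespace Res

variable {N K : GrMod (skewGr 𝒜 G)}

/-- Restriction of linear maps. -/
def resMap (f : N →ₗ[(SkewGrp 𝒜 G)ᵐᵒᵖ] K) : Res N →ₗ[Aᵐᵒᵖ] Res K :=
  { f.toAddMonoidHom with
    map_smul' := fun a x => f.map_smul (op (SkewMonoidAlgebra.single 1 (unop a))) x }

/-- The A-span of the degree n part is already stable under G: group elements have degree 0, so they
preserve that part, and they can be moved to the left of scalars in A. -/
theorem generatedInDegree {n : ℤ} (hN : N.GeneratedInDegree n) :
    (Res N).GeneratedInDegree n := by
  let T : Submodule Aᵐᵒᵖ (Res N) := Submodule.span Aᵐᵒᵖ ((Res N).gr n : Set (Res N))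
  have hmul : ∀ (h : G) (a : A), (SkewMonoidAlgebra.single h a : SkewGrp 𝒜 G) =
      SkewMonoidAlgebra.single h 1 * SkewMonoidAlgebra.single 1 (h⁻¹ • a) := fun h a => by
    rw [SkewMonoidAlgebra.single_mul_single, smul_inv_smul, mul_one, one_mul]
  have hone : ∀ (a : A) (x : N), x ∈ T →
      (op (SkewMonoidAlgebra.single 1 a : SkewGrp 𝒜 G) • x : N) ∈ T :=
    fun a x hx => T.smul_mem (op a) hx
  have hgrp : ∀ (h : G) (x : N), x ∈ T →
      (op (SkewMonoidAlgebra.single h 1 : SkewGrp 𝒜 G) • x : N) ∈ T := by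
    intro h x hx
    change x ∈ Submodule.span Aᵐᵒᵖ ((Res N).gr n : Set (Res N)) at hx
    induction hx using Submodule.span_induction with
    | mem x hx =>
      refine Submodule.subset_span ?_
      have := N.smul_mem 0 n _ x (single_mem_skewGr 𝒜 G h SetLike.GradedOne.one_mem) hx
      rwa [Nat.cast_zero, add_zero] at this
    | zero =>
      have : (op (SkewMonoidAlgebra.single h 1 : SkewGrp 𝒜 G) • (0 : N) : N) = 0 := smul_zero _
      exact (congrArg (· ∈ T) this).mpr T.zero_mem
    | add x y _ _ hx hy =>
      have := smul_add (op (SkewMonoidAlgebra.single h 1 : SkewGrp 𝒜 G)) (x : N) (y : N)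
      exact (congrArg (· ∈ T) this).mpr (T.add_mem hx hy)
    | smul a x _ hx =>
      -- Here x · a · h = (x · h) · h⁻¹(a), and x · h lies in the span by induction.
      have := hone (h⁻¹ • unop a) _ hx
      rw [smul_smul, ← op_mul, ← hmul] at this
      change (op (SkewMonoidAlgebra.single h 1 : SkewGrp 𝒜 G) •
        op (SkewMonoidAlgebra.single 1 (unop a) : SkewGrp 𝒜 G) • (show N from x) : N) ∈ T
      rwa [smul_smul, ← op_mul, SkewMonoidAlgebra.single_mul_single, one_mul, one_smul, mul_one]
  have hall : ∀ (b : SkewGrp 𝒜 G) (x : N), x ∈ T → (op b • x : N) ∈ T := by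
    intro b x hx
    induction b using SkewMonoidAlgebra.induction_on with
    | zero =>
      have : (op (0 : SkewGrp 𝒜 G) • x : N) = 0 := by rw [op_zero, zero_smul]
      exact (congrArg (· ∈ T) this).mpr T.zero_mem
    | add b c hb hc =>
      have : (op (b + c) • x : N) = op b • x + op c • x := by rw [op_add, add_smul]
      exact (congrArg (· ∈ T) this).mpr (T.add_mem hb hc)
    | single h a =>
      have : (op (SkewMonoidAlgebra.single h a : SkewGrp 𝒜 G) • x : N) =
          op (SkewMonoidAlgebra.single 1 (h⁻¹ • a) : SkewGrp 𝒜 G) •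
            op (SkewMonoidAlgebra.single h 1 : SkewGrp 𝒜 G) • x := by
        rw [smul_smul, ← op_mul, ← hmul]
      exact (congrArg (· ∈ T) this).mpr (hone _ _ (hgrp h x hx))
  let T' : Submodule (SkewGrp 𝒜 G)ᵐᵒᵖ N :=
    { T.toAddSubmonoid with smul_mem' := fun b x hx => hall (unop b) x hx }
  have hle : Submodule.span (SkewGrp 𝒜 G)ᵐᵒᵖ (N.gr n : Set N) ≤ T' :=
    Submodule.span_le.2 fun x hx => Submodule.subset_span (R := Aᵐᵒᵖ) (M := Res N) hx
  refine eq_top_iff.2 fun x _ => ?_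
  exact hle (hN ▸ Submodule.mem_top : (show N from x) ∈ _)

/-- Restriction of resolutions. -/
def resRes [Finite G] (R : GrProjRes N) : GrProjRes (Res N) where
  P i := Res (R.P i)
  d i := resMap (R.d i)
  ε := resMap R.ε
  projective i := projective_compHom (P := R.P i)
    (RingHom.op (SkewMonoidAlgebra.singleOneRingHom : A →+* SkewGrp 𝒜 G)) projective_skewGrp
    (R.projective i)
  d_mem := R.d_mem
  ε_mem := R.ε_mem
  ε_surjective := R.ε_surjective
  exact_zero := R.exact_zero
  exact_succ := R.exact_succ

end Res

/-- The inclusion of `A₀` in `(A * G)₀`. -/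
def degZeroToRes (G : Subgroup (GrAut 𝒜)) [Finite G] : degZero 𝒜 →ₗ[Aᵐᵒᵖ] Res (degZero (skewGr 𝒜 G)) where
  toFun := fun c : 𝒜 0 => degZeroIncl G c
  map_add' := fun c c' : 𝒜 0 => map_add (degZeroIncl G) c c'
  map_smul' := fun a (c : 𝒜 0) => Subtype.ext (by
    change SkewMonoidAlgebra.single 1 ((c : A) * (GradedRing.projZeroRingHom' 𝒜 (unop a) : A)) =
      SkewMonoidAlgebra.single 1 (c : A) * (GradedRing.projZeroRingHom' (skewGr 𝒜 G)
        (SkewMonoidAlgebra.single 1 (unop a)) : SkewGrp 𝒜 G)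
    rw [projZero_single, SkewMonoidAlgebra.single_mul_single, one_smul, one_mul])

/-- The projection of `(A * G)₀` to `A₀`. -/
def resToDegZero (G : Subgroup (GrAut 𝒜)) [Finite G] :
    Res (degZero (skewGr 𝒜 G)) →ₗ[Aᵐᵒᵖ] degZero 𝒜 where
  toFun := fun c : skewGr 𝒜 G 0 => (⟨(c : SkewGrp 𝒜 G).coeff 1, c.2 1⟩ : 𝒜 0)
  map_add' := fun c c' : skewGr 𝒜 G 0 => Subtype.ext
    (congrArg (fun f => f 1) (SkewMonoidAlgebra.coeff_add (c : SkewGrp 𝒜 G) c'))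
  map_smul' := fun a (c : skewGr 𝒜 G 0) => Subtype.ext (by
    change ((c : SkewGrp 𝒜 G) * (GradedRing.projZeroRingHom' (skewGr 𝒜 G)
        (SkewMonoidAlgebra.single 1 (unop a)) : SkewGrp 𝒜 G)).coeff 1 =
      (c : SkewGrp 𝒜 G).coeff 1 * (GradedRing.projZeroRingHom' 𝒜 (unop a) : A)
    rw [projZero_single, SkewMonoidAlgebra.coeff_mul_single_one, one_smul])

theorem resToDegZero_degZeroToRes [Finite G] (c : degZero 𝒜) : resToDegZero G (degZeroToRes G c) = c :=
  Subtype.ext (Finsupp.single_eq_same (a := (1 : G)) (b := ((show 𝒜 0 from c) : A)))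

/-- Going up, the linear resolution is induced. Going down, the restricted resolution resolves (A *
G)₀ over A, and A₀ is a retract of that module through the coefficient at 1. -/
theorem isKoszul_iff [Fintype G] (hG : (Fintype.card G : k) ≠ 0) :
    IsKoszul 𝒜 ↔ IsKoszul (skewGr 𝒜 G) := by
  constructor
  · rintro ⟨hfin, hss, R, hR⟩
    exact ⟨fun i => finite_skewGr (hfin i), isSemisimpleRing_skewGr_zero hG hss,
      (indRes G R).ofEquiv (degZeroEquivInd G).symm degZeroEquivInd_symm_isGraded,
      fun i => Ind.generatedInDegree (hR i)⟩
  · rintro ⟨hfin, hss, R, hR⟩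
    refine ⟨fun i => finite_of_skewGr (hfin i), isSemisimpleRing_of_skewGr_zero hss, ?_⟩
    have hl : (Res.resRes R).IsLinear := fun i => Res.generatedInDegree (hR i)
    exact hl.retract (i := degZeroToRes G) (r := resToDegZero G)
      (isGraded_of_concentrated _ (fun _ => degZero_gr_of_ne) degZero_gr_zero)
      (isGraded_of_concentrated _ (fun _ => degZero_gr_of_ne (𝒜 := skewGr 𝒜 G)) degZero_gr_zero)
      resToDegZero_degZeroToRes

end Restriction

end

end SkewKoszul

theorem mainTheorem9 {k : Type v} [Field k] [IsAlgClosed k] {A : Type u} [Ring A] [Algebra k A]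
    (𝒜 : ℕ → Submodule k A) [GradedAlgebra 𝒜] (G : Subgroup (GrAut 𝒜)) [Fintype G]
    (hG : ¬ ringChar k ∣ Fintype.card G)
    (hres : ∃ R : GrProjRes (degZeroSkew 𝒜 G),
      ∀ i, Module.Finite (SkewGrp 𝒜 G)ᵐᵒᵖ (R.P i)) :
    (∃ e : KoszulDual (skewGr 𝒜 G) ≃ₐ[k] LeftSkew G (KoszulDual 𝒜),
      (∀ p, (KoszulDual.grade (skewGr 𝒜 G) p).map e.toLinearMap =
        LeftSkew.extend G (KoszulDual.grade 𝒜 p)) ∧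
      (∀ p n, (KoszulDual.bigrade (skewGr 𝒜 G) p n).map e.toLinearMap =
        LeftSkew.extend G (KoszulDual.bigrade 𝒜 p n))) ∧
    (IsKoszul 𝒜 ↔ IsKoszul (skewGr 𝒜 G)) := by
  have hG' : (Fintype.card G : k) ≠ 0 := fun h => hG ((ringChar.spec k _).1 h)
  exact ⟨exists_koszulDual_equiv, isKoszul_iff hG'⟩
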